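/- **Setting.** Let $(y_i,x_i)_{i\ge 1}$ be i.i.d. copies of $(Y,X)$ with $Y$ real and $X\in\mathbb R^d$, $d\ge1$, and let $\mathcal X$ be the support of $X$. Let $\nu$ be a locally finite Borel measure on $\mathbb R^d$ (for example Lebesgue measure, possibly with point masses in some coordinates), let $f_X$ be the density of $X$ with respect to $\nu$, let $f_{Y|X}(\cdot\mid x)$ be a conditional density of $Y$ given $X=x$ (a probability density for every $x\in\mathcal X$), so that $f_{Y,X}(y,x)=f_{Y|X}(y\mid x)f_X(x)$ is the joint density with respect to $dy\otimes\nu$, and let $f_Y$ be the Lebesgue density of $Y$. Let $\tau\in(0,1)$, $\epsilon\in(0,\tfrac12)$, $I=[\epsilon,1-\epsilon]$; $Q_Y[\tau]$ and $Q_Y[\eta\mid X=x]$ denote the unconditional and the conditional quantiles, defined as $\inf\{q: F(q)\ge\cdot\}$. Let $\xi_\tau$ be the matching function: for every $x\in\mathcal X$, $\xi_\tau(x)\in I$ and $Q_Y[\xi_\tau(x)\mid X=x]=Q_Y[\tau]$. **Estimators.** With $\rho_p(u)=u(p-1[u<0])$, let $\hat\beta(\eta)$, $\eta\in I$, be a minimizer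 of $b\mapsto\frac1n\sum_{i\le n}\rho_\eta(y_i-x_i'b)$ and $\hat Q_Y[\tau]$ a minimizer of $q\mapsto\frac1n\sum_{i\le n}\rho_\tau(y_i-q)$. Let $\epsilon=\eta_1<\dots<\eta_m=1-\epsilon$ be a grid (depending on $n$). Let $\hat\xi_\tau(x)$ be $\epsilon$ if $\hat Q_Y[\tau]<x'\hat\beta(\eta_1)$; $\eta_j$ if $x'\hat\beta(\eta_j)\le\hat Q_Y[\tau]<x'\hat\beta(\eta_{j+1})$, $1\le j<m$; and $\eta_m$ if $x'\hat\beta(\eta_m)\le\hat Q_Y[\tau]$ (any admissible value if several cases apply). Let $K_h(u)=h^{-1}K(u/h)$. The feasible and the oracle estimators are $$\widehat{UQPE}(\tau)=\frac{\sum_{i\le n}K_h(y_i-\hat Q_Y[\tau])\,\hat\beta_1(\hat\xi_\tau(x_i))}{\sum_{i\le n}K_h(y_i-\hat Q_Y[\tau])},\qquad \widetilde{UQPE}(\tau)=\frac{\sum_{i\le n}K_h(y_i-Q_Y[\tau])\,\beta_1(\xi_\tau(x_i))}{\sum_{i\le n}K_h(y_i-Q_Y[\tau])}.$$ **Assumptions.**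 1. (Matching) (a) $Q_Y[\eta\mid X=x]=x'\beta(\eta)$ for $x\in\mathcal X$, $\eta\in I$, and $E|X|<\infty$. (b) There is $c>0$ with $f_{Y|X}(y\mid x)\ge c$ for all $x\in\mathcal X$ and $y\in[x'\beta(\epsilon),x'\beta(1-\epsilon)]$. (c) For $\eta\in I$ the matrix $J(\eta)=E[f_{Y|X}(X'\beta(\eta)\mid X)XX']$ exists and is invertible, $J$ is differentiable on $I$ with bounded derivative, and, uniformly in $\eta\in I$, $\hat\beta(\eta)-\beta(\eta)=J(\eta)^{-1}\frac1n\sum_{i\le n}(\eta-1\{y_i\le x_i'\beta(\eta)\})x_i+o_p(n^{-1/2})$. (d) $\hat Q_Y[\tau]-Q_Y[\tau]=f_Y(Q_Y[\tau])^{-1}\frac1n\sum_{i\le n}(\tau-1\{y_i\le Q_Y[\tau]\})+o_p(n^{-1/2})$. (e) $\max_j(\eta_j-\eta_{j-1})=o(n^{-1/2})$. 2. (Kernel) $r\ge2$ is an integer; $K$ is symmetric about $0$ and twice differentiable; $\int K=1$; $\int u^jK(u)\,du=0$ for $1\le j\le r-1$; $\int|u|^r|K(u)|\,du<\infty$; $K'$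 is integrable with $\int K'=0$; $u^jK(u)\to0$ as $u\to\pm\infty$ for $1\le j\le r+1$; $K'$ and $K''$ are bounded; $K'(u)^2$ and $uK'(u)^2$ are integrable. 3. (Bandwidth) $h=h_n$ is of exact order $n^{-a}$ ($c_1n^{-a}\le h_n\le c_2n^{-a}$ for all large $n$, with constants $c_1,c_2>0$), where $1/(1+2r)\le a<1/2$. 4. (Smoothness) $f_Y$ is $r+1$ times continuously differentiable with bounded derivatives; for every $x\in\mathcal X$, $y\mapsto f_{Y,X}(y,x)$ is $r+1$ times continuously differentiable, with derivatives bounded uniformly in $y\in\mathbb R$ and $x\in\mathcal X$. 5. (Uniformity) (i) Uniformly in $x\in\mathcal X$, $\hat\xi_\tau(x)-\xi_\tau(x)=f_{Y|X}(x'\beta(\xi_\tau(x))\mid x)\big[-x'(\hat\beta(\xi_\tau(x))-\beta(\xi_\tau(x)))+(\hat Q_Y[\tau]-Q_Y[\tau])\big]+o_p(n^{-1/2})$; (ii) $\beta_1$ is differentiable on $I$ with bounded derivative, and $f_{Y|X}$ is bounded on $\mathbb R\times\mathcal X$. **Theorem.** Under these assumptions, as $n\to\infty$, $$\widehat{UQPE}(\tau)=\widetilde{UQPE}(\tau)+o_p\big(n^{-1/2}h^{-1/2}\big).$$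 -/

import Mathlib

open MeasureTheory ProbabilityTheory Filter Topology Set
open scoped Matrix

noncomputable section

namespace UQPE

/-! ### Stochastic orders

Probabilities of sets that need not be measurable are outer probabilities, as is customary for
suprema of processes; no measurability of estimators is required. -/

/-- `Z n = o_p(r n)`. -/
def IsLittleOp {Ω F : Type*} [MeasurableSpace Ω] [Norm F] (μ : Measure Ω)
    (Z : ℕ → Ω → F) (r : ℕ → ℝ) : Prop :=
  ∀ δ : ℝ, 0 < δ → Tendsto (fun n => μ {ω | δ * r n < ‖Z n ω‖}) atTop (𝓝 0)

/-- `Z n t = o_p(r n)` uniformly in `t ∈ T`, that is `sup_{t ∈ T} ‖Z n t‖ = o_p(r n)`. -/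
def IsUniformLittleOp {Ω ι F : Type*} [MeasurableSpace Ω] [Norm F] (μ : Measure Ω)
    (T : Set ι) (Z : ℕ → ι → Ω → F) (r : ℕ → ℝ) : Prop :=
  ∀ δ : ℝ, 0 < δ → Tendsto (fun n => μ {ω | ∃ t ∈ T, δ * r n < ‖Z n t ω‖}) atTop (𝓝 0)

/-! ### Quantiles and the matching map -/

/-- The `p`-quantile `inf {q : m (-∞, q] ≥ p}` of a probability measure `m` on the line. -/
def quantile (m : Measure ℝ) (p : ℝ) : ℝ :=
  sInf {q : ℝ | ENNReal.ofReal p ≤ m (Iic q)}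

/-- The law of `Y` given `X = x`, where `f y x` is the conditional density of `Y` at `y` given
`X = x`. -/
def condLaw {d : ℕ} (f : ℝ → (Fin d → ℝ) → ℝ) (x : Fin d → ℝ) : Measure ℝ :=
  volume.withDensity fun y => ENNReal.ofReal (f y x)

/-- The matching map: all `η ∈ (0,1)` with `Q_Y[η | X = x] = Q_Y[τ]`, where `Q = Q_Y[τ]`. -/
def matchingSet {d : ℕ} (f : ℝ → (Fin d → ℝ) → ℝ) (Q : ℝ) (x : Fin d → ℝ) : Set ℝ :=
  {η | η ∈ Ioo (0 : ℝ) 1 ∧ quantile (condLaw f x) η = Q}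

/-! ### Estimators -/

/-- The check function `ρ_p(u) = u (p - 1[u < 0])`. -/
def checkFn (p u : ℝ) : ℝ := u * (p - if u < 0 then 1 else 0)

/-- `b` is a `p`-quantile-regression coefficient of the sample `(y_i, x_i)`, `i < n`. -/
def IsQRCoef {d : ℕ} (n : ℕ) (y : ℕ → ℝ) (x : ℕ → Fin d → ℝ) (p : ℝ) (b : Fin d → ℝ) : Prop :=
  IsMinOn (fun b' : Fin d → ℝ => (n : ℝ)⁻¹ * ∑ i ∈ Finset.range n, checkFn p (y i - x i ⬝ᵥ b'))
    univ b

/-- `q` is a `p`-sample-quantile of `y_i`, `i < n`. -/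
def IsSampleQuantile (n : ℕ) (y : ℕ → ℝ) (p q : ℝ) : Prop :=
  IsMinOn (fun q' : ℝ => (n : ℝ)⁻¹ * ∑ i ∈ Finset.range n, checkFn p (y i - q')) univ q

/-- `e` is a value of the estimated matching function at `x`, for the grid
`g 0 < ⋯ < g m`, the estimated coefficients `b` and the estimated unconditional quantile `q`.
If the estimated conditional quantiles cross, several values may be admissible, and any of them
may be chosen. -/
def IsMatch {d m : ℕ} (ε : ℝ) (g : Fin (m + 1) → ℝ) (b : ℝ → Fin d → ℝ) (q : ℝ)
    (x : Fin d → ℝ) (e : ℝ) : Prop :=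
  (q < x ⬝ᵥ b (g 0) ∧ e = ε) ∨
  (∃ j : Fin m, x ⬝ᵥ b (g j.castSucc) ≤ q ∧ q < x ⬝ᵥ b (g j.succ) ∧ e = g j.castSucc) ∨
  (x ⬝ᵥ b (g (Fin.last m)) ≤ q ∧ e = g (Fin.last m))

/-- The rescaled kernel `K_h(u) = K(u / h) / h`. -/
def rescale (K : ℝ → ℝ) (h u : ℝ) : ℝ := h⁻¹ * K (u / h)

/-- The Nadaraya–Watson regression of `w_i` on `y_i`, `i < n`, evaluated at `q`. -/
def nadarayaWatson (K : ℝ → ℝ) (h : ℝ) (n : ℕ) (y w : ℕ → ℝ) (q : ℝ) : ℝ :=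
  (∑ i ∈ Finset.range n, rescale K h (y i - q) * w i) /
    ∑ i ∈ Finset.range n, rescale K h (y i - q)

/-! ### Assumptions -/

/-- `(y_i, x_i)`, `i = 0, 1, …`, are independent and identically distributed. -/
structure IsRandomSample {Ω : Type*} [MeasurableSpace Ω] {d : ℕ} (μ : Measure Ω)
    (y : ℕ → Ω → ℝ) (x : ℕ → Ω → Fin d → ℝ) : Prop where
  measurable_y : ∀ i, Measurable (y i)
  measurable_x : ∀ i, Measurable (x i)
  indep : iIndepFun (fun i ω => (y i ω, x i ω)) μ
  identDistrib : ∀ i, IdentDistrib (fun ω => (y i ω, x i ω)) (fun ω => (y 0 ω, x 0 ω)) μ μ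

/-- `fX` is the density of `X` with respect to `ν`, `f y x` is a conditional density of `Y` given
`X = x` (for every `x` in the support of `X`), so that `f y x * fX x` is the joint density of
`(Y, X)` with respect to `dy ⊗ ν`, and `fY` is the density of `Y`. The measure `ν` on the
covariate space may have discrete components, since a covariate may be a constant. -/
structure HasDensities {Ω : Type*} [MeasurableSpace Ω] {d : ℕ} (μ : Measure Ω)
    (Y : Ω → ℝ) (X : Ω → Fin d → ℝ) (ν : Measure (Fin d → ℝ))
    (fX : (Fin d → ℝ) → ℝ) (f : ℝ → (Fin d → ℝ) → ℝ) (fY : ℝ → ℝ) : Prop where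
  measurable_fX : Measurable fX
  measurable_f : Measurable fun p : ℝ × (Fin d → ℝ) => f p.1 p.2
  measurable_fY : Measurable fY
  fX_nonneg : ∀ x, 0 ≤ fX x
  f_nonneg : ∀ y x, 0 ≤ f y x
  fY_nonneg : ∀ y, 0 ≤ fY y
  joint : μ.map (fun ω => (Y ω, X ω)) =
    (volume.prod ν).withDensity fun p => ENNReal.ofReal (f p.1 p.2 * fX p.2)
  marginal : μ.map Y = volume.withDensity fun y => ENNReal.ofReal (fY y)
  cond : ∀ x ∈ (μ.map X).support, IsProbabilityMeasure (condLaw f x)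

/-- The matrix `J(η) = E[f_{Y|X}(X'β(η) | X) X X']`. -/
def J {Ω : Type*} [MeasurableSpace Ω] {d : ℕ} (μ : Measure Ω) (X : Ω → Fin d → ℝ)
    (f : ℝ → (Fin d → ℝ) → ℝ) (β : ℝ → Fin d → ℝ) (η : ℝ) : Matrix (Fin d) (Fin d) ℝ :=
  Matrix.of fun i j => ∫ ω, f (X ω ⬝ᵥ β η) (X ω) * (X ω i * X ω j) ∂μ

/-- The influence function `Ψ_i(η) = J(η)⁻¹ (η - 1{y_i ≤ x_i'β(η)}) x_i`, as a function of the
observation `(y_i, x_i) = (y, x)`. -/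
def influenceQR {d : ℕ} (Jη : Matrix (Fin d) (Fin d) ℝ) (b : Fin d → ℝ) (η : ℝ)
    (y : ℝ) (x : Fin d → ℝ) : Fin d → ℝ :=
  Jη⁻¹ *ᵥ ((η - if y ≤ x ⬝ᵥ b then 1 else 0) • x)

/-- The influence function `ψ_i(τ) = f_Y(Q)⁻¹ (τ - 1{y_i ≤ Q})` with `Q = Q_Y[τ]`, as a function
of the observation `y_i = y`. -/
def influenceUQ (fYQ Q τ y : ℝ) : ℝ := fYQ⁻¹ * (τ - if y ≤ Q then 1 else 0)

/-- The assumption on the quantile regression model and on the first-step estimators. -/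
structure MatchingAssumption {Ω : Type*} [MeasurableSpace Ω] {d : ℕ} (μ : Measure Ω)
    (y : ℕ → Ω → ℝ) (x : ℕ → Ω → Fin d → ℝ)
    (f : ℝ → (Fin d → ℝ) → ℝ) (fY : ℝ → ℝ) (τ ε : ℝ) (β : ℝ → Fin d → ℝ)
    (βhat : ℕ → ℝ → Ω → Fin d → ℝ) (Qhat : ℕ → Ω → ℝ)
    (m : ℕ → ℕ) (grid : (n : ℕ) → Fin (m n + 1) → ℝ) : Prop where
  /-- Conditional quantiles are linear. -/
  linear : ∀ x' ∈ (μ.map (x 0)).support, ∀ η ∈ Icc ε (1 - ε),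
    quantile (condLaw f x') η = x' ⬝ᵥ β η
  integrable_X : Integrable (x 0) μ
  /-- The conditional density is bounded away from zero on the range of the modelled conditional
  quantiles. -/
  density_pos : ∃ c : ℝ, 0 < c ∧ ∀ x' ∈ (μ.map (x 0)).support,
    ∀ y' ∈ Icc (x' ⬝ᵥ β ε) (x' ⬝ᵥ β (1 - ε)), c ≤ f y' x'
  /-- The matrix `J(η)` exists, is invertible and has uniformly bounded derivatives. -/
  J_integrable : ∀ η ∈ Icc ε (1 - ε), ∀ i j,
    Integrable (fun ω => f (x 0 ω ⬝ᵥ β η) (x 0 ω) * (x 0 ω i * x 0 ω j)) μ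
  J_invertible : ∀ η ∈ Icc ε (1 - ε), IsUnit (J μ (x 0) f β η).det
  J_differentiable : ∀ i j, DifferentiableOn ℝ (fun η => J μ (x 0) f β η i j) (Icc ε (1 - ε))
  J_deriv_bounded : ∃ C : ℝ, ∀ i j, ∀ η ∈ Icc ε (1 - ε),
    |derivWithin (fun η => J μ (x 0) f β η i j) (Icc ε (1 - ε)) η| ≤ C
  /-- The uniform Bahadur representation of the quantile regression estimator. -/
  bahadur : IsUniformLittleOp μ (Icc ε (1 - ε))
    (fun n η ω => βhat n η ω - β η - (n : ℝ)⁻¹ • ∑ i ∈ Finset.range n,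
      influenceQR (J μ (x 0) f β η) (β η) η (y i ω) (x i ω))
    (fun n => (n : ℝ) ^ (-(1 / 2) : ℝ))
  /-- The linear representation of the sample quantile. -/
  unconditional : IsLittleOp μ
    (fun n ω => Qhat n ω - quantile (μ.map (y 0)) τ - (n : ℝ)⁻¹ * ∑ i ∈ Finset.range n,
      influenceUQ (fY (quantile (μ.map (y 0)) τ)) (quantile (μ.map (y 0)) τ) τ (y i ω))
    (fun n => (n : ℝ) ^ (-(1 / 2) : ℝ))
  /-- The grid runs from `ε` to `1 - ε` and its mesh is `o(n^{-1/2})`. -/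
  grid_strictMono : ∀ n, StrictMono (grid n)
  grid_first : ∀ n, grid n 0 = ε
  grid_last : ∀ n, grid n (Fin.last (m n)) = 1 - ε
  grid_mesh : ∃ Δ : ℕ → ℝ, (∀ n, ∀ j : Fin (m n), grid n j.succ - grid n j.castSucc ≤ Δ n) ∧
    Tendsto (fun n : ℕ => (n : ℝ) ^ (1 / 2 : ℝ) * Δ n) atTop (𝓝 0)

/-- The assumption on the kernel, of order `r`. -/
structure KernelAssumption (K : ℝ → ℝ) (r : ℕ) : Prop where
  two_le : 2 ≤ r
  symm : ∀ u, K (-u) = K u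
  integrable : Integrable K
  integral_eq_one : ∫ u, K u = 1
  moment_integrable : ∀ j ∈ Finset.Icc 1 (r - 1), Integrable fun u => u ^ j * K u
  moment_eq_zero : ∀ j ∈ Finset.Icc 1 (r - 1), ∫ u, u ^ j * K u = 0
  moment_r : Integrable fun u => |u| ^ r * K u
  differentiable : Differentiable ℝ K
  differentiable_deriv : Differentiable ℝ (deriv K)
  deriv_integrable : Integrable (deriv K)
  integral_deriv : ∫ u, deriv K u = 0
  decay_atTop : ∀ j ∈ Finset.Icc 1 (r + 1), Tendsto (fun u => u ^ j * K u) atTop (𝓝 0)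
  decay_atBot : ∀ j ∈ Finset.Icc 1 (r + 1), Tendsto (fun u => u ^ j * K u) atBot (𝓝 0)
  deriv_bounded : ∃ C : ℝ, ∀ u, |deriv K u| ≤ C
  deriv_two_bounded : ∃ C : ℝ, ∀ u, |deriv (deriv K) u| ≤ C
  deriv_sq_integrable : Integrable fun u => deriv K u ^ 2
  mul_deriv_sq_integrable : Integrable fun u => u * deriv K u ^ 2

/-- `h ∝ n^{-a}` with `1/(1+2r) ≤ a < 1/2`; the ratio `h / n^{-a}` only has to stay eventually
between two positive constants. -/
structure BandwidthAssumption (h : ℕ → ℝ) (a : ℝ) (r : ℕ) : Prop where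
  lower : 1 / (1 + 2 * (r : ℝ)) ≤ a
  upper : a < 1 / 2
  rate : ∃ c C : ℝ, 0 < c ∧ ∀ᶠ n : ℕ in atTop,
    c * (n : ℝ) ^ (-a) ≤ h n ∧ h n ≤ C * (n : ℝ) ^ (-a)

/-- The smoothness assumption on the densities; derivatives of the joint density are taken with
respect to `y`. -/
structure DensityAssumption {d : ℕ} (S : Set (Fin d → ℝ)) (fX : (Fin d → ℝ) → ℝ)
    (f : ℝ → (Fin d → ℝ) → ℝ) (fY : ℝ → ℝ) (r : ℕ) : Prop where
  marginal_contDiff : ContDiff ℝ ((r + 1 : ℕ) : WithTop ℕ∞) fY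
  marginal_bounded : ∃ C : ℝ, ∀ j ∈ Finset.Icc 1 (r + 1), ∀ y, |iteratedDeriv j fY y| ≤ C
  joint_contDiff : ∀ x ∈ S, ContDiff ℝ ((r + 1 : ℕ) : WithTop ℕ∞) fun y => f y x * fX x
  joint_bounded : ∃ C : ℝ, ∀ x ∈ S, ∀ j ∈ Finset.Icc 1 (r + 1), ∀ y,
    |iteratedDeriv j (fun y => f y x * fX x) y| ≤ C

/-- The uniformity assumption: the remainder of the linear expansion of the estimated matching
function is uniform over the support `S` of `X`, and `dβ₁/dη` and the conditional density are
bounded. -/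
structure ApproxAssumption {Ω : Type*} [MeasurableSpace Ω] {d : ℕ} [NeZero d] (μ : Measure Ω)
    (S : Set (Fin d → ℝ)) (f : ℝ → (Fin d → ℝ) → ℝ) (ε Q : ℝ) (β : ℝ → Fin d → ℝ)
    (ξ : (Fin d → ℝ) → ℝ) (βhat : ℕ → ℝ → Ω → Fin d → ℝ) (Qhat : ℕ → Ω → ℝ)
    (ξhat : ℕ → (Fin d → ℝ) → Ω → ℝ) : Prop where
  remainder : IsUniformLittleOp μ S
    (fun n x ω => ξhat n x ω - ξ x - f (x ⬝ᵥ β (ξ x)) x *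
      (-(x ⬝ᵥ (βhat n (ξ x) ω - β (ξ x))) + (Qhat n ω - Q)))
    (fun n => (n : ℝ) ^ (-(1 / 2) : ℝ))
  beta_differentiable : DifferentiableOn ℝ (fun η => β η 0) (Icc ε (1 - ε))
  beta_deriv_bounded : ∃ C : ℝ, ∀ η ∈ Icc ε (1 - ε),
    |derivWithin (fun η => β η 0) (Icc ε (1 - ε)) η| ≤ C
  density_bounded : ∃ C : ℝ, ∀ x ∈ S, ∀ y, f y x ≤ C

end UQPE

end

/-!
Since the estimated matching function takes values in `I = [ε, 1 - ε]`, its expansion, uniform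
over the support of `X`, can only hold if that support is bounded: otherwise, along a sequence of
points `x` with `‖x‖ → ∞`, dividing the expansion by `‖x‖` would leave a direction in which the
sample mean of the quantile regression score is `o_p(n^{-1/2})`, and a nondegenerate sample mean
is not.

The indicator `1{y ≤ x'β(η)}` is monotone in `η`, so dyadic chaining costs only logarithmic
factors, and the estimated coefficients, hence the weights `β̂₁(ξ̂(x))`, are `o_p((n h)^{-1/2})`
off their targets, uniformly over the support. Replacing `Q̂` by `Q_Y[τ]` in a kernel mean costs
at most the integral of the absolute derivative of the kernel mean over a window of radius `s`
about `Q_Y[τ]`, with `n^{-1/2} ≪ s ≪ (n h)^{-1/2}` and `s ≪ h`: the expectation of that derivative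
is bounded because the joint density is smooth in `y`, and its fluctuations are of order
`(n h)^{-1/2} / h`. The denominators converge to `E f(Q_Y[τ] | X) > 0`.
-/

noncomputable section

namespace UQPE

section StochasticOrders

variable {Ω ι F : Type*} [MeasurableSpace Ω] {μ : Measure Ω} [Norm F]

/-- The filter of the families of events, indexed by the sample size `n`, whose probability tends
to one as `n → ∞`. Along it `o_p` is the ordinary little-o, see `isLittleOp_iff_isLittleO`. -/
def whp (μ : Measure Ω) : Filter (ℕ × Ω) :=
  Filter.comk (fun s => Tendsto (fun n => μ {ω | (n, ω) ∈ s}) atTop (𝓝 0))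
    (by simp)
    (fun _ ht _ hst => tendsto_of_tendsto_of_tendsto_of_le_of_le tendsto_const_nhds ht
      (fun _ => zero_le) fun _ => measure_mono fun _ hω => hst hω)
    (fun s hs t ht => tendsto_of_tendsto_of_tendsto_of_le_of_le tendsto_const_nhds
      (by simpa only [add_zero] using hs.add ht) (fun _ => zero_le)
      fun n => measure_union_le {ω | (n, ω) ∈ s} {ω | (n, ω) ∈ t})

theorem eventually_whp_iff {P : ℕ × Ω → Prop} :
    (∀ᶠ p in whp μ, P p) ↔ Tendsto (fun n => μ {ω | ¬P (n, ω)}) atTop (𝓝 0) :=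
  Iff.rfl

theorem eventually_whp_of_measure_le {P : ℕ × Ω → Prop} {e : ℕ → ℝ}
    (h : ∀ᶠ n in atTop, μ {ω | ¬P (n, ω)} ≤ ENNReal.ofReal (e n))
    (he : Tendsto e atTop (𝓝 0)) : ∀ᶠ p in whp μ, P p :=
  eventually_whp_iff.2 <| tendsto_of_tendsto_of_tendsto_of_le_of_le' tendsto_const_nhds
    (by simpa using ENNReal.tendsto_ofReal he) (Eventually.of_forall fun _ => zero_le) h

theorem eventually_whp_of_eventually_ae {P : ℕ × Ω → Prop}
    (h : ∀ᶠ n in atTop, ∀ᵐ ω ∂μ, P (n, ω)) : ∀ᶠ p in whp μ, P p :=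
  eventually_whp_iff.2 <| tendsto_const_nhds.congr' <| h.mono fun _ hn => (ae_iff.1 hn).symm

theorem tendsto_fst_whp : Tendsto Prod.fst (whp μ) atTop := fun s hs =>
  eventually_whp_of_eventually_ae <| (show ∀ᶠ n in atTop, n ∈ s from hs).mono fun _ hn =>
    ae_of_all _ fun _ => hn

theorem isLittleOp_iff_isLittleO {Z : ℕ → Ω → F} {r : ℕ → ℝ} (hr : ∀ᶠ n in atTop, 0 ≤ r n) :
    IsLittleOp μ Z r ↔ (fun p : ℕ × Ω => Z p.1 p.2) =o[whp μ] fun p => r p.1 := by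
  have hr' : ∀ᶠ p in whp μ, ‖r p.1‖ = r p.1 :=
    (tendsto_fst_whp.eventually hr).mono fun _ => Real.norm_of_nonneg
  rw [Asymptotics.isLittleO_iff]
  refine forall₂_congr fun δ _ => ?_
  rw [eventually_congr (hr'.mono fun p hp => by rw [hp]), eventually_whp_iff]
  simp only [not_le]

theorem isUniformLittleOp_iff_isLittleO {T : Set ι} {Z : ℕ → ι → Ω → F} {r : ℕ → ℝ}
    (hr : ∀ᶠ n in atTop, 0 ≤ r n) :
    IsUniformLittleOp μ T Z r ↔
      (fun p : (ℕ × Ω) × ι => Z p.1.1 p.2 p.1.2) =o[whp μ ×ˢ 𝓟 T] fun p => r p.1.1 := by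
  have hr' : ∀ᶠ p in whp μ, ‖r p.1‖ = r p.1 :=
    (tendsto_fst_whp.eventually hr).mono fun _ => Real.norm_of_nonneg
  rw [Asymptotics.isLittleO_iff]
  refine forall₂_congr fun δ _ => ?_
  rw [eventually_prod_principal_iff,
    eventually_congr (hr'.mono fun p hp => by simp only [hp]; rfl), eventually_whp_iff]
  simp only [not_forall, not_le, exists_prop]

theorem IsUniformLittleOp.eventually_forall_norm_le {T : Set ι} {Z : ℕ → ι → Ω → F} {r : ℕ → ℝ}
    (h : IsUniformLittleOp μ T Z r) {δ : ℝ} (hδ : 0 < δ) :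
    ∀ᶠ p in whp μ, ∀ t ∈ T, ‖Z p.1 t p.2‖ ≤ δ * r p.1 :=
  eventually_whp_iff.2 (by simpa only [not_forall, not_le, exists_prop] using h δ hδ)

theorem isLittleO_whp_of_lintegral_le {V : ℕ → Ω → ℝ} {r e : ℕ → ℝ}
    (hV : ∀ᶠ n in atTop, AEMeasurable (V n) μ)
    (hle : ∀ᶠ n in atTop, ∫⁻ ω, ‖V n ω‖ₑ ∂μ ≤ ENNReal.ofReal (e n))
    (hr : ∀ᶠ n in atTop, 0 < r n) (he : e =o[atTop] r) :
    (fun p : ℕ × Ω => V p.1 p.2) =o[whp μ] fun p => r p.1 := by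
  refine Asymptotics.isLittleO_iff.2 fun δ hδ => eventually_whp_of_measure_le
    (e := fun n => δ⁻¹ * (e n / r n)) ?_ ?_
  · filter_upwards [hV, hle, hr] with n hVn hen hrn
    have hδr : 0 < δ * r n := mul_pos hδ hrn
    calc μ {ω | ¬‖V n ω‖ ≤ δ * ‖r n‖} ≤ μ {ω | ENNReal.ofReal (δ * r n) ≤ ‖V n ω‖ₑ} :=
          measure_mono fun ω hω => by
            rw [mem_ofPred_eq, Real.norm_of_nonneg hrn.le, not_le] at hω
            rw [mem_ofPred_eq, ← ofReal_norm]
            exact ENNReal.ofReal_le_ofReal hω.le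
      _ ≤ ENNReal.ofReal (e n) / ENNReal.ofReal (δ * r n) :=
          (meas_ge_le_lintegral_div hVn.enorm (by simpa using hδr) ENNReal.ofReal_ne_top).trans
            (by gcongr)
      _ = ENNReal.ofReal (δ⁻¹ * (e n / r n)) := by
          rw [← ENNReal.ofReal_div_of_pos hδr]
          congr 1
          field_simp
  · simpa using he.tendsto_div_nhds_zero.const_mul δ⁻¹

end StochasticOrders

section SampleMean

variable {Ω E : Type*} [MeasurableSpace Ω] [MeasurableSpace E] {μ : Measure Ω}

/-- The sample mean `n⁻¹ ∑ φ (Z i)` over `i < n`, the empirical counterpart of `E[φ (Z 0)]`. -/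
def sampleMean (Z : ℕ → Ω → E) (φ : E → ℝ) (n : ℕ) (ω : Ω) : ℝ :=
  (n : ℝ)⁻¹ * ∑ i ∈ Finset.range n, φ (Z i ω)

variable {Z : ℕ → Ω → E} {φ : E → ℝ}

theorem memLp_sampleMean (hid : ∀ i, IdentDistrib (Z i) (Z 0) μ μ) (hφ : Measurable φ)
    (h2 : MemLp (fun ω => φ (Z 0 ω)) 2 μ) (n : ℕ) : MemLp (sampleMean Z φ n) 2 μ :=
  (memLp_finsetSum (Finset.range n) fun i _ =>
    (((hid i).comp hφ).memLp_iff.2 h2 : MemLp (fun ω => φ (Z i ω)) 2 μ)).const_mul _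

theorem integral_sampleMean (hid : ∀ i, IdentDistrib (Z i) (Z 0) μ μ) (hφ : Measurable φ)
    (h1 : Integrable (fun ω => φ (Z 0 ω)) μ) {n : ℕ} (hn : n ≠ 0) :
    ∫ ω, sampleMean Z φ n ω ∂μ = ∫ ω, φ (Z 0 ω) ∂μ := by
  have hi : ∀ i, IdentDistrib (fun ω => φ (Z i ω)) (fun ω => φ (Z 0 ω)) μ μ :=
    fun i => (hid i).comp hφ
  simp only [sampleMean]
  rw [integral_const_mul, integral_finsetSum _ fun i _ => (hi i).integrable_iff.2 h1]
  simp [(hi _).integral_eq, hn]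

theorem integral_abs_le_sqrt_integral_sq [IsProbabilityMeasure μ] {V : Ω → ℝ}
    (hV : MemLp V 2 μ) : ∫ ω, |V ω| ∂μ ≤ √(∫ ω, V ω ^ 2 ∂μ) := by
  have hvar := variance_nonneg (fun ω => |V ω|) μ
  rw [variance_eq_sub (show MemLp (fun ω => |V ω|) 2 μ from hV.abs)] at hvar
  simp only [Pi.pow_apply, sq_abs, sub_nonneg] at hvar
  exact Real.le_sqrt_of_sq_le hvar

section Independent

variable [IsProbabilityMeasure μ]

theorem variance_sampleMean_le (hi : iIndepFun Z μ) (hid : ∀ i, IdentDistrib (Z i) (Z 0) μ μ)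
    (hφ : Measurable φ) (h2 : MemLp (fun ω => φ (Z 0 ω)) 2 μ) (n : ℕ) :
    Var[sampleMean Z φ n; μ] ≤ (∫ ω, φ (Z 0 ω) ^ 2 ∂μ) / n := by
  have hii : ∀ i, IdentDistrib (φ ∘ Z i) (φ ∘ Z 0) μ μ := fun i => (hid i).comp hφ
  calc Var[sampleMean Z φ n; μ]
      = (n : ℝ)⁻¹ ^ 2 * Var[∑ i ∈ Finset.range n, φ ∘ Z i; μ] := by
        rw [← variance_const_mul]
        congr 1
        ext ω
        simp [sampleMean]
    _ = (n : ℝ)⁻¹ ^ 2 * (n * Var[φ ∘ Z 0; μ]) := by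
        rw [IndepFun.variance_sum (fun i _ => (hii i).memLp_iff.2 h2)
          fun i _ j _ hij => (hi.indepFun hij).comp hφ hφ]
        simp [(hii _).variance_eq]
    _ = Var[φ ∘ Z 0; μ] / n := by
        rcases eq_or_ne n 0 with rfl | hn
        · simp
        · field_simp
    _ ≤ (∫ ω, φ (Z 0 ω) ^ 2 ∂μ) / n := by
        gcongr
        exact variance_le_expectation_sq h2.1

theorem measure_lt_abs_sampleMean_sub_le (hi : iIndepFun Z μ)
    (hid : ∀ i, IdentDistrib (Z i) (Z 0) μ μ) (hφ : Measurable φ)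
    (h2 : MemLp (fun ω => φ (Z 0 ω)) 2 μ) {n : ℕ} (hn : n ≠ 0) {t : ℝ} (ht : 0 < t) :
    μ {ω | t < |sampleMean Z φ n ω - ∫ ω, φ (Z 0 ω) ∂μ|} ≤
      ENNReal.ofReal ((∫ ω, φ (Z 0 ω) ^ 2 ∂μ) / n / t ^ 2) := by
  rw [← integral_sampleMean hid hφ (h2.integrable (by norm_num)) hn]
  refine (measure_mono fun ω hω => (mem_ofPred_eq ▸ hω).le).trans
    ((meas_ge_le_variance_div_sq (memLp_sampleMean hid hφ h2 n) ht).trans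
      (ENNReal.ofReal_le_ofReal ?_))
  gcongr
  exact variance_sampleMean_le hi hid hφ h2 n

theorem integral_abs_sampleMean_sub_le (hi : iIndepFun Z μ)
    (hid : ∀ i, IdentDistrib (Z i) (Z 0) μ μ) (hφ : Measurable φ)
    (h2 : MemLp (fun ω => φ (Z 0 ω)) 2 μ) {n : ℕ} (hn : n ≠ 0) :
    ∫ ω, |sampleMean Z φ n ω - ∫ ω, φ (Z 0 ω) ∂μ| ∂μ ≤ √((∫ ω, φ (Z 0 ω) ^ 2 ∂μ) / n) := by
  have hL := memLp_sampleMean hid hφ h2 n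
  refine (integral_abs_le_sqrt_integral_sq (hL.sub (memLp_const _))).trans
    (Real.sqrt_le_sqrt ?_)
  rw [← integral_sampleMean hid hφ (h2.integrable (by norm_num)) hn]
  exact (variance_eq_integral hL.aemeasurable).symm.trans_le
    (variance_sampleMean_le hi hid hφ h2 n)

theorem isLittleO_whp_sampleMean_sub (hi : iIndepFun Z μ)
    (hid : ∀ i, IdentDistrib (Z i) (Z 0) μ μ) {φ : ℕ → E → ℝ} (hφ : ∀ n, Measurable (φ n))
    (h2 : ∀ᶠ n in atTop, MemLp (fun ω => φ n (Z 0 ω)) 2 μ) {r : ℕ → ℝ}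
    (hr : ∀ᶠ n in atTop, 0 < r n)
    (ho : (fun n : ℕ => √((∫ ω, φ n (Z 0 ω) ^ 2 ∂μ) / n)) =o[atTop] r) :
    (fun p : ℕ × Ω => sampleMean Z (φ p.1) p.1 p.2 - ∫ ω, φ p.1 (Z 0 ω) ∂μ) =o[whp μ]
      fun p => r p.1 := by
  refine isLittleO_whp_of_lintegral_le (V := fun n ω => sampleMean Z (φ n) n ω -
    ∫ ω, φ n (Z 0 ω) ∂μ) ?_ ?_ hr ho
  · filter_upwards [h2] with n h2n
    exact (memLp_sampleMean hid (hφ n) h2n n).aemeasurable.sub_const _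
  · filter_upwards [h2, eventually_ne_atTop 0] with n h2n hn
    have hint : Integrable (fun ω => sampleMean Z (φ n) n ω - ∫ ω, φ n (Z 0 ω) ∂μ) μ :=
      ((memLp_sampleMean hid (hφ n) h2n n).sub (memLp_const _)).integrable (by norm_num)
    rw [← ofReal_integral_norm_eq_lintegral_enorm hint]
    exact ENNReal.ofReal_le_ofReal (integral_abs_sampleMean_sub_le hi hid (hφ n) h2n hn)

end Independent

end SampleMean

section Chaining

variable {Ω : Type*} [MeasurableSpace Ω] {μ : Measure Ω}

theorem abs_sub_zero_le_of_even_of_step {D : ℕ → ℝ} {L : ℕ} {s t : ℝ} (ht : 0 ≤ t)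
    (heven : ∀ k ≤ 2 ^ L, |D (2 * k) - D 0| ≤ s)
    (hstep : ∀ k < 2 ^ L, |D (2 * k + 1) - D (2 * k)| ≤ t) {j : ℕ} (hj : j ≤ 2 ^ (L + 1)) :
    |D j - D 0| ≤ s + t := by
  rw [pow_succ] at hj
  obtain ⟨k, rfl | rfl⟩ := Nat.even_or_odd' j
  · linarith [heven k (by omega)]
  · linarith [heven k (by omega), hstep k (by omega),
      abs_sub_le (D (2 * k + 1)) (D (2 * k)) (D 0)]

-- Dyadic chaining: the even times are controlled by the induction hypothesis, and the last step
-- to an odd time by a union bound, so each of the `L + 1` scales costs `t` once.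
theorem measure_exists_lt_abs_sub_le {t : ℝ} (ht : 0 < t) (L : ℕ) (C : ℝ) (D : ℕ → Ω → ℝ)
    (hC : 0 ≤ C)
    (hD : ∀ i j, i ≤ j → j ≤ 2 ^ L →
      μ {ω | t < |D j ω - D i ω|} ≤ ENNReal.ofReal (C * (j - i : ℝ))) :
    μ {ω | ∃ j ≤ 2 ^ L, (L + 1) * t < |D j ω - D 0 ω|} ≤
      ENNReal.ofReal ((L + 1) * C * 2 ^ L) := by
  induction L generalizing C D with
  | zero =>
    refine (measure_mono ?_).trans ((hD 0 1 zero_le_one le_rfl).trans_eq (by simp))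
    rintro ω ⟨j, hj, hlt⟩
    obtain rfl | rfl : j = 0 ∨ j = 1 := by omega
    · simp only [sub_self, abs_zero, CharP.cast_eq_zero, zero_add, one_mul] at hlt
      exact absurd hlt ht.not_gt
    · rwa [CharP.cast_eq_zero, zero_add, one_mul] at hlt
  | succ L ih =>
    have heven := ih (2 * C) (fun j => D (2 * j)) (by positivity) fun i j hij hj =>
      (hD (2 * i) (2 * j) (by omega) (by omega)).trans_eq (by push_cast; ring_nf)
    have hodd : μ (⋃ j ∈ Finset.range (2 ^ L), {ω | t < |D (2 * j + 1) ω - D (2 * j) ω|}) ≤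
        ENNReal.ofReal (2 ^ L * C) := by
      refine (measure_biUnion_finset_le _ _).trans ((Finset.sum_le_sum fun j hj =>
        hD (2 * j) (2 * j + 1) (by omega) (by rw [Finset.mem_range] at hj; omega)).trans_eq ?_)
      simp [ENNReal.ofReal_mul]
    refine (measure_mono ?_).trans ((measure_union_le _ _).trans
      ((add_le_add heven hodd).trans ?_))
    · rintro ω ⟨j, hj, hlt⟩
      by_contra hω
      simp only [mul_zero, mem_union, mem_ofPred_eq, not_or, not_exists, not_and, not_lt,
        mem_iUnion, Finset.mem_range] at hω
      have := abs_sub_zero_le_of_even_of_step (D := (D · ω)) ht.le hω.1 hω.2 hj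
      push_cast at hlt
      linarith
    · rw [← ENNReal.ofReal_add (by positivity) (by positivity)]
      refine ENNReal.ofReal_le_ofReal ?_
      have : 0 ≤ 2 ^ L * C := by positivity
      push_cast
      rw [pow_succ]
      linarith

end Chaining

section Quantile

variable {m : Measure ℝ} {p p' : ℝ}

theorem quantile_eq_sInf_cdf [IsProbabilityMeasure m] (p : ℝ) :
    quantile m p = sInf {q | p ≤ cdf m q} := by
  simp only [quantile, ← ofReal_cdf, ENNReal.ofReal_le_ofReal_iff (cdf_nonneg m _)]

theorem nonempty_setOf_le_cdf (hp : p < 1) : {q | p ≤ cdf m q}.Nonempty :=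
  ((tendsto_cdf_atTop m).eventually (lt_mem_nhds hp)).exists.imp fun _ => le_of_lt

theorem bddBelow_setOf_le_cdf (hp : 0 < p) : BddBelow {q | p ≤ cdf m q} := by
  obtain ⟨q, hq⟩ := ((tendsto_cdf_atBot m).eventually (gt_mem_nhds hp)).exists
  exact ⟨q, fun q' hq' => le_of_not_gt fun hlt =>
    hq.not_ge (le_trans hq' (monotone_cdf m hlt.le))⟩

theorem quantile_mono [IsProbabilityMeasure m] (hp : 0 < p) (hpp : p ≤ p') (hp' : p' < 1) :
    quantile m p ≤ quantile m p' := by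
  rw [quantile_eq_sInf_cdf, quantile_eq_sInf_cdf]
  exact csInf_le_csInf (bddBelow_setOf_le_cdf hp) (nonempty_setOf_le_cdf hp')
    fun q hq => hpp.trans hq

theorem continuous_cdf [IsProbabilityMeasure m] [NullSingletonClass m] : Continuous (cdf m) :=
  continuous_iff_continuousAt.2 fun q => by
    have hjump : (cdf m).measure {q} = 0 := by rw [measure_cdf, measure_singleton]
    rw [StieltjesFunction.measure_singleton, ENNReal.ofReal_eq_zero, sub_nonpos] at hjump
    exact continuousAt_iff_continuous_left'_right'.2
      ⟨(monotone_cdf m).continuousWithinAt_Iio_iff_leftLim_eq.2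
        (((monotone_cdf m).leftLim_le le_rfl).antisymm hjump),
      ((cdf m).right_continuous q).mono Ioi_subset_Ici_self⟩

theorem cdf_quantile [IsProbabilityMeasure m] [NullSingletonClass m] (hp : p ∈ Ioo (0 : ℝ) 1) :
    cdf m (quantile m p) = p := by
  have hbdd := bddBelow_setOf_le_cdf (m := m) hp.1
  obtain ⟨q, rfl⟩ : p ∈ range (cdf m) :=
    mem_range_of_exists_le_of_exists_ge continuous_cdf
      (((tendsto_cdf_atBot m).eventually (gt_mem_nhds hp.1)).exists.imp fun _ => le_of_lt)
      (nonempty_setOf_le_cdf hp.2)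
  rw [quantile_eq_sInf_cdf]
  exact (monotone_cdf m (csInf_le hbdd (le_refl (cdf m q)))).antisymm
    ((isClosed_le continuous_const continuous_cdf).csInf_mem (nonempty_setOf_le_cdf hp.2) hbdd)

theorem measureReal_Iic_quantile [IsProbabilityMeasure m] [NullSingletonClass m]
    (hp : p ∈ Ioo (0 : ℝ) 1) : m.real (Iic (quantile m p)) = p := by
  rw [← cdf_eq_real, cdf_quantile hp]

end Quantile

section Densities

variable {Ω : Type*} [MeasurableSpace Ω] {d : ℕ} {μ : Measure Ω}
    {Y : Ω → ℝ} {X : Ω → Fin d → ℝ} {ν : Measure (Fin d → ℝ)}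
    {fX : (Fin d → ℝ) → ℝ} {f : ℝ → (Fin d → ℝ) → ℝ} {fY : ℝ → ℝ}

instance nullSingletonClass_condLaw (x : Fin d → ℝ) : NullSingletonClass (condLaw f x) := by
  unfold condLaw; infer_instance

/-- The conditional laws `condLaw f x` as a kernel, the form in which Mathlib's disintegration
formulas apply to them. -/
def condLawKernel (f : ℝ → (Fin d → ℝ) → ℝ) : Kernel (Fin d → ℝ) ℝ :=
  (Kernel.const _ volume).withDensity fun x y => ENNReal.ofReal (f y x)

instance isSFiniteKernel_condLawKernel : IsSFiniteKernel (condLawKernel f) :=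
  Kernel.IsSFiniteKernel.withDensity _ fun _ _ => ENNReal.ofReal_ne_top

theorem condLawKernel_apply (hf : Measurable fun p : ℝ × (Fin d → ℝ) => f p.1 p.2)
    (x : Fin d → ℝ) : condLawKernel f x = condLaw f x := by
  rw [condLawKernel, Kernel.withDensity_apply _ (by fun_prop), Kernel.const_apply]
  rfl

theorem ae_mem_support (hX : Measurable X) : ∀ᵐ ω ∂μ, X ω ∈ (μ.map X).support :=
  ae_of_ae_map hX.aemeasurable Measure.support_mem_ae

theorem measurableSet_support (m : Measure (Fin d → ℝ)) : MeasurableSet m.support :=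
  Measure.isClosed_support.measurableSet

theorem lintegral_condLaw (hf : Measurable fun p : ℝ × (Fin d → ℝ) => f p.1 p.2)
    (x : Fin d → ℝ) {φ : ℝ → ENNReal} (hφ : Measurable φ) :
    ∫⁻ y, φ y ∂condLaw f x = ∫⁻ y, ENNReal.ofReal (f y x) * φ y := by
  rw [condLaw, lintegral_withDensity_eq_lintegral_mul _ (by fun_prop) hφ]
  rfl

theorem integral_condLaw (hf : Measurable fun p : ℝ × (Fin d → ℝ) => f p.1 p.2)
    (hf0 : ∀ y x, 0 ≤ f y x) (x : Fin d → ℝ) (φ : ℝ → ℝ) :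
    ∫ y, φ y ∂condLaw f x = ∫ y, f y x * φ y := by
  rw [condLaw, integral_withDensity_eq_integral_toReal_smul (by fun_prop) (by simp)]
  simp [ENNReal.toReal_ofReal (hf0 _ x)]

namespace HasDensities

theorem lintegral_eq_setLIntegral_condLaw [SFinite ν] (hd : HasDensities μ Y X ν fX f fY)
    (hY : Measurable Y) (hX : Measurable X) {φ : (Fin d → ℝ) × ℝ → ENNReal}
    (hφ : Measurable φ) :
    ∫⁻ ω, φ (X ω, Y ω) ∂μ = ∫⁻ x in (μ.map X).support, ENNReal.ofReal (fX x) *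
      ∫⁻ y, φ (x, y) ∂condLaw f x ∂ν := by
  have hf := hd.measurable_f
  have hfX := hd.measurable_fX
  have hS := measurableSet_support (μ.map X)
  have hrestrict : (μ.map fun ω => (Y ω, X ω)).restrict (univ ×ˢ (μ.map X).support) =
      μ.map fun ω => (Y ω, X ω) :=
    Measure.restrict_eq_self_of_ae_mem <|
      (ae_map_iff (by fun_prop) (MeasurableSet.univ.prod hS)).2 <|
        (ae_mem_support hX).mono fun _ hω => ⟨mem_univ _, hω⟩
  calc ∫⁻ ω, φ (X ω, Y ω) ∂μ
      = ∫⁻ p, φ p.swap ∂μ.map fun ω => (Y ω, X ω) :=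
        (lintegral_map (f := fun p : ℝ × (Fin d → ℝ) => φ p.swap) (g := fun ω => (Y ω, X ω))
          (by fun_prop) (by fun_prop)).symm
    _ = ∫⁻ p, ENNReal.ofReal (f p.1 p.2 * fX p.2) * φ p.swap
          ∂volume.prod (ν.restrict (μ.map X).support) := by
        rw [← hrestrict, hd.joint, restrict_withDensity (MeasurableSet.univ.prod hS),
          ← Measure.prod_restrict, Measure.restrict_univ,
          lintegral_withDensity_eq_lintegral_mul _ (by fun_prop) (by fun_prop)]
        rfl
    _ = _ := by
        rw [lintegral_prod_symm' _ (by fun_prop)]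
        refine lintegral_congr fun x => ?_
        rw [lintegral_condLaw hf x (by fun_prop), ← lintegral_const_mul _ (by fun_prop)]
        exact lintegral_congr fun y => by
          rw [ENNReal.ofReal_mul (hd.f_nonneg y x), Prod.swap_prod_mk]
          ring

theorem map_covariate_eq [SFinite ν] (hd : HasDensities μ Y X ν fX f fY)
    (hY : Measurable Y) (hX : Measurable X) :
    μ.map X = (ν.restrict (μ.map X).support).withDensity fun x => ENNReal.ofReal (fX x) := by
  have hfX := hd.measurable_fX
  refine Measure.ext_of_lintegral _ fun φ hφ => ?_
  rw [lintegral_map hφ hX, lintegral_withDensity_eq_lintegral_mul _ (by fun_prop) hφ,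
    hd.lintegral_eq_setLIntegral_condLaw hY hX (φ := fun p => φ p.1) (by fun_prop)]
  refine setLIntegral_congr_fun (measurableSet_support _) fun x hx => ?_
  have := hd.cond x hx
  simp

theorem map_eq_compProd [SFinite ν] [SFinite μ] (hd : HasDensities μ Y X ν fX f fY)
    (hY : Measurable Y) (hX : Measurable X) :
    μ.map (fun ω => (X ω, Y ω)) = μ.map X ⊗ₘ condLawKernel f := by
  have hfX := hd.measurable_fX
  refine Measure.ext_of_lintegral _ fun φ hφ => ?_
  rw [lintegral_map hφ (by fun_prop), Measure.lintegral_compProd hφ,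
    hd.lintegral_eq_setLIntegral_condLaw hY hX hφ]
  conv_rhs => rw [hd.map_covariate_eq hY hX]
  rw [lintegral_withDensity_eq_lintegral_mul _ (by fun_prop) hφ.lintegral_kernel_prod_right']
  simp only [Pi.mul_apply, condLawKernel_apply hd.measurable_f]

theorem lintegral_eq_lintegral_condLaw [SFinite ν] [SFinite μ]
    (hd : HasDensities μ Y X ν fX f fY)
    (hY : Measurable Y) (hX : Measurable X) {φ : ℝ → ENNReal} (hφ : Measurable φ) :
    ∫⁻ ω, φ (Y ω) ∂μ = ∫⁻ ω, ∫⁻ y, φ y ∂condLaw f (X ω) ∂μ := by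
  have hfst := lintegral_map (μ := μ) (f := fun p : (Fin d → ℝ) × ℝ => φ p.2)
    (g := fun ω => (X ω, Y ω)) (by fun_prop) (by fun_prop)
  have hinner : Measurable fun x => ∫⁻ y, φ y ∂condLawKernel f x :=
    (hφ.comp measurable_snd).lintegral_kernel_prod_right'
  rw [← hfst, hd.map_eq_compProd hY hX, Measure.lintegral_compProd (by fun_prop),
    lintegral_map hinner hX]
  simp only [condLawKernel_apply hd.measurable_f]

theorem integral_eq_integral_condLaw [SFinite ν] [SFinite μ]
    (hd : HasDensities μ Y X ν fX f fY)
    (hY : Measurable Y) (hX : Measurable X) {φ : (Fin d → ℝ) × ℝ → ℝ} (hφ : Measurable φ)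
    (hint : Integrable (fun ω => φ (X ω, Y ω)) μ) :
    ∫ ω, φ (X ω, Y ω) ∂μ = ∫ ω, ∫ y, φ (X ω, y) ∂condLaw f (X ω) ∂μ := by
  have hXY : AEMeasurable (fun ω => (X ω, Y ω)) μ := by fun_prop
  have hmap : Integrable φ (μ.map X ⊗ₘ condLawKernel f) := by
    rw [← hd.map_eq_compProd hY hX]
    exact (integrable_map_measure hφ.aestronglyMeasurable hXY).2 hint
  have hinner := hφ.stronglyMeasurable.integral_kernel_prod_right' (κ := condLawKernel f)
  rw [← integral_map hXY (f := φ) hφ.aestronglyMeasurable, hd.map_eq_compProd hY hX,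
    Measure.integral_compProd hmap, integral_map hX.aemeasurable hinner.aestronglyMeasurable]
  simp only [condLawKernel_apply hd.measurable_f]

theorem lintegral_le_mul_lintegral [SFinite ν] [IsProbabilityMeasure μ]
    (hd : HasDensities μ Y X ν fX f fY) (hY : Measurable Y) (hX : Measurable X) {C : ℝ}
    (hC : ∀ x ∈ (μ.map X).support, ∀ y, f y x ≤ C) {φ : ℝ → ENNReal} (hφ : Measurable φ) :
    ∫⁻ ω, φ (Y ω) ∂μ ≤ ENNReal.ofReal C * ∫⁻ y, φ y := by
  rw [hd.lintegral_eq_lintegral_condLaw hY hX hφ]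
  calc ∫⁻ ω, ∫⁻ y, φ y ∂condLaw f (X ω) ∂μ
      ≤ ∫⁻ _, (ENNReal.ofReal C * ∫⁻ y, φ y) ∂μ := by
        refine lintegral_mono_ae ((ae_mem_support hX).mono fun ω hω => ?_)
        rw [lintegral_condLaw hd.measurable_f _ hφ, ← lintegral_const_mul _ hφ]
        exact lintegral_mono fun y => by gcongr; exact hC _ hω y
    _ = ENNReal.ofReal C * ∫⁻ y, φ y := by simp

theorem measureReal_le_quantile [IsProbabilityMeasure μ] (hd : HasDensities μ Y X ν fX f fY)
    (hY : Measurable Y) {τ : ℝ} (hτ : τ ∈ Ioo (0 : ℝ) 1) :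
    μ.real {ω | Y ω ≤ quantile (μ.map Y) τ} = τ := by
  have : IsProbabilityMeasure (μ.map Y) := Measure.isProbabilityMeasure_map hY.aemeasurable
  have : NullSingletonClass (μ.map Y) := by rw [hd.marginal]; infer_instance
  conv_rhs => rw [← measureReal_Iic_quantile (m := μ.map Y) hτ,
    map_measureReal_apply hY measurableSet_Iic]
  rfl

end HasDensities

end Densities

section Score

variable {Ω : Type*} [MeasurableSpace Ω] {d : ℕ} {μ : Measure Ω}
    {Y : Ω → ℝ} {X : Ω → Fin d → ℝ} {ν : Measure (Fin d → ℝ)}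
    {fX : (Fin d → ℝ) → ℝ} {f : ℝ → (Fin d → ℝ) → ℝ} {fY : ℝ → ℝ}
    {η η' : ℝ} {b b' : Fin d → ℝ}

/-- The indicator of `y ≤ x'b`, as a function of the observation `p = (y, x)`. -/
def belowInd (b : Fin d → ℝ) (p : ℝ × (Fin d → ℝ)) : ℝ := if p.1 ≤ p.2 ⬝ᵥ b then 1 else 0

@[fun_prop]
theorem measurable_dotProduct_const (b : Fin d → ℝ) : Measurable fun x : Fin d → ℝ => x ⬝ᵥ b :=
  (continuous_id.dotProduct continuous_const).measurable

@[fun_prop]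
theorem measurable_belowInd (b : Fin d → ℝ) : Measurable (belowInd b) :=
  Measurable.ite (measurableSet_le (by fun_prop) (by fun_prop)) (by fun_prop) (by fun_prop)

theorem belowInd_nonneg (b : Fin d → ℝ) (p : ℝ × (Fin d → ℝ)) : 0 ≤ belowInd b p := by
  unfold belowInd; split_ifs <;> norm_num

theorem belowInd_le_one (b : Fin d → ℝ) (p : ℝ × (Fin d → ℝ)) : belowInd b p ≤ 1 := by
  unfold belowInd; split_ifs <;> norm_num

theorem belowInd_mono {p : ℝ × (Fin d → ℝ)} (h : p.2 ⬝ᵥ b ≤ p.2 ⬝ᵥ b') :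
    belowInd b p ≤ belowInd b' p := by
  unfold belowInd
  split_ifs <;> grind

theorem sq_belowInd_sub (b b' : Fin d → ℝ) (p : ℝ × (Fin d → ℝ)) :
    (belowInd b p - belowInd b' p) ^ 2 = |belowInd b p - belowInd b' p| := by
  unfold belowInd
  split_ifs <;> norm_num

theorem abs_sub_belowInd_le_one (hη : η ∈ Icc (0 : ℝ) 1) (b : Fin d → ℝ) (p : ℝ × (Fin d → ℝ)) :
    |η - belowInd b p| ≤ 1 :=
  abs_le.2 ⟨by linarith [hη.1, belowInd_le_one b p], by linarith [hη.2, belowInd_nonneg b p]⟩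

theorem integral_belowInd_condLaw (b x : Fin d → ℝ) :
    ∫ y, belowInd b (y, x) ∂condLaw f x = (condLaw f x).real (Iic (x ⬝ᵥ b)) :=
  (integral_congr_ae (ae_of_all _ fun y => by
    simp only [belowInd, indicator, mem_Iic, Pi.one_apply])).trans
      (integral_indicator_one measurableSet_Iic)

theorem integrable_mul_belowInd {g : Ω → ℝ} (hY : Measurable Y) (hX : Measurable X)
    (hg : Integrable g μ) (b : Fin d → ℝ) :
    Integrable (fun ω => g ω * belowInd b (Y ω, X ω)) μ :=
  hg.mul_bdd (c := 1) (Measurable.aestronglyMeasurable (by fun_prop)) (ae_of_all _ fun ω => by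
    rw [Real.norm_of_nonneg (belowInd_nonneg _ _)]
    exact belowInd_le_one _ _)

namespace HasDensities

theorem integral_mul_belowInd [SFinite ν] [SFinite μ] (hd : HasDensities μ Y X ν fX f fY)
    (hY : Measurable Y) (hX : Measurable X)
    (hb : ∀ x ∈ (μ.map X).support, (condLaw f x).real (Iic (x ⬝ᵥ b)) = η)
    {g : (Fin d → ℝ) → ℝ} (hg : Measurable g) (hgi : Integrable (fun ω => g (X ω)) μ) :
    ∫ ω, g (X ω) * belowInd b (Y ω, X ω) ∂μ = η * ∫ ω, g (X ω) ∂μ := by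
  refine (hd.integral_eq_integral_condLaw hY hX (φ := fun p => g p.1 * belowInd b p.swap)
    (by fun_prop) (integrable_mul_belowInd hY hX hgi b)).trans ?_
  rw [← integral_const_mul]
  refine integral_congr_ae ((ae_mem_support hX).mono fun ω hω => ?_)
  simp only [Prod.swap_prod_mk, integral_const_mul, integral_belowInd_condLaw, hb _ hω]
  ring

theorem integral_mul_belowInd_sub [SFinite ν] [SFinite μ] (hd : HasDensities μ Y X ν fX f fY)
    (hY : Measurable Y) (hX : Measurable X)
    (hb : ∀ x ∈ (μ.map X).support, (condLaw f x).real (Iic (x ⬝ᵥ b)) = η)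
    (hb' : ∀ x ∈ (μ.map X).support, (condLaw f x).real (Iic (x ⬝ᵥ b')) = η')
    {g : (Fin d → ℝ) → ℝ} (hg : Measurable g) (hgi : Integrable (fun ω => g (X ω)) μ) :
    ∫ ω, g (X ω) * (belowInd b (Y ω, X ω) - belowInd b' (Y ω, X ω)) ∂μ =
      (η - η') * ∫ ω, g (X ω) ∂μ := by
  simp only [mul_sub]
  rw [integral_sub (integrable_mul_belowInd hY hX hgi b) (integrable_mul_belowInd hY hX hgi b'),
    hd.integral_mul_belowInd hY hX hb hg hgi, hd.integral_mul_belowInd hY hX hb' hg hgi, sub_mul]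

theorem integral_sq_mul_belowInd_sub_le [SFinite ν] [SFinite μ]
    (hd : HasDensities μ Y X ν fX f fY) (hY : Measurable Y) (hX : Measurable X)
    (hb : ∀ x ∈ (μ.map X).support, (condLaw f x).real (Iic (x ⬝ᵥ b)) = η)
    (hb' : ∀ x ∈ (μ.map X).support, (condLaw f x).real (Iic (x ⬝ᵥ b')) = η')
    (hbb : (∀ x ∈ (μ.map X).support, x ⬝ᵥ b ≤ x ⬝ᵥ b') ∨
      ∀ x ∈ (μ.map X).support, x ⬝ᵥ b' ≤ x ⬝ᵥ b)
    {g : (Fin d → ℝ) → ℝ} (hg : Measurable g) (hgi : MemLp (fun ω => g (X ω)) 2 μ) :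
    ∫ ω, (g (X ω) * (belowInd b (Y ω, X ω) - belowInd b' (Y ω, X ω))) ^ 2 ∂μ ≤
      |η - η'| * ∫ ω, g (X ω) ^ 2 ∂μ := by
  have hint := hd.integral_mul_belowInd_sub hY hX hb hb' (g := fun x => g x ^ 2) (by fun_prop)
    hgi.integrable_sq
  have hpt : ∀ ω, (g (X ω) * (belowInd b (Y ω, X ω) - belowInd b' (Y ω, X ω))) ^ 2 =
      |g (X ω) ^ 2 * (belowInd b (Y ω, X ω) - belowInd b' (Y ω, X ω))| := fun ω => by
    rw [mul_pow, sq_belowInd_sub, abs_mul, abs_of_nonneg (sq_nonneg (g (X ω)))]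
  have habs : ∫ ω, |g (X ω) ^ 2 * (belowInd b (Y ω, X ω) - belowInd b' (Y ω, X ω))| ∂μ =
      |∫ ω, g (X ω) ^ 2 * (belowInd b (Y ω, X ω) - belowInd b' (Y ω, X ω)) ∂μ| := by
    rcases hbb with hbb | hbb
    · rw [← abs_neg, ← integral_neg, abs_of_nonneg]
      · refine integral_congr_ae ((ae_mem_support hX).mono fun ω hω => ?_)
        exact abs_of_nonpos (mul_nonpos_of_nonneg_of_nonpos (sq_nonneg _)
          (sub_nonpos.2 (belowInd_mono (hbb _ hω))))
      · refine integral_nonneg_of_ae ((ae_mem_support hX).mono fun ω hω => ?_)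
        exact neg_nonneg.2 (mul_nonpos_of_nonneg_of_nonpos (sq_nonneg _)
          (sub_nonpos.2 (belowInd_mono (hbb _ hω))))
    · rw [abs_of_nonneg]
      · refine integral_congr_ae ((ae_mem_support hX).mono fun ω hω => ?_)
        exact abs_of_nonneg (mul_nonneg (sq_nonneg _) (sub_nonneg.2 (belowInd_mono (hbb _ hω))))
      · refine integral_nonneg_of_ae ((ae_mem_support hX).mono fun ω hω => ?_)
        exact mul_nonneg (sq_nonneg _) (sub_nonneg.2 (belowInd_mono (hbb _ hω)))
  simp only [hpt]
  rw [habs, hint, abs_mul, abs_of_nonneg (integral_nonneg fun ω => sq_nonneg (g (X ω)))]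

end HasDensities

/-- The component `(η - 1{y ≤ x'b}) x'a` in direction `a` of the quantile regression score. -/
def score (b : Fin d → ℝ) (η : ℝ) (a : Fin d → ℝ) (p : ℝ × (Fin d → ℝ)) : ℝ :=
  (η - belowInd b p) * (p.2 ⬝ᵥ a)

@[fun_prop]
theorem measurable_score (b : Fin d → ℝ) (η : ℝ) (a : Fin d → ℝ) : Measurable (score b η a) := by
  unfold score
  fun_prop

theorem dotProduct_mean_influenceQR {Ω : Type*} (Jη : Matrix (Fin d) (Fin d) ℝ) (b : Fin d → ℝ)
    (η : ℝ) (v : Fin d → ℝ) (y : ℕ → Ω → ℝ) (x : ℕ → Ω → Fin d → ℝ) (n : ℕ) (ω : Ω) :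
    v ⬝ᵥ ((n : ℝ)⁻¹ • ∑ i ∈ Finset.range n, influenceQR Jη b η (y i ω) (x i ω)) =
      sampleMean (fun i ω => (y i ω, x i ω)) (score b η (v ᵥ* Jη⁻¹)) n ω := by
  simp only [sampleMean, dotProduct_smul, dotProduct_sum, influenceQR, score, belowInd,
    Matrix.dotProduct_mulVec, dotProduct_comm (v ᵥ* Jη⁻¹), smul_dotProduct, smul_eq_mul]

theorem abs_dotProduct_le (a x : Fin d → ℝ) : |x ⬝ᵥ a| ≤ ‖a‖ * ∑ j, |x j| := by
  rw [Finset.mul_sum]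
  refine (Finset.abs_sum_le_sum_abs _ _).trans (Finset.sum_le_sum fun j _ => ?_)
  rw [abs_mul, mul_comm]
  gcongr
  exact norm_le_pi_norm a j

theorem abs_score_le (hη : η ∈ Icc (0 : ℝ) 1) (b a : Fin d → ℝ) (p : ℝ × (Fin d → ℝ)) :
    |score b η a p| ≤ ‖a‖ * ∑ j, |p.2 j| := by
  rw [score, abs_mul]
  exact (mul_le_of_le_one_left (abs_nonneg _) (abs_sub_belowInd_le_one hη b p)).trans
    (abs_dotProduct_le a p.2)

theorem le_sq_score {ε : ℝ} (hε : 0 ≤ ε) (hη : η ∈ Icc ε (1 - ε)) (b a : Fin d → ℝ)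
    (p : ℝ × (Fin d → ℝ)) : ε ^ 2 * (p.2 ⬝ᵥ a) ^ 2 ≤ score b η a p ^ 2 := by
  rw [score, mul_pow]
  gcongr ?_ * _
  unfold belowInd
  split_ifs <;> nlinarith [hη.1, hη.2]

theorem memLp_sum_abs (h2 : ∀ j, MemLp (fun ω => X ω j) 2 μ) :
    MemLp (fun ω => ∑ j, |X ω j|) 2 μ :=
  memLp_finsetSum Finset.univ fun j _ => (h2 j).abs

theorem memLp_score (hY : Measurable Y) (hX : Measurable X)
    (h2 : ∀ j, MemLp (fun ω => X ω j) 2 μ) (hη : η ∈ Icc (0 : ℝ) 1) (b a : Fin d → ℝ) :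
    MemLp (fun ω => score b η a (Y ω, X ω)) 2 μ :=
  ((memLp_sum_abs h2).const_mul ‖a‖).mono (Measurable.aestronglyMeasurable (by fun_prop))
    (ae_of_all _ fun ω => (abs_score_le hη b a _).trans (le_abs_self _))

namespace HasDensities

theorem integral_score [IsFiniteMeasure μ] [SFinite ν] (hd : HasDensities μ Y X ν fX f fY)
    (hY : Measurable Y) (hX : Measurable X) (h2 : ∀ j, MemLp (fun ω => X ω j) 2 μ)
    (hb : ∀ x ∈ (μ.map X).support, (condLaw f x).real (Iic (x ⬝ᵥ b)) = η) (a : Fin d → ℝ) :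
    ∫ ω, score b η a (Y ω, X ω) ∂μ = 0 := by
  have hgi : Integrable (fun ω => X ω ⬝ᵥ a) μ :=
    integrable_finsetSum _ fun j _ => ((h2 j).integrable one_le_two).mul_const _
  calc ∫ ω, score b η a (Y ω, X ω) ∂μ
      = ∫ ω, (η * (X ω ⬝ᵥ a) - (X ω ⬝ᵥ a) * belowInd b (Y ω, X ω)) ∂μ := by
        simp only [score, sub_mul, mul_comm (X _ ⬝ᵥ a)]
    _ = 0 := by
        rw [integral_sub (hgi.const_mul _) (integrable_mul_belowInd hY hX hgi b),
          hd.integral_mul_belowInd hY hX hb (g := (· ⬝ᵥ a)) (by fun_prop) hgi,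
          integral_const_mul, sub_self]

end HasDensities

end Score

section CentralLimit

theorem natCast_rpow_neg_half (n : ℕ) : (n : ℝ) ^ (-(1 / 2) : ℝ) = (√n)⁻¹ := by
  rw [Real.rpow_neg n.cast_nonneg, Real.sqrt_eq_rpow]

theorem inv_sqrt_mul_sum_eq {Ω E : Type*} {Z : ℕ → Ω → E} {n : ℕ} (hn : n ≠ 0) (φ : E → ℝ)
    (ω : Ω) :
    (√n)⁻¹ * ∑ i ∈ Finset.range n, φ (Z i ω) =
      sampleMean Z φ n ω / (n : ℝ) ^ (-(1 / 2) : ℝ) := by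
  have hn0 : (0 : ℝ) < n := by positivity
  rw [sampleMean, natCast_rpow_neg_half, div_inv_eq_mul]
  field_simp
  rw [Real.sq_sqrt hn0.le, mul_comm]

variable {Ω E : Type*} [MeasurableSpace Ω] [MeasurableSpace E] {μ : Measure Ω}
  [IsProbabilityMeasure μ] {Z : ℕ → Ω → E}

theorem integral_sq_eq_zero_of_isLittleO (hi : iIndepFun Z μ)
    (hid : ∀ i, IdentDistrib (Z i) (Z 0) μ μ) {φ : E → ℝ} (hφ : Measurable φ)
    (h2 : MemLp (fun ω => φ (Z 0 ω)) 2 μ) (h0 : ∫ ω, φ (Z 0 ω) ∂μ = 0)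
    (hlittle : (fun p : ℕ × Ω => sampleMean Z φ p.1 p.2) =o[whp μ]
      fun p => (p.1 : ℝ) ^ (-(1 / 2) : ℝ)) :
    ∫ ω, φ (Z 0 ω) ^ 2 ∂μ = 0 := by
  have hclt := tendstoInDistribution_inv_sqrt_mul_sum_sub (X := fun i ω => φ (Z i ω))
    (Y := id) (P' := gaussianReal 0 Var[fun ω => φ (Z 0 ω); μ].toNNReal)
    HasLaw.id h2 (hi.comp (fun _ => φ) fun _ => hφ) fun i => (hid i).comp hφ
  have hmeas : TendstoInMeasure μ
      (fun (n : ℕ) ω => (√n)⁻¹ * (∑ i ∈ Finset.range n, φ (Z i ω) - n * ∫ ω, φ (Z 0 ω) ∂μ))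
      atTop fun _ => (0 : ℝ) := by
    refine tendstoInMeasure_iff_norm.2 fun δ hδ => ?_
    have hsmall := hlittle.tendsto_div_nhds_zero.norm.eventually_lt_const (norm_zero.trans_lt hδ)
    refine (eventually_whp_iff.1 hsmall).congr' ?_
    filter_upwards [eventually_ne_atTop 0] with n hn
    simp only [h0, mul_zero, sub_zero, inv_sqrt_mul_sum_eq hn, not_lt]
  have huniq := tendstoInDistribution_unique _ hclt
    (hmeas.tendstoInDistribution_of_aemeasurable hclt.forall_aemeasurable aemeasurable_const)
  have hvar : Var[fun ω => φ (Z 0 ω); μ] = 0 := by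
    have := congrArg (fun m : Measure ℝ => Var[id; m]) huniq
    simp only [Measure.map_const, measure_univ, one_smul, Measure.map_id] at this
    rwa [variance_id_gaussianReal, variance_dirac, Real.coe_toNNReal _ (variance_nonneg _ _)]
      at this
  rwa [variance_of_integral_eq_zero h2.1.aemeasurable h0] at hvar

end CentralLimit

section Sample

variable {Ω : Type*} [MeasurableSpace Ω] {μ : Measure Ω} {d : ℕ}
    {y : ℕ → Ω → ℝ} {x : ℕ → Ω → Fin d → ℝ} {ν : Measure (Fin d → ℝ)}
    {fX : (Fin d → ℝ) → ℝ} {f : ℝ → (Fin d → ℝ) → ℝ} {fY : ℝ → ℝ}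

theorem HasDensities.ae_ne_dotProduct [SFinite ν] [SFinite μ]
    {Y : Ω → ℝ} {X : Ω → Fin d → ℝ} (hd : HasDensities μ Y X ν fX f fY)
    (hY : Measurable Y) (hX : Measurable X) (b : Fin d → ℝ) : ∀ᵐ ω ∂μ, Y ω ≠ X ω ⬝ᵥ b := by
  have hms : MeasurableSet {p : (Fin d → ℝ) × ℝ | p.2 ≠ p.1 ⬝ᵥ b} :=
    (measurableSet_eq_fun (by fun_prop) (by fun_prop)).compl
  refine ae_of_ae_map (f := fun ω => (X ω, Y ω)) (p := fun p => p.2 ≠ p.1 ⬝ᵥ b) (by fun_prop) ?_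
  rw [hd.map_eq_compProd hY hX, Measure.ae_compProd_iff hms]
  refine ae_of_all _ fun x => ?_
  rw [condLawKernel_apply hd.measurable_f]
  exact ae_iff.2 (by simp)

namespace IsRandomSample

theorem ae_forall (hs : IsRandomSample μ y x) {P : ℝ × (Fin d → ℝ) → Prop}
    (hP : MeasurableSet {p | P p}) (h : ∀ᵐ ω ∂μ, P (y 0 ω, x 0 ω)) :
    ∀ᵐ ω ∂μ, ∀ i, P (y i ω, x i ω) :=
  ae_all_iff.2 fun i => (hs.identDistrib i).symm.ae_snd hP h

theorem ae_forall_mem_support (hs : IsRandomSample μ y x) :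
    ∀ᵐ ω ∂μ, ∀ i, x i ω ∈ (μ.map (x 0)).support :=
  hs.ae_forall (P := fun p => p.2 ∈ (μ.map (x 0)).support)
    (measurable_snd (measurableSet_support _)) (ae_mem_support (hs.measurable_x 0))

end IsRandomSample

end Sample

section Model

/-- The linear quantile regression model on `[ε, 1 - ε]`, with coefficients `β` and matrix `J`,
together with asymptotically linear estimators `βhat` of `β` and `Qhat` of `Q_Y[τ]`. -/
structure IsLinearQuantileModel {Ω : Type*} [MeasurableSpace Ω] {d : ℕ} (μ : Measure Ω)
    (y : ℕ → Ω → ℝ) (x : ℕ → Ω → Fin d → ℝ)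
    (f : ℝ → (Fin d → ℝ) → ℝ) (fY : ℝ → ℝ) (τ ε : ℝ) (β : ℝ → Fin d → ℝ)
    (βhat : ℕ → ℝ → Ω → Fin d → ℝ) (Qhat : ℕ → Ω → ℝ) : Prop where
  linear : ∀ x' ∈ (μ.map (x 0)).support, ∀ η ∈ Icc ε (1 - ε),
    quantile (condLaw f x') η = x' ⬝ᵥ β η
  density_pos : ∃ c : ℝ, 0 < c ∧ ∀ x' ∈ (μ.map (x 0)).support,
    ∀ y' ∈ Icc (x' ⬝ᵥ β ε) (x' ⬝ᵥ β (1 - ε)), c ≤ f y' x'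
  J_integrable : ∀ η ∈ Icc ε (1 - ε), ∀ i j,
    Integrable (fun ω => f (x 0 ω ⬝ᵥ β η) (x 0 ω) * (x 0 ω i * x 0 ω j)) μ
  J_invertible : ∀ η ∈ Icc ε (1 - ε), IsUnit (J μ (x 0) f β η).det
  J_continuousOn : ∀ i j, ContinuousOn (fun η => J μ (x 0) f β η i j) (Icc ε (1 - ε))
  bahadur : IsUniformLittleOp μ (Icc ε (1 - ε))
    (fun n η ω => βhat n η ω - β η - (n : ℝ)⁻¹ • ∑ i ∈ Finset.range n,
      influenceQR (J μ (x 0) f β η) (β η) η (y i ω) (x i ω))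
    (fun n => (n : ℝ) ^ (-(1 / 2) : ℝ))
  unconditional : IsLittleOp μ
    (fun n ω => Qhat n ω - quantile (μ.map (y 0)) τ - (n : ℝ)⁻¹ * ∑ i ∈ Finset.range n,
      influenceUQ (fY (quantile (μ.map (y 0)) τ)) (quantile (μ.map (y 0)) τ) τ (y i ω))
    (fun n => (n : ℝ) ^ (-(1 / 2) : ℝ))

variable {Ω : Type*} [MeasurableSpace Ω] {μ : Measure Ω} {d : ℕ}
    {y : ℕ → Ω → ℝ} {x : ℕ → Ω → Fin d → ℝ} {ν : Measure (Fin d → ℝ)}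
    {fX : (Fin d → ℝ) → ℝ} {f : ℝ → (Fin d → ℝ) → ℝ} {fY : ℝ → ℝ}
    {τ ε Q : ℝ} {β : ℝ → Fin d → ℝ} {ξ : (Fin d → ℝ) → ℝ}
    {βhat : ℕ → ℝ → Ω → Fin d → ℝ} {Qhat : ℕ → Ω → ℝ}

theorem mem_Ioo_of_mem_Icc_sub (hε : ε ∈ Ioo (0 : ℝ) (1 / 2)) {η : ℝ}
    (hη : η ∈ Icc ε (1 - ε)) : η ∈ Ioo (0 : ℝ) 1 :=
  ⟨hε.1.trans_le hη.1, by linarith [hη.2, hε.1]⟩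

theorem condLaw_real_Iic_of_mem_matchingSet {x' : Fin d → ℝ} {η : ℝ}
    [IsProbabilityMeasure (condLaw f x')] (hη : η ∈ matchingSet f Q x') :
    (condLaw f x').real (Iic Q) = η := by
  rw [← hη.2, measureReal_Iic_quantile hη.1]

theorem HasDensities.measurable_condLaw_real_Iic {Y : Ω → ℝ} {X : Ω → Fin d → ℝ}
    (hd : HasDensities μ Y X ν fX f fY) (q : ℝ) :
    Measurable fun x' => (condLaw f x').real (Iic q) := by
  simp only [← condLawKernel_apply hd.measurable_f]
  exact ((condLawKernel f).measurable_coe measurableSet_Iic).ennreal_toReal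

namespace MatchingAssumption

variable {m : ℕ → ℕ} {grid : (n : ℕ) → Fin (m n + 1) → ℝ}

theorem isLinearQuantileModel (hm : MatchingAssumption μ y x f fY τ ε β βhat Qhat m grid) :
    IsLinearQuantileModel μ y x f fY τ ε β βhat Qhat where
  linear := hm.linear
  density_pos := hm.density_pos
  J_integrable := hm.J_integrable
  J_invertible := hm.J_invertible
  J_continuousOn i j := (hm.J_differentiable i j).continuousOn
  bahadur := hm.bahadur
  unconditional := hm.unconditional

theorem mem_Icc_of_isMatch (hm : MatchingAssumption μ y x f fY τ ε β βhat Qhat m grid)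
    {n : ℕ} {b : ℝ → Fin d → ℝ} {q : ℝ} {x' : Fin d → ℝ} {e : ℝ}
    (he : IsMatch ε (grid n) b q x' e) : e ∈ Icc ε (1 - ε) := by
  obtain ⟨j, rfl⟩ : ∃ j, e = grid n j := by
    rcases he with ⟨-, rfl⟩ | ⟨j, -, -, rfl⟩ | ⟨-, rfl⟩
    exacts [⟨0, (hm.grid_first n).symm⟩, ⟨_, rfl⟩, ⟨_, rfl⟩]
  rw [← hm.grid_last n]
  conv_lhs => rw [← hm.grid_first n]
  exact ⟨(hm.grid_strictMono n).monotone (Fin.zero_le j),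
    (hm.grid_strictMono n).monotone (Fin.le_last j)⟩

end MatchingAssumption

namespace IsLinearQuantileModel

theorem condLaw_real_Iic (hm : IsLinearQuantileModel μ y x f fY τ ε β βhat Qhat)
    (hd : HasDensities μ (y 0) (x 0) ν fX f fY) (hε : ε ∈ Ioo (0 : ℝ) (1 / 2)) {η : ℝ}
    (hη : η ∈ Icc ε (1 - ε)) {x' : Fin d → ℝ} (hx : x' ∈ (μ.map (x 0)).support) :
    (condLaw f x').real (Iic (x' ⬝ᵥ β η)) = η := by
  have := hd.cond x' hx
  rw [← hm.linear x' hx η hη, measureReal_Iic_quantile (mem_Ioo_of_mem_Icc_sub hε hη)]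

theorem monotoneOn_dotProduct (hm : IsLinearQuantileModel μ y x f fY τ ε β βhat Qhat)
    (hd : HasDensities μ (y 0) (x 0) ν fX f fY) (hε : ε ∈ Ioo (0 : ℝ) (1 / 2))
    {x' : Fin d → ℝ} (hx : x' ∈ (μ.map (x 0)).support) :
    MonotoneOn (fun η => x' ⬝ᵥ β η) (Icc ε (1 - ε)) := fun η hη η' hη' hle => by
  have := hd.cond x' hx
  simp only [← hm.linear x' hx η hη, ← hm.linear x' hx η' hη']
  exact quantile_mono (mem_Ioo_of_mem_Icc_sub hε hη).1 hle (mem_Ioo_of_mem_Icc_sub hε hη').2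

theorem exists_le_density (hm : IsLinearQuantileModel μ y x f fY τ ε β βhat Qhat)
    (hd : HasDensities μ (y 0) (x 0) ν fX f fY) (hε : ε ∈ Ioo (0 : ℝ) (1 / 2)) :
    ∃ c : ℝ, 0 < c ∧ ∀ x' ∈ (μ.map (x 0)).support, ∀ η ∈ Icc ε (1 - ε), ∀ η' ∈ Icc ε (1 - ε),
      ∀ q ∈ Icc (x' ⬝ᵥ β η) (x' ⬝ᵥ β η'), c ≤ f q x' := by
  obtain ⟨c, hc, hcf⟩ := hm.density_pos
  have hle : ε ≤ 1 - ε := by linarith [hε.2]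
  refine ⟨c, hc, fun x' hx η hη η' hη' q hq => hcf x' hx q ⟨?_, ?_⟩⟩
  · exact (hm.monotoneOn_dotProduct hd hε hx (left_mem_Icc.2 hle) hη hη.1).trans hq.1
  · exact hq.2.trans (hm.monotoneOn_dotProduct hd hε hx hη' (right_mem_Icc.2 hle) hη'.2)

theorem continuousOn_dotProduct (hm : IsLinearQuantileModel μ y x f fY τ ε β βhat Qhat)
    (hd : HasDensities μ (y 0) (x 0) ν fX f fY) (hε : ε ∈ Ioo (0 : ℝ) (1 / 2))
    {x' : Fin d → ℝ} (hx : x' ∈ (μ.map (x 0)).support) :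
    ContinuousOn (fun η => x' ⬝ᵥ β η) (Icc ε (1 - ε)) := by
  obtain ⟨c, hc, hcf⟩ := hm.exists_le_density hd hε
  have := hd.cond x' hx
  have hstep : ∀ η ∈ Icc ε (1 - ε), ∀ η' ∈ Icc ε (1 - ε), η ≤ η' →
      c * (x' ⬝ᵥ β η' - x' ⬝ᵥ β η) ≤ η' - η := fun η hη η' hη' hle => by
    have hab : x' ⬝ᵥ β η ≤ x' ⬝ᵥ β η' := hm.monotoneOn_dotProduct hd hε hx hη hη' hle
    calc c * (x' ⬝ᵥ β η' - x' ⬝ᵥ β η)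
        = (ENNReal.ofReal c * volume (Ioc (x' ⬝ᵥ β η) (x' ⬝ᵥ β η'))).toReal := by
          rw [Real.volume_Ioc, ENNReal.toReal_mul, ENNReal.toReal_ofReal hc.le,
            ENNReal.toReal_ofReal (sub_nonneg.2 hab)]
      _ ≤ (condLaw f x').real (Ioc (x' ⬝ᵥ β η) (x' ⬝ᵥ β η')) := by
          refine ENNReal.toReal_mono (measure_ne_top _ _) ?_
          rw [condLaw, withDensity_apply _ measurableSet_Ioc, ← setLIntegral_const]
          exact setLIntegral_mono' measurableSet_Ioc fun q hq => ENNReal.ofReal_le_ofReal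
            (hcf x' hx η hη η' hη' q (Ioc_subset_Icc_self hq))
      _ = η' - η := by
          rw [← Iic_sdiff_Iic, measureReal_sdiff (Iic_subset_Iic.2 hab) measurableSet_Iic,
            hm.condLaw_real_Iic hd hε hη hx, hm.condLaw_real_Iic hd hε hη' hx]
  refine (LipschitzOnWith.of_le_add_mul' c⁻¹ fun η hη η' hη' => ?_).continuousOn
  rcases le_total η η' with hle | hle
  · exact (hm.monotoneOn_dotProduct hd hε hx hη hη' hle).trans
      (le_add_of_nonneg_right (by positivity))
  · rw [← sub_le_iff_le_add', Real.dist_eq, abs_of_nonneg (sub_nonneg.2 hle),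
      le_inv_mul_iff₀ hc]
    exact hstep η' hη' η hη hle

theorem memLp_covariate (hm : IsLinearQuantileModel μ y x f fY τ ε β βhat Qhat)
    (hs : IsRandomSample μ y x) (hd : HasDensities μ (y 0) (x 0) ν fX f fY)
    (hε : ε ∈ Ioo (0 : ℝ) (1 / 2)) (j : Fin d) : MemLp (fun ω => x 0 ω j) 2 μ := by
  have hεI : ε ∈ Icc ε (1 - ε) := left_mem_Icc.2 (by linarith [hε.2])
  obtain ⟨c, hc, hcf⟩ := hm.exists_le_density hd hε
  have hX := hs.measurable_x 0
  rw [memLp_two_iff_integrable_sq (by fun_prop)]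
  refine ((hm.J_integrable ε hεI j j).const_mul c⁻¹).mono (by fun_prop) ?_
  filter_upwards [ae_mem_support hX] with ω hω
  rw [Real.norm_of_nonneg (sq_nonneg _)]
  refine le_trans ?_ (le_abs_self _)
  rw [le_inv_mul_iff₀ hc, ← sq]
  gcongr
  exact hcf _ hω ε hεI ε hεI _ ⟨le_rfl, le_rfl⟩

theorem dotProduct_matching (hm : IsLinearQuantileModel μ y x f fY τ ε β βhat Qhat)
    {x' : Fin d → ℝ} (hx : x' ∈ (μ.map (x 0)).support) {η : ℝ}
    (hη : η ∈ matchingSet f Q x' ∩ Icc ε (1 - ε)) : x' ⬝ᵥ β η = Q := by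
  rw [← hm.linear x' hx _ hη.2]
  exact hη.1.2

theorem continuousOn_J_inv (hm : IsLinearQuantileModel μ y x f fY τ ε β βhat Qhat) :
    ContinuousOn (fun η => (J μ (x 0) f β η)⁻¹) (Icc ε (1 - ε)) := by
  have hJ : ContinuousOn (fun η => J μ (x 0) f β η) (Icc ε (1 - ε)) :=
    continuousOn_pi.2 fun i => continuousOn_pi.2 fun j => hm.J_continuousOn i j
  have hdet := continuous_id.matrix_det.comp_continuousOn hJ
  have hadj := continuous_id.matrix_adjugate.comp_continuousOn hJ
  refine ((hdet.inv₀ fun η hη => (hm.J_invertible η hη).ne_zero).smul hadj).congr fun η _ => ?_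
  rw [Matrix.inv_def, Ring.inverse_eq_inv']
  rfl

theorem vecMul_J_eq_zero (hm : IsLinearQuantileModel μ y x f fY τ ε β βhat Qhat) {η : ℝ}
    (hη : η ∈ Icc ε (1 - ε)) {a : Fin d → ℝ} (ha : ∀ᵐ ω ∂μ, x 0 ω ⬝ᵥ a = 0) :
    a ᵥ* J μ (x 0) f β η = 0 := by
  ext j
  calc ∑ i, a i * ∫ ω, f (x 0 ω ⬝ᵥ β η) (x 0 ω) * (x 0 ω i * x 0 ω j) ∂μ
      = ∫ ω, ∑ i, a i * (f (x 0 ω ⬝ᵥ β η) (x 0 ω) * (x 0 ω i * x 0 ω j)) ∂μ := by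
        rw [integral_finsetSum _ fun i _ => (hm.J_integrable η hη i j).const_mul _]
        simp only [integral_const_mul]
    _ = ∫ ω, f (x 0 ω ⬝ᵥ β η) (x 0 ω) * x 0 ω j * (x 0 ω ⬝ᵥ a) ∂μ := by
        simp only [dotProduct, Finset.mul_sum]
        congr! 3
        ring
    _ = 0 := integral_eq_zero_of_ae (ha.mono fun ω hω => by simp [hω])

theorem not_isLittleO_score [IsProbabilityMeasure μ] [SFinite ν]
    (hm : IsLinearQuantileModel μ y x f fY τ ε β βhat Qhat) (hs : IsRandomSample μ y x)
    (hd : HasDensities μ (y 0) (x 0) ν fX f fY) (hε : ε ∈ Ioo (0 : ℝ) (1 / 2))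
    {η : ℝ} (hη : η ∈ Icc ε (1 - ε)) {v : Fin d → ℝ} (hv : v ≠ 0) :
    ¬ (fun p : ℕ × Ω => sampleMean (fun i ω => (y i ω, x i ω))
      (score (β η) η (v ᵥ* (J μ (x 0) f β η)⁻¹)) p.1 p.2) =o[whp μ]
        fun p => (p.1 : ℝ) ^ (-(1 / 2) : ℝ) := by
  intro hlittle
  set a := v ᵥ* (J μ (x 0) f β η)⁻¹ with ha
  have hX2 := hm.memLp_covariate hs hd hε
  have hscore := memLp_score (hs.measurable_y 0) (hs.measurable_x 0) hX2
    (Ioo_subset_Icc_self (mem_Ioo_of_mem_Icc_sub hε hη)) (β η) a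
  have hzero := integral_sq_eq_zero_of_isLittleO hs.indep hs.identDistrib
    (measurable_score (β η) η a) hscore
    (hd.integral_score (hs.measurable_y 0) (hs.measurable_x 0) hX2
      (fun _ hx => hm.condLaw_real_Iic hd hε hη hx) a) hlittle
  rw [integral_eq_zero_iff_of_nonneg (fun _ => sq_nonneg _) hscore.integrable_sq] at hzero
  have hxa : ∀ᵐ ω ∂μ, x 0 ω ⬝ᵥ a = 0 := hzero.mono fun ω hω => by
    have hle := (le_sq_score hε.1.le hη (β η) a (y 0 ω, x 0 ω)).trans_eq hω
    exact pow_eq_zero_iff two_ne_zero |>.1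
      (le_antisymm (nonpos_of_mul_nonpos_right hle (pow_pos hε.1 2)) (sq_nonneg _))
  have hv0 := hm.vecMul_J_eq_zero hη hxa
  rw [ha, Matrix.vecMul_vecMul, Matrix.nonsing_inv_mul _ (hm.J_invertible η hη),
    Matrix.vecMul_one] at hv0
  exact hv hv0

end IsLinearQuantileModel

end Model

section SampleQuantile

variable {Ω : Type*} [MeasurableSpace Ω] {μ : Measure Ω} [IsProbabilityMeasure μ] {d : ℕ}
    {y : ℕ → Ω → ℝ} {x : ℕ → Ω → Fin d → ℝ} {ν : Measure (Fin d → ℝ)}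
    {fX : (Fin d → ℝ) → ℝ} {f : ℝ → (Fin d → ℝ) → ℝ} {fY : ℝ → ℝ}

@[fun_prop]
theorem measurable_influenceUQ (fYQ Q τ : ℝ) : Measurable (influenceUQ fYQ Q τ) :=
  (measurable_const.sub (Measurable.ite measurableSet_Iic measurable_const
    measurable_const)).const_mul _

theorem abs_influenceUQ_le {τ : ℝ} (hτ : τ ∈ Icc (0 : ℝ) 1) (fYQ Q y : ℝ) :
    |influenceUQ fYQ Q τ y| ≤ |fYQ⁻¹| := by
  rw [influenceUQ, abs_mul]
  refine mul_le_of_le_one_right (abs_nonneg _) (abs_le.2 ?_)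
  split_ifs <;> constructor <;> linarith [hτ.1, hτ.2]

theorem HasDensities.integral_influenceUQ {Y : Ω → ℝ} {X : Ω → Fin d → ℝ}
    (hd : HasDensities μ Y X ν fX f fY) (hY : Measurable Y) {τ : ℝ} (hτ : τ ∈ Ioo (0 : ℝ) 1)
    (fYQ : ℝ) : ∫ ω, influenceUQ fYQ (quantile (μ.map Y) τ) τ (Y ω) ∂μ = 0 := by
  set Q := quantile (μ.map Y) τ with hQ
  have hset : MeasurableSet {ω | Y ω ≤ Q} := hY measurableSet_Iic
  have hind : (fun ω => if Y ω ≤ Q then (1 : ℝ) else 0) = {ω | Y ω ≤ Q}.indicator 1 := by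
    ext ω
    simp [indicator_apply]
  simp only [influenceUQ]
  rw [integral_const_mul, integral_sub (integrable_const _)
    (hind ▸ (integrable_const (1 : ℝ)).indicator hset), hind, integral_indicator_one hset, hQ,
    hd.measureReal_le_quantile hY hτ]
  simp

theorem IsLinearQuantileModel.isLittleO_sampleQuantile {τ ε : ℝ} {β : ℝ → Fin d → ℝ}
    {βhat : ℕ → ℝ → Ω → Fin d → ℝ} {Qhat : ℕ → Ω → ℝ}
    (hm : IsLinearQuantileModel μ y x f fY τ ε β βhat Qhat) (hs : IsRandomSample μ y x)
    (hd : HasDensities μ (y 0) (x 0) ν fX f fY) (hτ : τ ∈ Ioo (0 : ℝ) 1) {s : ℕ → ℝ}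
    (hs0 : ∀ᶠ n in atTop, 0 < s n)
    (ho : (fun n : ℕ => (n : ℝ) ^ (-(1 / 2) : ℝ)) =o[atTop] s) :
    (fun p : ℕ × Ω => Qhat p.1 p.2 - quantile (μ.map (y 0)) τ) =o[whp μ] fun p => s p.1 := by
  set Q := quantile (μ.map (y 0)) τ
  have hy := hs.measurable_y
  have hx := hs.measurable_x
  let φ : ℝ × (Fin d → ℝ) → ℝ := fun p => influenceUQ (fY Q) Q τ p.1
  have h2 : MemLp (fun ω => φ (y 0 ω, x 0 ω)) 2 μ :=
    MemLp.of_bound (Measurable.aestronglyMeasurable (by fun_prop)) |(fY Q)⁻¹|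
      (ae_of_all _ fun ω => abs_influenceUQ_le (Ioo_subset_Icc_self hτ) _ _ _)
  have hrate : ∀ V : ℝ, (fun n : ℕ => √(V / n)) =o[atTop] s := fun V => by
    refine (ho.const_mul_left (√V)).congr_left fun n => ?_
    rw [Real.sqrt_div' _ n.cast_nonneg, natCast_rpow_neg_half, div_eq_mul_inv]
  have hmean := isLittleO_whp_sampleMean_sub hs.indep hs.identDistrib (φ := fun _ => φ)
    (fun _ => by fun_prop) (Eventually.of_forall fun _ => h2) hs0 (hrate _)
  have hrem := ((isLittleOp_iff_isLittleO (Eventually.of_forall fun n => by positivity)).1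
    hm.unconditional).trans (ho.comp_tendsto tendsto_fst_whp)
  refine (hrem.add hmean).congr_left fun p => ?_
  rw [show ∫ ω, φ (y 0 ω, x 0 ω) ∂μ = 0 from hd.integral_influenceUQ (hy 0) hτ _]
  simp only [sampleMean, φ, Q]
  ring

end SampleQuantile

section BoundedSupport

theorem tendsto_belowInd {ι : Type*} {d : ℕ} {l : Filter ι} {b : ι → Fin d → ℝ} {b' : Fin d → ℝ}
    {p : ℝ × (Fin d → ℝ)}
    (hb : Tendsto (fun k => p.2 ⬝ᵥ b k) l (𝓝 (p.2 ⬝ᵥ b')))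
    (hp : p.1 ≠ p.2 ⬝ᵥ b') : Tendsto (fun k => belowInd (b k) p) l (𝓝 (belowInd b' p)) := by
  refine tendsto_const_nhds.congr' ?_
  rcases hp.lt_or_gt with hlt | hlt
  · filter_upwards [hb.eventually (lt_mem_nhds hlt)] with k hk
    rw [belowInd, belowInd, if_pos hlt.le, if_pos hk.le]
  · filter_upwards [hb.eventually (gt_mem_nhds hlt)] with k hk
    rw [belowInd, belowInd, if_neg hlt.not_ge, if_neg hk.not_ge]

theorem tendsto_sampleMean_score {Ω ι : Type*} {d : ℕ} {l : Filter ι} {Z : ℕ → Ω → ℝ × (Fin d → ℝ)}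
    {b a : ι → Fin d → ℝ} {η : ι → ℝ} {b' a' : Fin d → ℝ} {η' : ℝ} {ω : Ω}
    (hb : ∀ i, Tendsto (fun k => (Z i ω).2 ⬝ᵥ b k) l (𝓝 ((Z i ω).2 ⬝ᵥ b')))
    (hne : ∀ i, (Z i ω).1 ≠ (Z i ω).2 ⬝ᵥ b') (hη : Tendsto η l (𝓝 η'))
    (ha : Tendsto a l (𝓝 a')) (n : ℕ) :
    Tendsto (fun k => sampleMean Z (score (b k) (η k) (a k)) n ω) l
      (𝓝 (sampleMean Z (score b' η' a') n ω)) :=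
  (tendsto_finsetSum _ fun i _ => (hη.sub (tendsto_belowInd (hb i) (hne i))).mul
    (((continuous_const.dotProduct continuous_id).tendsto a').comp ha)).const_mul _

theorem abs_dotProduct_le_mul_norm {d : ℕ} (a v : Fin d → ℝ) : |v ⬝ᵥ a| ≤ d * ‖a‖ * ‖v‖ := by
  refine (abs_dotProduct_le a v).trans ?_
  rw [mul_comm (d : ℝ), mul_assoc]
  gcongr
  simpa using Finset.sum_le_sum fun j (_ : j ∈ Finset.univ) => norm_le_pi_norm v j

theorem abs_le_of_abs_sub_mul_le {c φ Δ q t : ℝ} (hc : 0 < c) (hφ : c ≤ φ) (hΔ : |Δ| ≤ 1)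
    (hq : |q| ≤ 1) (h : |Δ - φ * (-t + q)| ≤ 1) : |t| ≤ 2 / c + 1 := by
  have hsum : |φ * (-t + q)| ≤ 2 := by
    rw [abs_le] at *
    constructor <;> linarith [h.1, h.2, hΔ.1, hΔ.2]
  have hmul : c * |-t + q| ≤ 2 := by
    rw [abs_mul, abs_of_pos (hc.trans_le hφ)] at hsum
    exact (mul_le_mul_of_nonneg_right hφ (abs_nonneg _)).trans hsum
  have hq' := abs_sub q (-t + q)
  rw [sub_add_cancel_right, neg_neg] at hq'
  rw [← le_div_iff₀' hc] at hmul
  linarith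

variable {Ω : Type*} [MeasurableSpace Ω] {μ : Measure Ω} {d : ℕ}
    {y : ℕ → Ω → ℝ} {x : ℕ → Ω → Fin d → ℝ} {ν : Measure (Fin d → ℝ)}
    {fX : (Fin d → ℝ) → ℝ} {f : ℝ → (Fin d → ℝ) → ℝ} {fY : ℝ → ℝ}
    {τ ε Q : ℝ} {β : ℝ → Fin d → ℝ} {ξ : (Fin d → ℝ) → ℝ}
    {βhat : ℕ → ℝ → Ω → Fin d → ℝ} {Qhat : ℕ → Ω → ℝ} {ξhat : ℕ → (Fin d → ℝ) → Ω → ℝ}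

theorem sampleMean_score_smul {Ω : Type*} {Z : ℕ → Ω → ℝ × (Fin d → ℝ)} (b a : Fin d → ℝ)
    (η c : ℝ) (n : ℕ) (ω : Ω) :
    sampleMean Z (score b η (c • a)) n ω = c * sampleMean Z (score b η a) n ω := by
  simp only [sampleMean, score, dotProduct_smul, smul_eq_mul, Finset.mul_sum]
  exact Finset.sum_congr rfl fun i _ => by ring

namespace IsLinearQuantileModel

variable [IsProbabilityMeasure μ] [NeZero d]

theorem eventually_abs_dotProduct_sub_le
    (hm : IsLinearQuantileModel μ y x f fY τ ε β βhat Qhat) (hs : IsRandomSample μ y x)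
    (hd : HasDensities μ (y 0) (x 0) ν fX f fY) (hτ : τ ∈ Ioo (0 : ℝ) 1)
    (hε : ε ∈ Ioo (0 : ℝ) (1 / 2))
    (hξ : ∀ x' ∈ (μ.map (x 0)).support,
      ξ x' ∈ matchingSet f (quantile (μ.map (y 0)) τ) x' ∩ Icc ε (1 - ε))
    (hξhat : ∀ n x' ω, ξhat n x' ω ∈ Icc ε (1 - ε))
    (ha : ApproxAssumption μ (μ.map (x 0)).support f ε (quantile (μ.map (y 0)) τ) β ξ βhat Qhat
      ξhat) :
    ∃ C, ∀ᶠ p in whp μ, ∀ x' ∈ (μ.map (x 0)).support,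
      |x' ⬝ᵥ (βhat p.1 (ξ x') p.2 - β (ξ x'))| ≤ C := by
  obtain ⟨c, hc, hcf⟩ := hm.exists_le_density hd hε
  have hle : ∀ n : ℕ, n ≠ 0 → (n : ℝ) ^ (-(1 / 2) : ℝ) ≤ 1 := fun n hn =>
    Real.rpow_le_one_of_one_le_of_nonpos (by exact_mod_cast Nat.one_le_iff_ne_zero.2 hn)
      (by norm_num)
  have hQ := hm.isLittleO_sampleQuantile hs hd hτ (s := fun _ => 1) (by simp)
    ((Asymptotics.isLittleO_one_iff ℝ).2 ((tendsto_rpow_neg_atTop (by norm_num)).comp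
      tendsto_natCast_atTop_atTop))
  refine ⟨2 / c + 1, ?_⟩
  filter_upwards [hQ.def one_pos, ha.remainder.eventually_forall_norm_le one_pos,
      tendsto_fst_whp.eventually (eventually_ne_atTop 0)]
    with p hQp hremp hp x' hx
  have hΔ : |ξhat p.1 x' p.2 - ξ x'| ≤ 1 := by
    have h1 := hξhat p.1 x' p.2
    have h2 := (hξ x' hx).2
    exact abs_le.2 ⟨by linarith [h1.1, h2.2, hε.1], by linarith [h1.2, h2.1, hε.1]⟩
  refine abs_le_of_abs_sub_mul_le hc
    (hcf x' hx _ (hξ x' hx).2 _ (hξ x' hx).2 _ ⟨le_rfl, le_rfl⟩) hΔ (by simpa using hQp) ?_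
  exact (hremp x' hx).trans (by simpa using hle p.1 hp)

theorem eventually_abs_sampleMean_score_le
    (hm : IsLinearQuantileModel μ y x f fY τ ε β βhat Qhat) (hs : IsRandomSample μ y x)
    (hd : HasDensities μ (y 0) (x 0) ν fX f fY) (hτ : τ ∈ Ioo (0 : ℝ) 1)
    (hε : ε ∈ Ioo (0 : ℝ) (1 / 2))
    (hξ : ∀ x' ∈ (μ.map (x 0)).support,
      ξ x' ∈ matchingSet f (quantile (μ.map (y 0)) τ) x' ∩ Icc ε (1 - ε))
    (hξhat : ∀ n x' ω, ξhat n x' ω ∈ Icc ε (1 - ε))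
    (ha : ApproxAssumption μ (μ.map (x 0)).support f ε (quantile (μ.map (y 0)) τ) β ξ βhat Qhat
      ξhat) :
    ∃ C, ∀ δ > 0, ∀ᶠ p in whp μ, ∀ x' ∈ (μ.map (x 0)).support,
      |sampleMean (fun i ω => (y i ω, x i ω))
          (score (β (ξ x')) (ξ x') (x' ᵥ* (J μ (x 0) f β (ξ x'))⁻¹)) p.1 p.2| ≤
        C + δ * (p.1 : ℝ) ^ (-(1 / 2) : ℝ) * ‖x'‖ := by
  obtain ⟨C, hC⟩ := hm.eventually_abs_dotProduct_sub_le hs hd hτ hε hξ hξhat ha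
  refine ⟨C, fun δ hδ => ?_⟩
  have hd0 : (0 : ℝ) < d := Nat.cast_pos.2 (NeZero.pos d)
  filter_upwards [hC, hm.bahadur.eventually_forall_norm_le (div_pos hδ hd0)] with p hCp hbahp x' hx
  rw [← dotProduct_mean_influenceQR]
  set b := βhat p.1 (ξ x') p.2 - β (ξ x')
  set G := (p.1 : ℝ)⁻¹ • ∑ i ∈ Finset.range p.1, influenceQR (J μ (x 0) f β (ξ x')) (β (ξ x'))
    (ξ x') (y i p.2) (x i p.2)
  have hG : ‖b - G‖ ≤ δ / d * (p.1 : ℝ) ^ (-(1 / 2) : ℝ) := hbahp _ (hξ x' hx).2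
  calc |x' ⬝ᵥ G| ≤ |x' ⬝ᵥ b| + |x' ⬝ᵥ (b - G)| := by
        rw [dotProduct_sub x' b G]
        simpa using abs_sub (x' ⬝ᵥ b) (x' ⬝ᵥ b - x' ⬝ᵥ G)
    _ ≤ C + d * (δ / d * (p.1 : ℝ) ^ (-(1 / 2) : ℝ)) * ‖x'‖ := by
        gcongr
        · exact hCp x' hx
        · exact (abs_dotProduct_le_mul_norm _ _).trans (by gcongr)
    _ = C + δ * (p.1 : ℝ) ^ (-(1 / 2) : ℝ) * ‖x'‖ := by field_simp

-- Division by `‖X k‖` removes the constant from the bound of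
-- `eventually_abs_sampleMean_score_le`, since `‖X k‖ → ∞`.
theorem isLittleO_sampleMean_score_of_tendsto [SFinite ν]
    (hm : IsLinearQuantileModel μ y x f fY τ ε β βhat Qhat) (hs : IsRandomSample μ y x)
    (hd : HasDensities μ (y 0) (x 0) ν fX f fY) (hτ : τ ∈ Ioo (0 : ℝ) 1)
    (hε : ε ∈ Ioo (0 : ℝ) (1 / 2))
    (hξ : ∀ x' ∈ (μ.map (x 0)).support,
      ξ x' ∈ matchingSet f (quantile (μ.map (y 0)) τ) x' ∩ Icc ε (1 - ε))
    (hξhat : ∀ n x' ω, ξhat n x' ω ∈ Icc ε (1 - ε))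
    (ha : ApproxAssumption μ (μ.map (x 0)).support f ε (quantile (μ.map (y 0)) τ) β ξ βhat Qhat
      ξhat)
    {X : ℕ → Fin d → ℝ} (hX : ∀ k, X k ∈ (μ.map (x 0)).support)
    (hXtop : Tendsto (fun k => ‖X k‖) atTop atTop) {v : Fin d → ℝ}
    (hv : Tendsto (fun k => ‖X k‖⁻¹ • X k) atTop (𝓝 v)) {η : ℝ} (hη : η ∈ Icc ε (1 - ε))
    (hξη : Tendsto (fun k => ξ (X k)) atTop (𝓝 η)) :
    (fun p : ℕ × Ω => sampleMean (fun i ω => (y i ω, x i ω))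
      (score (β η) η (v ᵥ* (J μ (x 0) f β η)⁻¹)) p.1 p.2) =o[whp μ]
        fun p => (p.1 : ℝ) ^ (-(1 / 2) : ℝ) := by
  obtain ⟨C, hC⟩ := hm.eventually_abs_sampleMean_score_le hs hd hτ hε hξ hξhat ha
  have hξw : Tendsto (fun k => ξ (X k)) atTop (𝓝[Icc ε (1 - ε)] η) :=
    tendsto_nhdsWithin_iff.2 ⟨hξη, Eventually.of_forall fun k => (hξ _ (hX k)).2⟩
  have ha : Tendsto (fun k => (‖X k‖⁻¹ • X k) ᵥ* (J μ (x 0) f β (ξ (X k)))⁻¹) atTop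
      (𝓝 (v ᵥ* (J μ (x 0) f β η)⁻¹)) :=
    ((continuous_fst.matrix_vecMul continuous_snd).tendsto (v, (J μ (x 0) f β η)⁻¹)).comp
      (hv.prodMk_nhds ((hm.continuousOn_J_inv η hη).tendsto.comp hξw))
  have hgood : ∀ᶠ p in whp μ, ∀ i, x i p.2 ∈ (μ.map (x 0)).support ∧
      y i p.2 ≠ x i p.2 ⬝ᵥ β η := by
    have hne : MeasurableSet {p : ℝ × (Fin d → ℝ) | p.1 ≠ p.2 ⬝ᵥ β η} :=
      (measurableSet_eq_fun measurable_fst (by fun_prop)).compl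
    refine eventually_whp_of_eventually_ae (Eventually.of_forall fun n => ?_)
    filter_upwards [hs.ae_forall_mem_support, hs.ae_forall hne
      (hd.ae_ne_dotProduct (hs.measurable_y 0) (hs.measurable_x 0) (β η))] with ω h1 h2 i
    exact ⟨h1 i, h2 i⟩
  refine Asymptotics.isLittleO_iff.2 fun δ hδ => ?_
  filter_upwards [hC δ hδ, hgood] with p hp hgoodp
  have hlim := tendsto_sampleMean_score (Z := fun i ω => (y i ω, x i ω))
    (fun i => ((hm.continuousOn_dotProduct hd hε (hgoodp i).1) η hη).tendsto.comp hξw)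
    (fun i => (hgoodp i).2) hξη ha p.1
  have hbound : Tendsto (fun k => ‖X k‖⁻¹ * C + δ * (p.1 : ℝ) ^ (-(1 / 2) : ℝ)) atTop
      (𝓝 (δ * (p.1 : ℝ) ^ (-(1 / 2) : ℝ))) := by
    simpa using (hXtop.inv_tendsto_atTop.mul_const C).add_const _
  rw [Real.norm_of_nonneg (by positivity : (0 : ℝ) ≤ (p.1 : ℝ) ^ (-(1 / 2) : ℝ))]
  refine le_of_tendsto_of_tendsto hlim.norm hbound ?_
  filter_upwards [hXtop.eventually_gt_atTop 0] with k hk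
  rw [Matrix.smul_vecMul, sampleMean_score_smul, norm_mul, norm_inv, norm_norm, Real.norm_eq_abs,
    inv_mul_le_iff₀ hk, mul_add, mul_inv_cancel_left₀ hk.ne', mul_comm ‖X k‖]
  exact hp (X k) (hX k)

theorem isBounded_support [SFinite ν]
    (hm : IsLinearQuantileModel μ y x f fY τ ε β βhat Qhat) (hs : IsRandomSample μ y x)
    (hd : HasDensities μ (y 0) (x 0) ν fX f fY) (hτ : τ ∈ Ioo (0 : ℝ) 1)
    (hε : ε ∈ Ioo (0 : ℝ) (1 / 2))
    (hξ : ∀ x' ∈ (μ.map (x 0)).support,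
      ξ x' ∈ matchingSet f (quantile (μ.map (y 0)) τ) x' ∩ Icc ε (1 - ε))
    (hξhat : ∀ n x' ω, ξhat n x' ω ∈ Icc ε (1 - ε))
    (ha : ApproxAssumption μ (μ.map (x 0)).support f ε (quantile (μ.map (y 0)) τ) β ξ βhat Qhat
      ξhat) : Bornology.IsBounded (μ.map (x 0)).support := by
  by_contra hunb
  have hex : ∀ k : ℕ, ∃ x' ∈ (μ.map (x 0)).support, (k : ℝ) < ‖x'‖ := fun k => by
    by_contra! hcon
    exact hunb (isBounded_iff_forall_norm_le.2 ⟨k, hcon⟩)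
  choose X hXS hXk using hex
  have hXtop : Tendsto (fun k => ‖X k‖) atTop atTop :=
    tendsto_atTop_mono (fun k => (hXk k).le) tendsto_natCast_atTop_atTop
  have hnorm : ∀ k, ‖‖X k‖⁻¹ • X k‖ = 1 := fun k => by
    rw [norm_smul, norm_inv, norm_norm,
      inv_mul_cancel₀ ((Nat.cast_nonneg k).trans_lt (hXk k)).ne']
  obtain ⟨⟨v, η⟩, hvη, s, hsmono, hslim⟩ :=
    ((isCompact_closedBall (0 : Fin d → ℝ) 1).prod (isCompact_Icc (a := ε) (b := 1 - ε)))
      |>.tendsto_subseq (x := fun k => (‖X k‖⁻¹ • X k, ξ (X k))) fun k =>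
        ⟨mem_closedBall_zero_iff.2 (hnorm k).le, (hξ _ (hXS k)).2⟩
  have hv := (continuous_fst.tendsto _).comp hslim
  have hv1 : ‖v‖ = 1 := tendsto_nhds_unique hv.norm (by
    simp only [Function.comp_apply, hnorm, tendsto_const_nhds])
  exact hm.not_isLittleO_score hs hd hε hvη.2 (norm_ne_zero_iff.1 (by simp [hv1]))
    (hm.isLittleO_sampleMean_score_of_tendsto hs hd hτ hε hξ hξhat ha (fun k => hXS (s k))
      (hXtop.comp hsmono.tendsto_atTop) hv hvη.2 ((continuous_snd.tendsto _).comp hslim))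

end IsLinearQuantileModel

end BoundedSupport

section Bandwidth

theorem tendsto_natCast_rpow_neg {b : ℝ} (hb : 0 < b) :
    Tendsto (fun n : ℕ => (n : ℝ) ^ (-b)) atTop (𝓝 0) :=
  (tendsto_rpow_neg_atTop hb).comp tendsto_natCast_atTop_atTop

/-- The bandwidths for which the theorem holds: of larger order than `n^{-1/2}`, so that the
quantile estimator is accurate on the scale `h`, and of smaller order than `(log n)^{-3}`, which
absorbs the logarithms lost in the dyadic chaining argument. -/
structure IsAdmissibleBandwidth (h : ℕ → ℝ) : Prop where
  eventually_pos : ∀ᶠ n in atTop, 0 < h n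
  tendsto_rpow_div : Tendsto (fun n : ℕ => (n : ℝ) ^ (-(1 / 2) : ℝ) / h n) atTop (𝓝 0)
  tendsto_log_mul : Tendsto (fun n : ℕ => Real.log n ^ 3 * h n) atTop (𝓝 0)

/-- The rate `(n h)^{-1/2}`. -/
def kernelRate (h : ℕ → ℝ) (n : ℕ) : ℝ := (n : ℝ) ^ (-(1 / 2) : ℝ) * h n ^ (-(1 / 2) : ℝ)

variable {h : ℕ → ℝ}

theorem kernelRate_sq {n : ℕ} (hh : 0 < h n) : kernelRate h n ^ 2 = (n * h n)⁻¹ := by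
  unfold kernelRate
  rw [mul_pow, ← Real.rpow_natCast, ← Real.rpow_natCast, ← Real.rpow_mul (Nat.cast_nonneg n),
    ← Real.rpow_mul hh.le]
  norm_num [Real.rpow_neg_one, mul_comm]

theorem tendsto_log_cube_mul_rpow_neg {a : ℝ} (ha : 0 < a) :
    Tendsto (fun n : ℕ => Real.log n ^ 3 * (n : ℝ) ^ (-a)) atTop (𝓝 0) := by
  have hlog : Tendsto (fun t : ℝ => Real.log t ^ (3 : ℝ) / t ^ a) atTop (𝓝 0) :=
    (isLittleO_log_rpow_rpow_atTop 3 ha).tendsto_div_nhds_zero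
  refine (hlog.comp tendsto_natCast_atTop_atTop).congr fun n => ?_
  simp only [Function.comp_apply]
  rw [Real.rpow_neg n.cast_nonneg, div_eq_mul_inv]
  norm_cast

theorem BandwidthAssumption.isAdmissibleBandwidth {a : ℝ} {r : ℕ}
    (hb : BandwidthAssumption h a r) : IsAdmissibleBandwidth h := by
  obtain ⟨c, C, hc, hrate⟩ := hb.rate
  have ha : 0 < a := lt_of_lt_of_le (by positivity) hb.lower
  have hpos : ∀ᶠ n in atTop, 0 < h n := by
    filter_upwards [hrate, eventually_gt_atTop 0] with n hn hn0
    have : (0 : ℝ) < n := Nat.cast_pos.2 hn0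
    exact lt_of_lt_of_le (by positivity) hn.1
  refine ⟨hpos, ?_, ?_⟩
  · have hlim := (tendsto_natCast_rpow_neg (sub_pos.2 hb.upper)).const_mul c⁻¹
    rw [mul_zero] at hlim
    refine squeeze_zero' (hpos.mono fun n hn => by positivity) ?_ hlim
    filter_upwards [hrate, eventually_gt_atTop 0] with n hn hn0
    have hn0 : (0 : ℝ) < n := Nat.cast_pos.2 hn0
    rw [show -(1 / 2 - a) = -(1 / 2) - -a by ring, Real.rpow_sub hn0, ← div_eq_inv_mul, div_div,
      mul_comm _ c]
    exact div_le_div_of_nonneg_left (by positivity) (by positivity) hn.1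
  · have hlim := (tendsto_log_cube_mul_rpow_neg ha).const_mul C
    rw [mul_zero] at hlim
    have hlog : ∀ n : ℕ, 0 ≤ Real.log n ^ 3 := fun n => pow_nonneg (Real.log_natCast_nonneg n) 3
    refine squeeze_zero' (hpos.mono fun n hn => mul_nonneg (hlog n) hn.le) ?_ hlim
    filter_upwards [hrate] with n hn
    rw [mul_left_comm]
    exact mul_le_mul_of_nonneg_left hn.2 (hlog n)

namespace IsAdmissibleBandwidth

theorem tendsto_natLog_mul (hb : IsAdmissibleBandwidth h) :
    Tendsto (fun n => ((Nat.log 2 n : ℝ) + 2) ^ 3 * h n) atTop (𝓝 0) := by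
  have hlim := hb.tendsto_log_mul.const_mul (((Real.log 2)⁻¹ + 2) ^ 3)
  rw [mul_zero] at hlim
  refine squeeze_zero' (hb.eventually_pos.mono fun n hn => by positivity) ?_ hlim
  have hlog : Tendsto (fun n : ℕ => Real.log n) atTop atTop :=
    Real.tendsto_log_atTop.comp tendsto_natCast_atTop_atTop
  filter_upwards [hb.eventually_pos, hlog.eventually_ge_atTop 1] with n hn h1
  rw [← mul_assoc, ← mul_pow]
  gcongr
  have hle : (Nat.log 2 n : ℝ) ≤ Real.log n / Real.log 2 := by
    simpa [Real.logb] using Real.natLog_le_logb n 2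
  rw [div_eq_inv_mul] at hle
  linarith

theorem tendsto_zero (hb : IsAdmissibleBandwidth h) : Tendsto h atTop (𝓝 0) := by
  refine squeeze_zero' (hb.eventually_pos.mono fun n hn => hn.le) ?_ hb.tendsto_natLog_mul
  filter_upwards [hb.eventually_pos] with n hn
  exact le_mul_of_one_le_left hn.le (one_le_pow₀ (by linarith [(Nat.log 2 n).cast_nonneg (α := ℝ)]))

theorem eventually_kernelRate_pos (hb : IsAdmissibleBandwidth h) :
    ∀ᶠ n in atTop, 0 < kernelRate h n := by
  filter_upwards [hb.eventually_pos, eventually_gt_atTop 0] with n hn hn0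
  exact mul_pos (Real.rpow_pos_of_pos (Nat.cast_pos.2 hn0) _) (Real.rpow_pos_of_pos hn _)

theorem tendsto_rpow_half (hb : IsAdmissibleBandwidth h) :
    Tendsto (fun n => h n ^ (1 / 2 : ℝ)) atTop (𝓝 0) := by
  simpa using hb.tendsto_zero.rpow_const (p := 1 / 2) (Or.inr (by norm_num))

theorem rpow_isLittleO_kernelRate (hb : IsAdmissibleBandwidth h) :
    (fun n : ℕ => (n : ℝ) ^ (-(1 / 2) : ℝ)) =o[atTop] kernelRate h := by
  refine Asymptotics.isLittleO_of_tendsto' ?_ (hb.tendsto_rpow_half.congr' ?_)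
  · exact hb.eventually_kernelRate_pos.mono fun n hn h0 => absurd h0 hn.ne'
  · filter_upwards [hb.eventually_pos, eventually_gt_atTop 0] with n hn hn0
    have := Real.rpow_pos_of_pos (Nat.cast_pos.2 hn0 : (0 : ℝ) < n) (-(1 / 2))
    rw [kernelRate, Real.rpow_neg hn.le, div_mul_cancel_left₀ this.ne', inv_inv]

theorem tendsto_kernelRate (hb : IsAdmissibleBandwidth h) :
    Tendsto (kernelRate h) atTop (𝓝 0) := by
  have hlim := hb.tendsto_rpow_div.mul hb.tendsto_rpow_half
  rw [mul_zero] at hlim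
  refine hlim.congr' (hb.eventually_pos.mono fun n hn => ?_)
  rw [kernelRate, div_mul_eq_mul_div, mul_div_assoc, ← Real.rpow_sub_one hn.ne']
  norm_num

end IsAdmissibleBandwidth

end Bandwidth

section UniformRate

theorem abs_sub_mul_le_of_monotoneOn_of_grid {G : ℝ → ℝ} {lo hi M e : ℝ} (hlt : lo < hi)
    (hG : MonotoneOn G (Icc lo hi)) (hM : 0 ≤ M) {N : ℕ} (hN : 0 < N)
    (hgrid : ∀ j ≤ N, |G (lo + (hi - lo) * (j / N)) - (lo + (hi - lo) * (j / N)) * M| ≤ e)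
    {η : ℝ} (hη : η ∈ Icc lo hi) : |G η - η * M| ≤ (hi - lo) / N * M + e := by
  have hw : 0 < hi - lo := sub_pos.2 hlt
  have hN0 : (0 : ℝ) < N := Nat.cast_pos.2 hN
  obtain ⟨u, hu, rfl⟩ : ∃ u ∈ Icc (0 : ℝ) N, lo + (hi - lo) * (u / N) = η :=
    ⟨(η - lo) / (hi - lo) * N, ⟨by have := sub_nonneg.2 hη.1; positivity,
      mul_le_of_le_one_left hN0.le ((div_le_one hw).2 (by linarith [hη.2]))⟩, by field_simp; ring⟩
  have hmem : ∀ j : ℕ, j ≤ N → lo + (hi - lo) * (j / N) ∈ Icc lo hi := fun j hj => by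
    have hj1 : (j : ℝ) / N ≤ 1 := (div_le_one hN0).2 (Nat.cast_le.2 hj)
    have hj0 : 0 ≤ (j : ℝ) / N := by positivity
    exact ⟨by nlinarith, by nlinarith⟩
  have hfl := Nat.floor_le_of_le hu.2
  have hce := Nat.ceil_le.2 hu.2
  have hstep : ∀ s : ℝ, s ≤ 1 → (hi - lo) * (s / N) * M ≤ (hi - lo) / N * M := fun s hs => by
    rw [mul_div_assoc']
    gcongr
    exact mul_le_of_le_one_right hw.le hs
  have hlo := hstep (u - ⌊u⌋₊) (by linarith [Nat.lt_floor_add_one u])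
  have hhi := hstep (⌈u⌉₊ - u) (by linarith [Nat.ceil_lt_add_one hu.1])
  have hGlo := hG (hmem _ hfl) hη (by gcongr; exact Nat.floor_le hu.1)
  have hGhi := hG hη (hmem _ hce) (by gcongr; exact Nat.le_ceil u)
  have h1 := abs_le.1 (hgrid _ hfl)
  have h2 := abs_le.1 (hgrid _ hce)
  rw [sub_div] at hlo hhi
  exact abs_le.2 ⟨by linarith [h1.1], by linarith [h2.2]⟩

theorem measure_exists_lt_abs_sub_mul_le {Ω : Type*} [MeasurableSpace Ω] {μ : Measure Ω}
    {G : ℝ → Ω → ℝ} {lo hi M V : ℝ} (hlt : lo < hi) (hM : 0 ≤ M) (hV : 0 ≤ V)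
    (hG : ∀ᵐ ω ∂μ, MonotoneOn (fun η => G η ω) (Icc lo hi)) {t : ℝ} (ht : 0 < t)
    (hincr : ∀ η ∈ Icc lo hi, ∀ η' ∈ Icc lo hi, η ≤ η' →
      μ {ω | t < |(G η' ω - η' * M) - (G η ω - η * M)|} ≤
        ENNReal.ofReal ((η' - η) * (V / t ^ 2))) (L : ℕ) :
    μ {ω | ∃ η ∈ Icc lo hi,
        (hi - lo) / 2 ^ L * M + ((L + 1) * t + |G lo ω - lo * M|) < |G η ω - η * M|} ≤
      ENNReal.ofReal ((L + 1) * (hi - lo) * (V / t ^ 2)) := by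
  have hw : 0 < hi - lo := sub_pos.2 hlt
  let pt : ℕ → ℝ := fun j => lo + (hi - lo) * (j / (2 ^ L : ℕ))
  have hpt : ∀ j ≤ 2 ^ L, pt j ∈ Icc lo hi := fun j hj => by
    have hj1 : (j : ℝ) / (2 ^ L : ℕ) ≤ 1 := (div_le_one (by positivity)).2 (Nat.cast_le.2 hj)
    have hj0 : 0 ≤ (j : ℝ) / (2 ^ L : ℕ) := by positivity
    exact ⟨by simp only [pt]; nlinarith, by simp only [pt]; nlinarith⟩
  have hchain := measure_exists_lt_abs_sub_le ht L ((hi - lo) / 2 ^ L * (V / t ^ 2))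
    (fun j ω => G (pt j) ω - pt j * M) (by positivity) fun i j hij hj => by
      refine (hincr _ (hpt i (hij.trans hj)) _ (hpt j hj) ?_).trans_eq ?_
      · simp only [pt]
        gcongr
      · simp only [pt]
        push_cast
        congr 1
        ring
  refine (measure_mono_ae ?_).trans (hchain.trans_eq (by congr 1; field_simp))
  filter_upwards [hG] with ω hω
  rintro ⟨η, hη, hηlt⟩
  change ∃ j ≤ 2 ^ L, _
  by_contra! hcon
  refine hηlt.not_ge ?_
  have hpt0 : pt 0 = lo := by simp [pt]
  have hgrid : ∀ j ≤ 2 ^ L, |G (pt j) ω - pt j * M| ≤ (L + 1) * t + |G lo ω - lo * M| :=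
    fun j hj => by
      have h1 := hcon j hj
      rw [hpt0] at h1
      linarith [abs_sub_abs_le_abs_sub (G (pt j) ω - pt j * M) (G lo ω - lo * M)]
  exact_mod_cast abs_sub_mul_le_of_monotoneOn_of_grid hlt hω hM (by positivity) hgrid hη

theorem memLp_mul_of_abs_le_one {Ω : Type*} [MeasurableSpace Ω] {μ : Measure Ω} {d : ℕ}
    {Y : Ω → ℝ} {X : Ω → Fin d → ℝ} (hY : Measurable Y) (hX : Measurable X)
    {g : (Fin d → ℝ) → ℝ} (hg : Measurable g) (hg2 : MemLp (fun ω => g (X ω)) 2 μ)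
    {ψ : ℝ × (Fin d → ℝ) → ℝ} (hψ : Measurable ψ) (hψ1 : ∀ p, |ψ p| ≤ 1) :
    MemLp (fun ω => g (X ω) * ψ (Y ω, X ω)) 2 μ :=
  hg2.mono (Measurable.aestronglyMeasurable (by fun_prop)) <| ae_of_all _ fun ω => by
    rw [norm_mul]
    exact mul_le_of_le_one_right (norm_nonneg _) (hψ1 _)

theorem IsAdmissibleBandwidth.isLittleO_sqrt_div {h : ℕ → ℝ} (hh : IsAdmissibleBandwidth h)
    (c : ℝ) : (fun n : ℕ => √(c / n)) =o[atTop] kernelRate h :=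
  (hh.rpow_isLittleO_kernelRate.const_mul_left √c).congr_left fun n => by
    rw [Real.sqrt_div' _ n.cast_nonneg, natCast_rpow_neg_half, div_eq_mul_inv]

theorem monotoneOn_dotProduct_of_condLaw {d : ℕ} {f : ℝ → (Fin d → ℝ) → ℝ} {x : Fin d → ℝ}
    [IsProbabilityMeasure (condLaw f x)] {s : Set ℝ} {b : ℝ → Fin d → ℝ}
    (hb : ∀ η ∈ s, (condLaw f x).real (Iic (x ⬝ᵥ b η)) = η) :
    MonotoneOn (fun η => x ⬝ᵥ b η) s := fun η hη η' hη' hle => by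
  by_contra! hlt
  have hle' : (condLaw f x).real (Iic (x ⬝ᵥ b η')) ≤ (condLaw f x).real (Iic (x ⬝ᵥ b η)) :=
    measureReal_mono (Iic_subset_Iic.2 hlt.le)
  rw [hb η hη, hb η' hη'] at hle'
  exact hlt.ne' (by rw [hle.antisymm hle'])

/-- The process `n⁻¹ ∑ g(x_i) 1{y_i ≤ x_i'b(η)}`, indexed by the quantile level `η`. -/
def belowMean {Ω : Type*} {d : ℕ} (y : ℕ → Ω → ℝ) (x : ℕ → Ω → Fin d → ℝ)
    (b : ℝ → Fin d → ℝ) (g : (Fin d → ℝ) → ℝ) (n : ℕ) (η : ℝ) (ω : Ω) : ℝ :=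
  sampleMean (fun i ω => (y i ω, x i ω)) (fun p => g p.2 * belowInd (b η) p) n ω

variable {Ω : Type*} [MeasurableSpace Ω] {μ : Measure Ω} [IsProbabilityMeasure μ] {d : ℕ}
    {y : ℕ → Ω → ℝ} {x : ℕ → Ω → Fin d → ℝ} {ν : Measure (Fin d → ℝ)} [SFinite ν]
    {fX : (Fin d → ℝ) → ℝ} {f : ℝ → (Fin d → ℝ) → ℝ} {fY : ℝ → ℝ}
    {lo hi : ℝ} {b : ℝ → Fin d → ℝ} {g : (Fin d → ℝ) → ℝ}

theorem measure_lt_abs_belowMean_sub_le (hs : IsRandomSample μ y x)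
    (hd : HasDensities μ (y 0) (x 0) ν fX f fY)
    (hb : ∀ x' ∈ (μ.map (x 0)).support, ∀ η ∈ Icc lo hi, (condLaw f x').real (Iic (x' ⬝ᵥ b η)) = η)
    (hg : Measurable g) (hg2 : MemLp (fun ω => g (x 0 ω)) 2 μ) {η η' : ℝ} (hη : η ∈ Icc lo hi)
    (hη' : η' ∈ Icc lo hi) (hle : η ≤ η') {n : ℕ} (hn : n ≠ 0) {t : ℝ} (ht : 0 < t) :
    μ {ω | t < |(belowMean y x b g n η' ω - η' * ∫ ω, g (x 0 ω) ∂μ) -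
        (belowMean y x b g n η ω - η * ∫ ω, g (x 0 ω) ∂μ)|} ≤
      ENNReal.ofReal ((η' - η) * ((∫ ω, g (x 0 ω) ^ 2 ∂μ) / n / t ^ 2)) := by
  have hY := hs.measurable_y 0
  have hX := hs.measurable_x 0
  have hmono : ∀ x' ∈ (μ.map (x 0)).support, x' ⬝ᵥ b η ≤ x' ⬝ᵥ b η' := fun x' hx => by
    have := hd.cond x' hx
    exact monotoneOn_dotProduct_of_condLaw (hb x' hx) hη hη' hle
  let φ : ℝ × (Fin d → ℝ) → ℝ := fun p => g p.2 * (belowInd (b η') p - belowInd (b η) p)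
  have hφ : Measurable φ := by fun_prop
  have hmean : ∫ ω, φ (y 0 ω, x 0 ω) ∂μ = (η' - η) * ∫ ω, g (x 0 ω) ∂μ :=
    hd.integral_mul_belowInd_sub hY hX (fun x' hx => hb x' hx η' hη')
      (fun x' hx => hb x' hx η hη) hg (hg2.integrable one_le_two)
  have hsq : ∫ ω, φ (y 0 ω, x 0 ω) ^ 2 ∂μ ≤ (η' - η) * ∫ ω, g (x 0 ω) ^ 2 ∂μ := by
    have := hd.integral_sq_mul_belowInd_sub_le hY hX (fun x' hx => hb x' hx η' hη')
      (fun x' hx => hb x' hx η hη) (Or.inr hmono) hg hg2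
    rwa [abs_of_nonneg (sub_nonneg.2 hle)] at this
  have hsub : ∀ ω, (belowMean y x b g n η' ω - η' * ∫ ω, g (x 0 ω) ∂μ) -
      (belowMean y x b g n η ω - η * ∫ ω, g (x 0 ω) ∂μ) =
      sampleMean (fun i ω => (y i ω, x i ω)) φ n ω - ∫ ω, φ (y 0 ω, x 0 ω) ∂μ := fun ω => by
    rw [hmean]
    simp only [belowMean, sampleMean, φ, mul_sub, Finset.sum_sub_distrib]
    ring
  simp only [hsub]
  have hφ2 : MemLp (fun ω => φ (y 0 ω, x 0 ω)) 2 μ :=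
    memLp_mul_of_abs_le_one hY hX hg hg2 (ψ := fun p => belowInd (b η') p - belowInd (b η) p)
      (by fun_prop) fun p => abs_le.2
        ⟨by linarith [belowInd_nonneg (b η') p, belowInd_le_one (b η) p],
          by linarith [belowInd_nonneg (b η) p, belowInd_le_one (b η') p]⟩
  refine (measure_lt_abs_sampleMean_sub_le hs.indep hs.identDistrib hφ hφ2 hn ht).trans
    (ENNReal.ofReal_le_ofReal ?_)
  rw [mul_div_assoc', mul_div_assoc']
  gcongr

theorem measure_exists_lt_abs_belowMean_sub_le (hs : IsRandomSample μ y x)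
    (hd : HasDensities μ (y 0) (x 0) ν fX f fY) (hlt : lo < hi)
    (hb : ∀ x' ∈ (μ.map (x 0)).support, ∀ η ∈ Icc lo hi, (condLaw f x').real (Iic (x' ⬝ᵥ b η)) = η)
    (hg : Measurable g) (hg0 : 0 ≤ g) (hg2 : MemLp (fun ω => g (x 0 ω)) 2 μ)
    {n : ℕ} (hn : n ≠ 0) {t : ℝ} (ht : 0 < t) (L : ℕ) :
    μ {ω | ∃ η ∈ Icc lo hi, (hi - lo) / 2 ^ L * (∫ ω, g (x 0 ω) ∂μ) + ((L + 1) * t +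
        |belowMean y x b g n lo ω - lo * ∫ ω, g (x 0 ω) ∂μ|) <
          |belowMean y x b g n η ω - η * ∫ ω, g (x 0 ω) ∂μ|} ≤
      ENNReal.ofReal ((L + 1) * (hi - lo) * ((∫ ω, g (x 0 ω) ^ 2 ∂μ) / n / t ^ 2)) := by
  have hM : 0 ≤ ∫ ω, g (x 0 ω) ∂μ := integral_nonneg fun ω => hg0 _
  have hV : 0 ≤ (∫ ω, g (x 0 ω) ^ 2 ∂μ) / n :=
    div_nonneg (integral_nonneg fun _ => sq_nonneg _) n.cast_nonneg
  have hmono : ∀ᵐ ω ∂μ, MonotoneOn (fun η => belowMean y x b g n η ω) (Icc lo hi) := by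
    filter_upwards [hs.ae_forall_mem_support] with ω hω η hη η' hη' hle
    refine mul_le_mul_of_nonneg_left (Finset.sum_le_sum fun i _ => mul_le_mul_of_nonneg_left
      (belowInd_mono ?_) (hg0 _)) (by positivity)
    have := hd.cond _ (hω i)
    exact monotoneOn_dotProduct_of_condLaw (hb _ (hω i)) hη hη' hle
  exact measure_exists_lt_abs_sub_mul_le hlt hM hV hmono ht (fun η hη η' hη' hle =>
    measure_lt_abs_belowMean_sub_le hs hd hb hg hg2 hη hη' hle hn ht) L

theorem isLittleO_belowMean_sub_left (hs : IsRandomSample μ y x)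
    (hd : HasDensities μ (y 0) (x 0) ν fX f fY) {η : ℝ}
    (hb : ∀ x' ∈ (μ.map (x 0)).support, (condLaw f x').real (Iic (x' ⬝ᵥ b η)) = η)
    (hg : Measurable g) (hg2 : MemLp (fun ω => g (x 0 ω)) 2 μ)
    {h : ℕ → ℝ} (hh : IsAdmissibleBandwidth h) :
    (fun p : ℕ × Ω => belowMean y x b g p.1 η p.2 - η * ∫ ω, g (x 0 ω) ∂μ) =o[whp μ]
      fun p => kernelRate h p.1 := by
  have hY := hs.measurable_y 0
  have hX := hs.measurable_x 0
  rw [← hd.integral_mul_belowInd hY hX hb hg (hg2.integrable one_le_two)]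
  refine isLittleO_whp_sampleMean_sub hs.indep hs.identDistrib
    (φ := fun _ p => g p.2 * belowInd (b η) p) (fun _ => by fun_prop)
    (.of_forall fun _ => memLp_mul_of_abs_le_one hY hX hg hg2 (by fun_prop) fun p => ?_)
    hh.eventually_kernelRate_pos (hh.isLittleO_sqrt_div _)
  rw [abs_of_nonneg (belowInd_nonneg _ _)]
  exact belowInd_le_one _ _

theorem IsAdmissibleBandwidth.tendsto_chaining_bound {h : ℕ → ℝ} (hh : IsAdmissibleBandwidth h)
    (w V δ : ℝ) :
    Tendsto (fun n => ((Nat.log 2 n + 1 : ℕ) + 1) * w *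
      (V / n / (δ * kernelRate h n / ((Nat.log 2 n + 1 : ℕ) + 1)) ^ 2)) atTop (𝓝 0) := by
  have hlim := hh.tendsto_natLog_mul.const_mul (w * V / δ ^ 2)
  rw [mul_zero] at hlim
  refine hlim.congr' ?_
  filter_upwards [hh.eventually_pos, eventually_gt_atTop 0] with n hhn hn
  have hn0 : (n : ℝ) ≠ 0 := by positivity
  rw [div_pow, mul_pow, kernelRate_sq hhn]
  push_cast
  rw [add_assoc, one_add_one_eq_two]
  rcases eq_or_ne δ 0 with rfl | hδ
  · simp
  · field_simp

theorem IsAdmissibleBandwidth.isLittleO_inv_two_pow {h : ℕ → ℝ} (hh : IsAdmissibleBandwidth h) :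
    (fun n : ℕ => ((2 : ℝ) ^ (Nat.log 2 n + 1))⁻¹) =o[atTop] kernelRate h := by
  refine Asymptotics.IsBigO.trans_isLittleO (.of_bound 1 ?_) hh.rpow_isLittleO_kernelRate
  filter_upwards [eventually_gt_atTop 0] with n hn
  have hn1 : (1 : ℝ) ≤ n := Nat.one_le_cast.2 hn
  have hle : (n : ℝ) ≤ 2 ^ (Nat.log 2 n + 1) := by
    exact_mod_cast (Nat.lt_pow_succ_log_self one_lt_two n).le
  rw [one_mul, Real.norm_of_nonneg (by positivity), Real.norm_of_nonneg (by positivity),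
    natCast_rpow_neg_half]
  gcongr
  exact (Real.sqrt_le_iff.2 ⟨n.cast_nonneg, by nlinarith⟩).trans hle

theorem isLittleO_belowMean_sub (hs : IsRandomSample μ y x)
    (hd : HasDensities μ (y 0) (x 0) ν fX f fY) (hlt : lo < hi)
    (hb : ∀ x' ∈ (μ.map (x 0)).support, ∀ η ∈ Icc lo hi, (condLaw f x').real (Iic (x' ⬝ᵥ b η)) = η)
    (hg : Measurable g) (hg0 : 0 ≤ g) (hg2 : MemLp (fun ω => g (x 0 ω)) 2 μ)
    {h : ℕ → ℝ} (hh : IsAdmissibleBandwidth h) :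
    (fun p : (ℕ × Ω) × ℝ => belowMean y x b g p.1.1 p.2 p.1.2 - p.2 * ∫ ω, g (x 0 ω) ∂μ)
      =o[whp μ ×ˢ 𝓟 (Icc lo hi)] fun p => kernelRate h p.1.1 := by
  refine Asymptotics.isLittleO_iff.2 fun δ hδ => eventually_prod_principal_iff.2 ?_
  have hδ3 : 0 < δ / 3 := by positivity
  have hmesh : ∀ᶠ p : ℕ × Ω in whp μ, _ := tendsto_fst_whp.eventually
    ((hh.isLittleO_inv_two_pow.const_mul_left ((hi - lo) * ∫ ω, g (x 0 ω) ∂μ)).def hδ3)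
  have hleft := (isLittleO_belowMean_sub_left hs hd
    (fun x' hx => hb x' hx lo (left_mem_Icc.2 hlt.le)) hg hg2 hh).def hδ3
  have hchain := eventually_whp_of_measure_le
    (P := fun p => ∀ η ∈ Icc lo hi, |belowMean y x b g p.1 η p.2 - η * ∫ ω, g (x 0 ω) ∂μ| ≤
      (hi - lo) / 2 ^ (Nat.log 2 p.1 + 1) * (∫ ω, g (x 0 ω) ∂μ) +
      (((Nat.log 2 p.1 + 1 : ℕ) + 1) * (δ / 3 * kernelRate h p.1 / ((Nat.log 2 p.1 + 1 : ℕ) + 1)) +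
        |belowMean y x b g p.1 lo p.2 - lo * ∫ ω, g (x 0 ω) ∂μ|))
    (μ := μ) (by
      filter_upwards [hh.eventually_kernelRate_pos, eventually_ne_atTop 0] with n hρ hn
      simp only [not_forall, not_le, exists_prop]
      exact measure_exists_lt_abs_belowMean_sub_le hs hd hlt hb hg hg0 hg2 hn (by positivity) _)
    (hh.tendsto_chaining_bound (hi - lo) (∫ ω, g (x 0 ω) ^ 2 ∂μ) (δ / 3))
  filter_upwards [hmesh, hleft, hchain, tendsto_fst_whp.eventually hh.eventually_kernelRate_pos]
    with p hp1 hp2 hp3 hρ η hη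
  rw [Real.norm_of_nonneg hρ.le] at *
  have hmesh_le := (le_abs_self _).trans hp1
  rw [mul_right_comm, ← div_eq_mul_inv] at hmesh_le
  have hchain_le := hp3 η hη
  rw [mul_div_cancel₀ _ (by positivity)] at hchain_le
  exact hchain_le.trans (by linarith [(Real.norm_eq_abs _).symm.trans_le hp2])

end UniformRate

section FirstStep

theorem isLittleO_dotProduct {α : Type*} {d : ℕ} {l : Filter α} {A B : α → Fin d → ℝ} {r : α → ℝ}
    {C : ℝ} (hA : ∀ᶠ p in l, ‖A p‖ ≤ C) (hB : B =o[l] r) : (fun p => A p ⬝ᵥ B p) =o[l] r :=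
  Asymptotics.IsBigO.trans_isLittleO (.of_bound (d * C) <| hA.mono fun p hp => by
    rw [Real.norm_eq_abs, mul_right_comm]
    exact (abs_dotProduct_le_mul_norm _ _).trans (by gcongr)) hB

variable {Ω : Type*} [MeasurableSpace Ω] {μ : Measure Ω} [IsProbabilityMeasure μ] {d : ℕ}
    {y : ℕ → Ω → ℝ} {x : ℕ → Ω → Fin d → ℝ} {ν : Measure (Fin d → ℝ)} [SFinite ν]
    {fX : (Fin d → ℝ) → ℝ} {f : ℝ → (Fin d → ℝ) → ℝ} {fY : ℝ → ℝ}
    {h : ℕ → ℝ}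

theorem isLittleO_sampleMean_sub_belowInd_mul {lo hi : ℝ} {b : ℝ → Fin d → ℝ}
    {g : (Fin d → ℝ) → ℝ} (hs : IsRandomSample μ y x)
    (hd : HasDensities μ (y 0) (x 0) ν fX f fY) (hlt : lo < hi)
    (hb : ∀ x' ∈ (μ.map (x 0)).support, ∀ η ∈ Icc lo hi, (condLaw f x').real (Iic (x' ⬝ᵥ b η)) = η)
    (hg : Measurable g) (hg0 : 0 ≤ g) (hg2 : MemLp (fun ω => g (x 0 ω)) 2 μ)
    (hh : IsAdmissibleBandwidth h) :
    (fun p : (ℕ × Ω) × ℝ => sampleMean (fun i ω => (y i ω, x i ω))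
      (fun q => (p.2 - belowInd (b p.2) q) * g q.2) p.1.1 p.1.2)
      =o[whp μ ×ˢ 𝓟 (Icc lo hi)] fun p => kernelRate h p.1.1 := by
  have hmean := (isLittleO_whp_sampleMean_sub hs.indep hs.identDistrib (φ := fun _ q => g q.2)
    (fun _ => by fun_prop) (.of_forall fun _ => hg2) hh.eventually_kernelRate_pos
    (hh.isLittleO_sqrt_div _)).comp_tendsto (tendsto_fst (g := 𝓟 (Icc lo hi)))
  have hη : (fun p : (ℕ × Ω) × ℝ => p.2) =O[whp μ ×ˢ 𝓟 (Icc lo hi)] fun _ => (1 : ℝ) :=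
    .of_bound (max |lo| |hi|) <| eventually_prod_principal_iff.2 <| .of_forall fun _ η hη => by
      simpa using abs_le_max_abs_abs hη.1 hη.2
  refine (((hη.mul_isLittleO hmean).congr_right fun _ => one_mul _).sub
    (isLittleO_belowMean_sub hs hd hlt hb hg hg0 hg2 hh)).congr_left fun p => ?_
  simp only [Function.comp_apply, belowMean, sampleMean, sub_mul, mul_comm (belowInd _ _),
    Finset.sum_sub_distrib, ← Finset.mul_sum]
  ring

namespace IsLinearQuantileModel

variable {τ ε : ℝ} {β : ℝ → Fin d → ℝ} {ξ : (Fin d → ℝ) → ℝ}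
    {βhat : ℕ → ℝ → Ω → Fin d → ℝ} {Qhat : ℕ → Ω → ℝ} {ξhat : ℕ → (Fin d → ℝ) → Ω → ℝ}

theorem isLittleO_mean_sub_belowInd_smul
    (hm : IsLinearQuantileModel μ y x f fY τ ε β βhat Qhat) (hs : IsRandomSample μ y x)
    (hd : HasDensities μ (y 0) (x 0) ν fX f fY) (hε : ε ∈ Ioo (0 : ℝ) (1 / 2))
    (hh : IsAdmissibleBandwidth h) :
    (fun p : (ℕ × Ω) × ℝ => (p.1.1 : ℝ)⁻¹ • ∑ i ∈ Finset.range p.1.1,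
      (p.2 - belowInd (β p.2) (y i p.1.2, x i p.1.2)) • x i p.1.2)
      =o[whp μ ×ˢ 𝓟 (Icc ε (1 - ε))] fun p => kernelRate h p.1.1 := by
  have hlt : ε < 1 - ε := by linarith [hε.2]
  have hb := fun x' hx η hη => hm.condLaw_real_Iic hd hε (η := η) hη (x' := x') hx
  refine Asymptotics.isLittleO_pi.2 fun j => ?_
  have hX2 := hm.memLp_covariate hs hd hε j
  have hpos := isLittleO_sampleMean_sub_belowInd_mul (g := fun x' => max (x' j) 0) hs hd hlt hb
    (by fun_prop) (fun _ => le_max_right _ _) hX2.pos_part hh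
  have hneg := isLittleO_sampleMean_sub_belowInd_mul (g := fun x' => max (-x' j) 0) hs hd hlt hb
    (by fun_prop) (fun _ => le_max_right _ _) hX2.neg_part hh
  refine (hpos.sub hneg).congr_left fun p => ?_
  simp only [sampleMean, ← mul_sub, ← Finset.sum_sub_distrib, Pi.smul_apply, Finset.sum_apply,
    smul_eq_mul]
  congr 1
  refine Finset.sum_congr rfl fun i _ => congr_arg _ ?_
  rcases le_total 0 (x i p.1.2 j) with h0 | h0 <;> simp [h0]

theorem isLittleO_coef (hm : IsLinearQuantileModel μ y x f fY τ ε β βhat Qhat)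
    (hs : IsRandomSample μ y x) (hd : HasDensities μ (y 0) (x 0) ν fX f fY)
    (hε : ε ∈ Ioo (0 : ℝ) (1 / 2)) (hh : IsAdmissibleBandwidth h) :
    (fun p : (ℕ × Ω) × ℝ => βhat p.1.1 p.2 p.1.2 - β p.2)
      =o[whp μ ×ˢ 𝓟 (Icc ε (1 - ε))] fun p => kernelRate h p.1.1 := by
  have hrem := ((isUniformLittleOp_iff_isLittleO (.of_forall fun n => by positivity)).1
    hm.bahadur).trans (hh.rpow_isLittleO_kernelRate.comp_tendsto
      (tendsto_fst_whp.comp (tendsto_fst (g := 𝓟 (Icc ε (1 - ε))))))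
  have hlin : (fun p : (ℕ × Ω) × ℝ => (J μ (x 0) f β p.2)⁻¹ *ᵥ ((p.1.1 : ℝ)⁻¹ •
      ∑ i ∈ Finset.range p.1.1, (p.2 - belowInd (β p.2) (y i p.1.2, x i p.1.2)) • x i p.1.2))
      =o[whp μ ×ˢ 𝓟 (Icc ε (1 - ε))] fun p => kernelRate h p.1.1 :=
    Asymptotics.isLittleO_pi.2 fun i => by
      obtain ⟨C, hC⟩ := isCompact_Icc.exists_bound_of_continuousOn
        (continuousOn_pi.1 hm.continuousOn_J_inv i)
      exact isLittleO_dotProduct (eventually_prod_principal_iff.2 (.of_forall fun _ => hC))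
        (hm.isLittleO_mean_sub_belowInd_smul hs hd hε hh)
  refine (hrem.add hlin).congr_left fun p => ?_
  simp only [influenceQR, ← Matrix.mulVec_sum, ← Matrix.mulVec_smul]
  exact sub_add_cancel _ _

variable [NeZero d]

theorem isLittleO_match (hm : IsLinearQuantileModel μ y x f fY τ ε β βhat Qhat)
    (hs : IsRandomSample μ y x) (hd : HasDensities μ (y 0) (x 0) ν fX f fY)
    (hτ : τ ∈ Ioo (0 : ℝ) 1) (hε : ε ∈ Ioo (0 : ℝ) (1 / 2))
    (hξ : ∀ x' ∈ (μ.map (x 0)).support, ξ x' ∈ Icc ε (1 - ε))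
    (ha : ApproxAssumption μ (μ.map (x 0)).support f ε (quantile (μ.map (y 0)) τ) β ξ βhat Qhat
      ξhat) (hbdd : Bornology.IsBounded (μ.map (x 0)).support) (hh : IsAdmissibleBandwidth h) :
    (fun p : (ℕ × Ω) × (Fin d → ℝ) => ξhat p.1.1 p.2 p.1.2 - ξ p.2)
      =o[whp μ ×ˢ 𝓟 (μ.map (x 0)).support] fun p => kernelRate h p.1.1 := by
  set S := (μ.map (x 0)).support
  have hrem := ((isUniformLittleOp_iff_isLittleO (.of_forall fun n => by positivity)).1
    ha.remainder).trans (hh.rpow_isLittleO_kernelRate.comp_tendsto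
      (tendsto_fst_whp.comp (tendsto_fst (g := 𝓟 S))))
  have hcoef := (hm.isLittleO_coef hs hd hε hh).comp_tendsto
    (k := fun p : (ℕ × Ω) × (Fin d → ℝ) => (p.1, ξ p.2)) (tendsto_fst.prodMk
      ((tendsto_principal_principal.2 hξ).comp tendsto_snd))
  have hQ := (hm.isLittleO_sampleQuantile hs hd hτ hh.eventually_kernelRate_pos
    hh.rpow_isLittleO_kernelRate).comp_tendsto (tendsto_fst (g := 𝓟 S))
  obtain ⟨B, hB⟩ := isBounded_iff_forall_norm_le.1 hbdd
  obtain ⟨C, hC⟩ := ha.density_bounded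
  have hf : (fun p : (ℕ × Ω) × (Fin d → ℝ) => f (p.2 ⬝ᵥ β (ξ p.2)) p.2) =O[whp μ ×ˢ 𝓟 S]
      fun _ => (1 : ℝ) :=
    .of_bound C <| eventually_prod_principal_iff.2 <| .of_forall fun _ x' hx => by
      rw [norm_one, mul_one, Real.norm_of_nonneg (hd.f_nonneg _ _)]
      exact hC x' hx _
  have hdot := isLittleO_dotProduct (A := Prod.snd)
    (eventually_prod_principal_iff.2 (.of_forall fun _ => hB)) hcoef
  refine (hrem.add ((hf.mul_isLittleO (hdot.neg_left.add hQ)).congr_right fun _ =>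
    one_mul _)).congr_left fun p => sub_add_cancel _ _

theorem isLittleO_weight (hm : IsLinearQuantileModel μ y x f fY τ ε β βhat Qhat)
    (hs : IsRandomSample μ y x) (hd : HasDensities μ (y 0) (x 0) ν fX f fY)
    (hτ : τ ∈ Ioo (0 : ℝ) 1) (hε : ε ∈ Ioo (0 : ℝ) (1 / 2))
    (hξ : ∀ x' ∈ (μ.map (x 0)).support, ξ x' ∈ Icc ε (1 - ε))
    (hξhat : ∀ n x' ω, ξhat n x' ω ∈ Icc ε (1 - ε))
    (ha : ApproxAssumption μ (μ.map (x 0)).support f ε (quantile (μ.map (y 0)) τ) β ξ βhat Qhat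
      ξhat) (hbdd : Bornology.IsBounded (μ.map (x 0)).support) (hh : IsAdmissibleBandwidth h) :
    (fun p : (ℕ × Ω) × (Fin d → ℝ) =>
      βhat p.1.1 (ξhat p.1.1 p.2 p.1.2) p.1.2 0 - β (ξ p.2) 0)
      =o[whp μ ×ˢ 𝓟 (μ.map (x 0)).support] fun p => kernelRate h p.1.1 := by
  have hcoef := (hm.isLittleO_coef hs hd hε hh).comp_tendsto
    (k := fun p : (ℕ × Ω) × (Fin d → ℝ) => (p.1, ξhat p.1.1 p.2 p.1.2))
    ((tendsto_fst (g := 𝓟 (μ.map (x 0)).support)).prodMk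
      (tendsto_principal.2 (.of_forall fun p => hξhat _ _ _)))
  obtain ⟨C, hC⟩ := ha.beta_deriv_bounded
  have hβ : (fun p : (ℕ × Ω) × (Fin d → ℝ) => β (ξhat p.1.1 p.2 p.1.2) 0 - β (ξ p.2) 0)
      =O[whp μ ×ˢ 𝓟 (μ.map (x 0)).support] fun p => ξhat p.1.1 p.2 p.1.2 - ξ p.2 :=
    .of_bound C <| eventually_prod_principal_iff.2 <| .of_forall fun p x' hx =>
      (convex_Icc ε (1 - ε)).norm_image_sub_le_of_norm_derivWithin_le ha.beta_differentiable hC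
        (hξ x' hx) (hξhat _ _ _)
  exact ((Asymptotics.isLittleO_pi.1 hcoef 0).add (hβ.trans_isLittleO
    (hm.isLittleO_match hs hd hτ hε hξ ha hbdd hh))).congr_left fun p => sub_add_sub_cancel _ _ _

end IsLinearQuantileModel

end FirstStep

section Kernel

/-- A continuously differentiable kernel of mass one whose derivative is both integrable and square
integrable; this class of functions is stable under rescaling. -/
structure IsSmoothKernel (K : ℝ → ℝ) : Prop where
  contDiff : ContDiff ℝ 1 K
  integrable : Integrable K
  integral_eq_one : ∫ u, K u = 1
  integrable_deriv : Integrable (deriv K)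
  memLp_deriv : MemLp (deriv K) 2

theorem KernelAssumption.isSmoothKernel {K : ℝ → ℝ} {r : ℕ} (hK : KernelAssumption K r) :
    IsSmoothKernel K where
  contDiff := contDiff_one_iff_deriv.2
    ⟨hK.differentiable, hK.differentiable_deriv.continuous⟩
  integrable := hK.integrable
  integral_eq_one := hK.integral_eq_one
  integrable_deriv := hK.deriv_integrable
  memLp_deriv := (memLp_two_iff_integrable_sq hK.deriv_integrable.1).2 hK.deriv_sq_integrable

theorem abs_sub_le_integral_abs_deriv {F : ℝ → ℝ} (hF : ContDiff ℝ 1 F) {Q q ρ : ℝ}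
    (hq : |q - Q| ≤ ρ) : |F q - F Q| ≤ ∫ t in Icc (Q - ρ) (Q + ρ), |deriv F t| := by
  have hG : Continuous (deriv F) := hF.continuous_deriv_one
  rw [← intervalIntegral.integral_deriv_eq_sub' F rfl
    (fun t _ => hF.differentiable_one t) hG.continuousOn, ← Real.norm_eq_abs]
  refine intervalIntegral.norm_integral_le_integral_norm_uIoc.trans ?_
  refine setIntegral_mono_set (hG.norm.continuousOn.integrableOn_compact isCompact_Icc)
    (ae_of_all _ fun _ => norm_nonneg _) (LE.le.eventuallyLE ?_)
  have hQq := abs_le.1 hq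
  refine uIoc_subset_uIcc.trans (uIcc_subset_Icc ⟨?_, ?_⟩ ⟨?_, ?_⟩) <;>
    linarith [abs_nonneg (q - Q)]

theorem IsSmoothKernel.abs_le {K : ℝ → ℝ} (hK : IsSmoothKernel K) (u : ℝ) :
    |K u| ≤ |K 0| + ∫ t, |deriv K t| := by
  have hincr := abs_sub_le_integral_abs_deriv hK.contDiff (Q := 0) (q := u) le_rfl
  have hset := setIntegral_le_integral (s := Icc (0 - |u - 0|) (0 + |u - 0|))
    hK.integrable_deriv.abs (ae_of_all _ fun _ => abs_nonneg _)
  linarith [abs_sub_abs_le_abs_sub (K u) (K 0)]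

theorem IsSmoothKernel.memLp_two {K : ℝ → ℝ} (hK : IsSmoothKernel K) : MemLp K 2 := by
  refine (memLp_two_iff_integrable_sq hK.integrable.1).2 ?_
  simp_rw [sq]
  exact hK.integrable.bdd_mul hK.integrable.1 (ae_of_all _ hK.abs_le)

section Rescale

variable {K : ℝ → ℝ} {h : ℝ}

theorem deriv_rescale (hK : Differentiable ℝ K) :
    deriv (rescale K h) = fun u => h⁻¹ * rescale (deriv K) h u := by
  funext u
  have hdiv : HasDerivAt (fun u => u / h) (1 / h) u := (hasDerivAt_id u).div_const h
  have hcomp := ((hK (u / h)).hasDerivAt.comp u hdiv).const_mul h⁻¹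
  refine hcomp.deriv.trans ?_
  rw [rescale, one_div]
  ring

theorem integrable_rescale (hK : Integrable K) (hh : 0 < h) : Integrable (rescale K h) :=
  (hK.comp_div hh.ne').const_mul _

theorem integral_rescale_mul (hh : 0 < h) (φ : ℝ → ℝ) (q : ℝ) :
    ∫ y, rescale K h (y - q) * φ y = ∫ u, K u * φ (q + h * u) := by
  have hy : ∀ y, q + h * ((y - q) / h) = y := fun y => by field_simp; ring
  calc ∫ y, rescale K h (y - q) * φ y
      = ∫ y, rescale K h (y - q) * φ (q + h * ((y - q) / h)) := by simp_rw [hy]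
    _ = h⁻¹ * ∫ y, (fun u => K (u / h) * φ (q + h * (u / h))) (y - q) := by
        simp only [rescale, mul_assoc, integral_const_mul]
    _ = ∫ u, K u * φ (q + h * u) := by
        rw [integral_sub_right_eq_self (fun u => K (u / h) * φ (q + h * (u / h))),
          Measure.integral_comp_div (fun u => K u * φ (q + h * u)), abs_of_pos hh, smul_eq_mul,
          inv_mul_cancel_left₀ hh.ne']

theorem integral_rescale (hh : 0 < h) : ∫ u, rescale K h u = ∫ u, K u := by
  simpa only [sub_zero, mul_one] using integral_rescale_mul (K := K) hh (fun _ => 1) 0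

theorem abs_rescale (hh : 0 < h) (u : ℝ) : |rescale K h u| = rescale (fun v => |K v|) h u := by
  rw [rescale, abs_mul, abs_of_pos (inv_pos.2 hh), rescale]

theorem integral_abs_rescale (hh : 0 < h) : ∫ u, |rescale K h u| = ∫ u, |K u| := by
  simp_rw [abs_rescale hh, integral_rescale hh]

theorem integral_rescale_sq (hh : 0 < h) : ∫ u, rescale K h u ^ 2 = h⁻¹ * ∫ u, K u ^ 2 := by
  have hsq : ∀ u, rescale K h u ^ 2 = h⁻¹ * rescale (fun v => K v ^ 2) h u := fun u => by
    simp only [rescale]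
    ring
  simp_rw [hsq, integral_const_mul, integral_rescale hh]

theorem memLp_two_rescale (hK : Integrable K) (hK2 : MemLp K 2) (hh : 0 < h) :
    MemLp (rescale K h) 2 := by
  refine (memLp_two_iff_integrable_sq (integrable_rescale hK hh).1).2 ?_
  have hsq := ((memLp_two_iff_integrable_sq hK.1).1 hK2).comp_div hh.ne'
  simpa only [rescale, mul_pow] using hsq.const_mul (h⁻¹ ^ 2)

theorem IsSmoothKernel.rescale (hK : IsSmoothKernel K) (hh : 0 < h) :
    IsSmoothKernel (rescale K h) where
  contDiff := contDiff_const.mul (hK.contDiff.comp (contDiff_id.div_const h))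
  integrable := integrable_rescale hK.integrable hh
  integral_eq_one := (integral_rescale hh).trans hK.integral_eq_one
  integrable_deriv := by
    rw [deriv_rescale hK.contDiff.differentiable_one]
    exact (integrable_rescale hK.integrable_deriv hh).const_mul _
  memLp_deriv := by
    rw [deriv_rescale hK.contDiff.differentiable_one]
    exact (memLp_two_rescale hK.integrable_deriv hK.memLp_deriv hh).const_mul _

theorem IsSmoothKernel.integral_abs_deriv_rescale (hK : IsSmoothKernel K) (hh : 0 < h) :
    ∫ u, |deriv (UQPE.rescale K h) u| = h⁻¹ * ∫ u, |deriv K u| := by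
  simp_rw [deriv_rescale hK.contDiff.differentiable_one, abs_mul, integral_const_mul,
    abs_of_pos (inv_pos.2 hh), integral_abs_rescale hh]

theorem IsSmoothKernel.integral_deriv_rescale_sq (hK : IsSmoothKernel K) (hh : 0 < h) :
    ∫ u, deriv (UQPE.rescale K h) u ^ 2 = h⁻¹ ^ 3 * ∫ u, deriv K u ^ 2 := by
  simp_rw [deriv_rescale hK.contDiff.differentiable_one, mul_pow, integral_const_mul,
    integral_rescale_sq hh]
  ring

end Rescale

end Kernel

section KernelMean

/-- The average of the weights `w_i`, `i < n`, smoothed by the kernel `g` in `y_i` around `q`; a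
Nadaraya–Watson regression is a quotient of two such averages. -/
def kernelMean (g : ℝ → ℝ) (n : ℕ) (y w : ℕ → ℝ) (q : ℝ) : ℝ :=
  (n : ℝ)⁻¹ * ∑ i ∈ Finset.range n, g (y i - q) * w i

theorem nadarayaWatson_eq_div (K : ℝ → ℝ) (h : ℝ) {n : ℕ} (hn : n ≠ 0) (y w : ℕ → ℝ) (q : ℝ) :
    nadarayaWatson K h n y w q =
      kernelMean (rescale K h) n y w q / kernelMean (rescale K h) n y (fun _ => 1) q := by
  simp only [kernelMean, nadarayaWatson, mul_one]
  exact (mul_div_mul_left _ _ (inv_ne_zero (Nat.cast_ne_zero.2 hn))).symm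

variable {g : ℝ → ℝ} {n : ℕ} {y w w' : ℕ → ℝ} {q : ℝ}

theorem kernelMean_sub :
    kernelMean g n y w q - kernelMean g n y w' q = kernelMean g n y (fun i => w i - w' i) q := by
  simp only [kernelMean, mul_sub, Finset.sum_sub_distrib]

theorem abs_kernelMean_le {B : ℝ} (hw : ∀ i < n, |w i| ≤ B) :
    |kernelMean g n y w q| ≤ B * kernelMean (fun u => |g u|) n y (fun _ => 1) q := by
  simp only [kernelMean, mul_one, abs_mul, abs_inv, Nat.abs_cast]
  rw [mul_left_comm, Finset.mul_sum]
  gcongr ?_ * ?_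
  refine (Finset.abs_sum_le_sum_abs _ _).trans (Finset.sum_le_sum fun i hi => ?_)
  rw [abs_mul, mul_comm B]
  gcongr
  exact hw i (Finset.mem_range.1 hi)

theorem continuous_kernelMean (hg : Continuous g) : Continuous (kernelMean g n y w) := by
  unfold kernelMean
  fun_prop

theorem contDiff_kernelMean (hg : ContDiff ℝ 1 g) : ContDiff ℝ 1 (kernelMean g n y w) :=
  contDiff_const.mul <| ContDiff.sum fun _ _ =>
    (hg.comp (contDiff_const.sub contDiff_id)).mul contDiff_const

theorem deriv_kernelMean (hg : Differentiable ℝ g) :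
    deriv (kernelMean g n y w) q = -kernelMean (deriv g) n y w q := by
  have hterm : ∀ i ∈ Finset.range n,
      HasDerivAt (fun q => g (y i - q) * w i) (-deriv g (y i - q) * w i) q := fun i _ => by
    have hsub : HasDerivAt (fun q => y i - q) (-1) q := (hasDerivAt_id q).const_sub _
    have hcomp := ((hg (y i - q)).hasDerivAt.comp q hsub).mul_const (w i)
    rwa [mul_neg_one] at hcomp
  refine ((HasDerivAt.fun_sum hterm).const_mul (n : ℝ)⁻¹).deriv.trans ?_
  simp only [kernelMean, neg_mul, Finset.sum_neg_distrib, mul_neg]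

theorem abs_kernelMean_sub_le (hg : ContDiff ℝ 1 g) {Q ρ : ℝ} (hq : |q - Q| ≤ ρ) :
    |kernelMean g n y w q - kernelMean g n y w Q| ≤
      ∫ t in Icc (Q - ρ) (Q + ρ), |kernelMean (deriv g) n y w t| := by
  simpa only [deriv_kernelMean hg.differentiable_one, abs_neg] using
    abs_sub_le_integral_abs_deriv (contDiff_kernelMean hg) hq

theorem kernelMean_abs_le (hg : ContDiff ℝ 1 g) {Q ρ : ℝ} (hq : |q - Q| ≤ ρ) :
    kernelMean (fun u => |g u|) n y (fun _ => 1) q ≤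
      kernelMean (fun u => |g u|) n y (fun _ => 1) Q +
        ∫ t in Icc (Q - ρ) (Q + ρ), |kernelMean (fun u => |deriv g u|) n y (fun _ => 1) t| := by
  have hg' := hg.continuous_deriv_one
  -- With the signs of `g (y i - q)` as weights, the mean of `|g|` at `q` is a mean of `g`.
  set σ : ℕ → ℝ := fun i => SignType.sign (g (y i - q)) with hσ
  have hσ1 : ∀ i < n, |σ i| ≤ 1 := fun i _ => by
    rcases lt_trichotomy (g (y i - q)) 0 with hi | hi | hi <;> simp [hσ, hi]
  have hsign : kernelMean (fun u => |g u|) n y (fun _ => 1) q = kernelMean g n y σ q := by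
    simp only [kernelMean, hσ, mul_one, self_mul_sign]
  calc kernelMean (fun u => |g u|) n y (fun _ => 1) q
      ≤ kernelMean g n y σ Q + ∫ t in Icc (Q - ρ) (Q + ρ), |kernelMean (deriv g) n y σ t| := by
        rw [hsign, ← sub_le_iff_le_add']
        exact (le_abs_self _).trans (abs_kernelMean_sub_le hg hq)
    _ ≤ _ := by
        gcongr ?_ + ?_
        · exact (le_abs_self _).trans ((abs_kernelMean_le hσ1).trans_eq (one_mul _))
        · refine setIntegral_mono
            ((continuous_kernelMean hg').abs.continuousOn.integrableOn_compact isCompact_Icc)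
            ((continuous_kernelMean hg'.abs).abs.continuousOn.integrableOn_compact isCompact_Icc)
            fun t => ?_
          exact (abs_kernelMean_le hσ1).trans ((one_mul _).trans_le (le_abs_self _))

end KernelMean

section LocalVariation

variable {Ω : Type*} [MeasurableSpace Ω] {μ : Measure Ω}

theorem lintegral_enorm_sampleMean_le {E : Type*} [MeasurableSpace E] {Z : ℕ → Ω → E}
    (hid : ∀ i, IdentDistrib (Z i) (Z 0) μ μ) {φ : E → ℝ} (hφ : Measurable φ) (n : ℕ) :
    ∫⁻ ω, ‖sampleMean Z φ n ω‖ₑ ∂μ ≤ ∫⁻ ω, ‖φ (Z 0 ω)‖ₑ ∂μ := by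
  have hterm : ∀ i, ∫⁻ ω, ‖φ (Z i ω)‖ₑ ∂μ = ∫⁻ ω, ‖φ (Z 0 ω)‖ₑ ∂μ := fun i =>
    ((hid i).comp (measurable_enorm.comp hφ)).lintegral_eq
  have hZ : ∀ i, AEMeasurable (fun ω => ‖φ (Z i ω)‖ₑ) μ := fun i =>
    (measurable_enorm.comp hφ).comp_aemeasurable (hid i).aemeasurable_fst
  calc ∫⁻ ω, ‖sampleMean Z φ n ω‖ₑ ∂μ
      ≤ ∫⁻ ω, ‖(n : ℝ)⁻¹‖ₑ * ∑ i ∈ Finset.range n, ‖φ (Z i ω)‖ₑ ∂μ := by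
        refine lintegral_mono fun ω => ?_
        rw [sampleMean, enorm_mul]
        gcongr
        exact enorm_sum_le _ _
    _ = ‖(n : ℝ)⁻¹‖ₑ * (n * ∫⁻ ω, ‖φ (Z 0 ω)‖ₑ ∂μ) := by
        rw [lintegral_const_mul' _ _ enorm_ne_top, lintegral_finsetSum' _ fun i _ => hZ i]
        simp only [hterm, Finset.sum_const, Finset.card_range, nsmul_eq_mul]
    _ ≤ ∫⁻ ω, ‖φ (Z 0 ω)‖ₑ ∂μ := by
        rw [← mul_assoc]
        refine mul_le_of_le_one_left' ?_
        rcases eq_or_ne n 0 with rfl | hn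
        · simp
        · rw [enorm_inv (Nat.cast_ne_zero.2 hn), Real.enorm_natCast]
          exact ENNReal.inv_mul_le_one _

theorem lintegral_enorm_sampleMean_le_add [IsProbabilityMeasure μ] {E : Type*}
    [MeasurableSpace E] {Z : ℕ → Ω → E} (hi : iIndepFun Z μ)
    (hid : ∀ i, IdentDistrib (Z i) (Z 0) μ μ) {φ : E → ℝ} (hφ : Measurable φ)
    (h2 : MemLp (fun ω => φ (Z 0 ω)) 2 μ) {n : ℕ} (hn : n ≠ 0) :
    ∫⁻ ω, ‖sampleMean Z φ n ω‖ₑ ∂μ ≤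
      ENNReal.ofReal (|∫ ω, φ (Z 0 ω) ∂μ| + √((∫ ω, φ (Z 0 ω) ^ 2 ∂μ) / n)) := by
  have hint : Integrable (sampleMean Z φ n) μ :=
    (memLp_sampleMean hid hφ h2 n).integrable (by norm_num)
  have hle := integral_abs_sampleMean_sub_le hi hid hφ h2 hn
  set c := ∫ ω, φ (Z 0 ω) ∂μ
  have hcentred : Integrable (fun ω => |sampleMean Z φ n ω - c|) μ :=
    (hint.sub (integrable_const c)).abs
  rw [← ofReal_integral_norm_eq_lintegral_enorm hint]
  refine ENNReal.ofReal_le_ofReal ?_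
  calc ∫ ω, ‖sampleMean Z φ n ω‖ ∂μ
      ≤ ∫ ω, |c| + |sampleMean Z φ n ω - c| ∂μ :=
        integral_mono hint.norm ((integrable_const _).add hcentred) fun ω => by
          simpa using abs_add_le c (sampleMean Z φ n ω - c)
    _ = |c| + ∫ ω, |sampleMean Z φ n ω - c| ∂μ := by
        rw [integral_add (integrable_const _) hcentred]
        simp
    _ ≤ _ := by gcongr

theorem isLittleO_whp_setIntegral_abs [SFinite μ] {G : ℕ → Ω → ℝ → ℝ}
    (hG : ∀ n, Measurable (Function.uncurry (G n))) {s b r : ℕ → ℝ}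
    (hs : ∀ᶠ n in atTop, 0 < s n)
    (hb : ∀ᶠ n in atTop, ∀ t, ∫⁻ ω, ‖G n ω t‖ₑ ∂μ ≤ ENNReal.ofReal (b n))
    (hr : ∀ᶠ n in atTop, 0 < r n) (ho : (fun n => s n * b n) =o[atTop] r) (Q : ℝ) :
    (fun p : ℕ × Ω => ∫ t in Icc (Q - s p.1) (Q + s p.1), |G p.1 p.2 t|) =o[whp μ]
      fun p => r p.1 := by
  refine isLittleO_whp_of_lintegral_le
    (V := fun n ω => ∫ t in Icc (Q - s n) (Q + s n), |G n ω t|)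
    (e := fun n => 2 * (s n * b n)) (Eventually.of_forall fun n => ?_) ?_ hr (ho.const_mul_left 2)
  · exact ((hG n).abs.stronglyMeasurable.integral_prod_right').measurable.aemeasurable
  · filter_upwards [hs, hb] with n hsn hbn
    calc ∫⁻ ω, ‖∫ t in Icc (Q - s n) (Q + s n), |G n ω t|‖ₑ ∂μ
        ≤ ∫⁻ ω, (∫⁻ t in Icc (Q - s n) (Q + s n), ‖G n ω t‖ₑ) ∂μ :=
          lintegral_mono fun ω => (enorm_integral_le_lintegral_enorm _).trans_eq <|
            lintegral_congr fun t => by rw [← Real.norm_eq_abs, enorm_norm]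
      _ = ∫⁻ t in Icc (Q - s n) (Q + s n), ∫⁻ ω, ‖G n ω t‖ₑ ∂μ :=
          lintegral_lintegral_swap (f := fun ω t => ‖G n ω t‖ₑ)
            (measurable_enorm.comp (hG n)).aemeasurable
      _ ≤ ∫⁻ _ in Icc (Q - s n) (Q + s n), ENNReal.ofReal (b n) := lintegral_mono hbn
      _ = ENNReal.ofReal (2 * (s n * b n)) := by
          rw [setLIntegral_const, Real.volume_Icc, ← ENNReal.ofReal_mul' (by linarith)]
          congr 1
          ring

end LocalVariation

section KernelExpectation

theorem HasDensities.bound_nonneg {Ω : Type*} [MeasurableSpace Ω] {μ : Measure Ω}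
    [IsProbabilityMeasure μ] {d : ℕ} {Y : Ω → ℝ} {X : Ω → Fin d → ℝ} {ν : Measure (Fin d → ℝ)}
    {fX : (Fin d → ℝ) → ℝ} {f : ℝ → (Fin d → ℝ) → ℝ} {fY : ℝ → ℝ} {C : ℝ}
    (hd : HasDensities μ Y X ν fX f fY) (hX : Measurable X)
    (hC : ∀ x ∈ (μ.map X).support, ∀ y, f y x ≤ C) : 0 ≤ C := by
  obtain ⟨ω, hω⟩ := (ae_mem_support (μ := μ) hX).exists
  exact (hd.f_nonneg 0 (X ω)).trans (hC _ hω 0)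

theorem HasDensities.ae_density_covariate_pos {Ω : Type*} [MeasurableSpace Ω] {μ : Measure Ω}
    {d : ℕ} {Y : Ω → ℝ} {X : Ω → Fin d → ℝ} {ν : Measure (Fin d → ℝ)} [SFinite ν]
    {fX : (Fin d → ℝ) → ℝ} {f : ℝ → (Fin d → ℝ) → ℝ} {fY : ℝ → ℝ}
    (hd : HasDensities μ Y X ν fX f fY) (hY : Measurable Y)
    (hX : Measurable X) : ∀ᵐ ω ∂μ, 0 < fX (X ω) := by
  have hfX := hd.measurable_fX
  have hmap : ∀ᵐ x ∂μ.map X, 0 < fX x := by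
    rw [hd.map_covariate_eq hY hX, ae_withDensity_iff (by fun_prop)]
    exact ae_of_all _ fun x hx => ENNReal.ofReal_pos.1 (pos_iff_ne_zero.2 hx)
  exact ae_of_ae_map hX.aemeasurable hmap

theorem HasDensities.ae_continuous_condDensity {Ω : Type*} [MeasurableSpace Ω] {μ : Measure Ω}
    {d : ℕ} {Y : Ω → ℝ} {X : Ω → Fin d → ℝ} {ν : Measure (Fin d → ℝ)} [SFinite ν]
    {fX : (Fin d → ℝ) → ℝ} {f : ℝ → (Fin d → ℝ) → ℝ} {fY : ℝ → ℝ}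
    (hd : HasDensities μ Y X ν fX f fY) (hY : Measurable Y) (hX : Measurable X)
    (hcont : ∀ x ∈ (μ.map X).support, Continuous fun y => f y x * fX x) :
    ∀ᵐ ω ∂μ, Continuous fun y => f y (X ω) := by
  filter_upwards [ae_mem_support hX, hd.ae_density_covariate_pos hY hX] with ω hω hpos
  simpa only [mul_div_cancel_right₀ _ hpos.ne'] using (hcont _ hω).div_const (fX (X ω))

theorem IsSmoothKernel.abs_integral_mul_deriv_le {g : ℝ → ℝ} (hg : IsSmoothKernel g) {F : ℝ → ℝ}
    (hF : ContDiff ℝ 1 F) {M D : ℝ} (hM : ∀ y, |F y| ≤ M) (hD : ∀ y, |deriv F y| ≤ D) (q : ℝ) :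
    |∫ y, F y * deriv g (y - q)| ≤ D * ∫ u, |g u| := by
  have hF' : ∀ y, HasDerivAt F (deriv F y) y := fun y => (hF.differentiable_one y).hasDerivAt
  have hg' : ∀ y, HasDerivAt (fun y => g (y - q)) (deriv g (y - q)) y := fun y =>
    (hg.contDiff.differentiable_one (y - q)).hasDerivAt.comp_sub_const y q
  have hFg' : Integrable fun y => F y * deriv g (y - q) :=
    (hg.integrable_deriv.comp_sub_right q).bdd_mul hF.continuous.aestronglyMeasurable
      (ae_of_all _ hM)
  have hF'g : Integrable fun y => deriv F y * g (y - q) :=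
    (hg.integrable.comp_sub_right q).bdd_mul hF.continuous_deriv_one.aestronglyMeasurable
      (ae_of_all _ hD)
  have hFg : Integrable fun y => F y * g (y - q) :=
    (hg.integrable.comp_sub_right q).bdd_mul hF.continuous.aestronglyMeasurable (ae_of_all _ hM)
  have hparts := integral_mul_deriv_eq_deriv_mul_of_integrable
    (fun y _ => hF' y) (fun y _ => hg' y) hFg' hF'g hFg
  rw [hparts, abs_neg, ← integral_sub_right_eq_self (fun u => |g u|) q, ← integral_const_mul]
  refine norm_integral_le_of_norm_le (f := fun y => deriv F y * g (y - q))
    ((hg.integrable.abs.comp_sub_right q).const_mul D) (ae_of_all _ fun y => ?_)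
  rw [norm_mul]
  exact mul_le_mul_of_nonneg_right (hD y) (abs_nonneg _)

variable {Ω : Type*} [MeasurableSpace Ω] {μ : Measure Ω} [IsProbabilityMeasure μ] {d : ℕ}
  {Y : Ω → ℝ} {X : Ω → Fin d → ℝ} {ν : Measure (Fin d → ℝ)} [SFinite ν]
  {fX : (Fin d → ℝ) → ℝ} {f : ℝ → (Fin d → ℝ) → ℝ} {fY : ℝ → ℝ} {K g : ℝ → ℝ} {C : ℝ}

namespace HasDensities

theorem lintegral_enorm_comp_sub_le (hd : HasDensities μ Y X ν fX f fY) (hY : Measurable Y)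
    (hX : Measurable X) (hC : ∀ x ∈ (μ.map X).support, ∀ y, f y x ≤ C) (hgm : Measurable g)
    (hg : Integrable g) (q : ℝ) :
    ∫⁻ ω, ‖g (Y ω - q)‖ₑ ∂μ ≤ ENNReal.ofReal (C * ∫ u, |g u|) := by
  refine (hd.lintegral_le_mul_lintegral hY hX hC (φ := fun y => ‖g (y - q)‖ₑ)
    (by fun_prop)).trans_eq ?_
  rw [lintegral_sub_right_eq_self (fun u => ‖g u‖ₑ), ← ofReal_integral_norm_eq_lintegral_enorm hg,
    ← ENNReal.ofReal_mul' (integral_nonneg fun _ => norm_nonneg _)]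
  rfl

theorem integrable_comp_sub (hd : HasDensities μ Y X ν fX f fY) (hY : Measurable Y)
    (hX : Measurable X) (hC : ∀ x ∈ (μ.map X).support, ∀ y, f y x ≤ C) (hgm : Measurable g)
    (hg : Integrable g) (q : ℝ) : Integrable (fun ω => g (Y ω - q)) μ :=
  ⟨(hgm.comp (hY.sub_const q)).aestronglyMeasurable,
    (hd.lintegral_enorm_comp_sub_le hY hX hC hgm hg q).trans_lt ENNReal.ofReal_lt_top⟩

theorem integral_abs_comp_sub_le (hd : HasDensities μ Y X ν fX f fY) (hY : Measurable Y)
    (hX : Measurable X) (hC : ∀ x ∈ (μ.map X).support, ∀ y, f y x ≤ C) (hgm : Measurable g)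
    (hg : Integrable g) (q : ℝ) : ∫ ω, |g (Y ω - q)| ∂μ ≤ C * ∫ u, |g u| := by
  rw [← ENNReal.ofReal_le_ofReal_iff
    (mul_nonneg (hd.bound_nonneg hX hC) (integral_nonneg fun _ => abs_nonneg _))]
  exact (ofReal_integral_norm_eq_lintegral_enorm
    (hd.integrable_comp_sub hY hX hC hgm hg q)).trans_le
      (hd.lintegral_enorm_comp_sub_le hY hX hC hgm hg q)

theorem memLp_comp_sub_mul (hd : HasDensities μ Y X ν fX f fY) (hY : Measurable Y)
    (hX : Measurable X) (hC : ∀ x ∈ (μ.map X).support, ∀ y, f y x ≤ C) (hgm : Measurable g)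
    (hg : MemLp g 2) {W : (Fin d → ℝ) → ℝ} (hW : Measurable W) {B : ℝ} (hB : ∀ x, |W x| ≤ B)
    (q : ℝ) : MemLp (fun ω => g (Y ω - q) * W (X ω)) 2 μ := by
  have hsq := hd.integrable_comp_sub hY hX hC (hgm.pow_const 2)
    ((memLp_two_iff_integrable_sq hg.1).1 hg) q
  have hgY : MemLp (fun ω => g (Y ω - q)) 2 μ :=
    (memLp_two_iff_integrable_sq (hgm.comp (hY.sub_const q)).aestronglyMeasurable).2 hsq
  refine hgY.of_le_mul (c := B) (hgY.1.mul (hW.comp hX).aestronglyMeasurable)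
    (ae_of_all _ fun ω => ?_)
  rw [norm_mul, mul_comm]
  exact mul_le_mul_of_nonneg_right (hB _) (norm_nonneg _)

theorem integral_comp_sub_mul_sq_le (hd : HasDensities μ Y X ν fX f fY) (hY : Measurable Y)
    (hX : Measurable X) (hC : ∀ x ∈ (μ.map X).support, ∀ y, f y x ≤ C) (hgm : Measurable g)
    (hg : MemLp g 2) {W : (Fin d → ℝ) → ℝ} {B : ℝ} (hB : ∀ x, |W x| ≤ B) (q : ℝ) :
    ∫ ω, (g (Y ω - q) * W (X ω)) ^ 2 ∂μ ≤ B ^ 2 * (C * ∫ u, g u ^ 2) := by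
  have hsq := (memLp_two_iff_integrable_sq hg.1).1 hg
  have hle := hd.integral_abs_comp_sub_le hY hX hC (hgm.pow_const 2) hsq q
  simp only [abs_sq] at hle
  calc ∫ ω, (g (Y ω - q) * W (X ω)) ^ 2 ∂μ
      ≤ ∫ ω, B ^ 2 * g (Y ω - q) ^ 2 ∂μ := by
        refine integral_mono_of_nonneg (ae_of_all _ fun _ => sq_nonneg _)
          ((hd.integrable_comp_sub hY hX hC (hgm.pow_const 2) hsq q).const_mul _)
          (ae_of_all _ fun ω => ?_)
        change (g (Y ω - q) * W (X ω)) ^ 2 ≤ B ^ 2 * g (Y ω - q) ^ 2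
        rw [mul_pow, mul_comm]
        gcongr ?_ * _
        exact sq_le_sq' (neg_le_of_abs_le (hB _)) (le_of_abs_le (hB _))
    _ ≤ B ^ 2 * (C * ∫ u, g u ^ 2) := by
        rw [integral_const_mul]
        gcongr

theorem integral_comp_sub_mul (hd : HasDensities μ Y X ν fX f fY) (hY : Measurable Y)
    (hX : Measurable X) (hC : ∀ x ∈ (μ.map X).support, ∀ y, f y x ≤ C) (hgm : Measurable g)
    (hg : Integrable g) {W : (Fin d → ℝ) → ℝ} (hW : Measurable W) {B : ℝ} (hB : ∀ x, |W x| ≤ B)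
    (q : ℝ) :
    ∫ ω, g (Y ω - q) * W (X ω) ∂μ = ∫ ω, (W (X ω) * ∫ y, f y (X ω) * g (y - q)) ∂μ := by
  have hint : Integrable (fun ω => g (Y ω - q) * W (X ω)) μ :=
    (hd.integrable_comp_sub hY hX hC hgm hg q).mul_bdd (hW.comp hX).aestronglyMeasurable
      (ae_of_all _ fun ω => hB (X ω))
  rw [hd.integral_eq_integral_condLaw hY hX (φ := fun p => g (p.2 - q) * W p.1) (by fun_prop) hint]
  refine integral_congr_ae (ae_of_all _ fun ω => ?_)
  change ∫ y, g (y - q) * W (X ω) ∂condLaw f (X ω) = _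
  rw [integral_mul_const, integral_condLaw hd.measurable_f hd.f_nonneg, mul_comm]

theorem abs_integral_deriv_mul_le (hd : HasDensities μ Y X ν fX f fY) (hY : Measurable Y)
    (hX : Measurable X) (hC : ∀ x ∈ (μ.map X).support, ∀ y, f y x ≤ C)
    (hν : ν (μ.map X).support < ⊤)
    (hsmooth : ∀ x ∈ (μ.map X).support, ContDiff ℝ 1 fun y => f y x * fX x) {D : ℝ}
    (hD : ∀ x ∈ (μ.map X).support, ∀ y, |deriv (fun y => f y x * fX x) y| ≤ D)
    (hg : IsSmoothKernel g) {W : (Fin d → ℝ) → ℝ} (hW : Measurable W) {B : ℝ}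
    (hB : ∀ x, |W x| ≤ B) (q : ℝ) :
    |∫ ω, deriv g (Y ω - q) * W (X ω) ∂μ| ≤
      B * (D * ∫ u, |g u|) * ν.real (μ.map X).support := by
  have hfX := hd.measurable_fX
  have hf := hd.measurable_f
  have hinner : StronglyMeasurable fun x => W x * ∫ y, f y x * deriv g (y - q) := by
    have hjoint : Measurable fun p : (Fin d → ℝ) × ℝ => f p.2 p.1 * deriv g (p.2 - q) :=
      (hf.comp measurable_swap).mul ((measurable_deriv g).comp (measurable_snd.sub_const q))
    exact hW.stronglyMeasurable.mul hjoint.stronglyMeasurable.integral_prod_right'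
  rw [hd.integral_comp_sub_mul hY hX hC (measurable_deriv g) hg.integrable_deriv hW hB,
    ← integral_map hX.aemeasurable hinner.aestronglyMeasurable]
  nth_rw 1 [hd.map_covariate_eq hY hX]
  rw [integral_withDensity_eq_integral_toReal_smul (by fun_prop) (by simp), ← Real.norm_eq_abs]
  refine norm_setIntegral_le_of_norm_le_const hν fun x hx => ?_
  have hfx : ∀ y, |f y x * fX x| ≤ C * fX x := fun y => by
    rw [abs_of_nonneg (mul_nonneg (hd.f_nonneg y x) (hd.fX_nonneg x))]
    exact mul_le_mul_of_nonneg_right (hC x hx y) (hd.fX_nonneg x)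
  have hsplit : fX x * ∫ y, f y x * deriv g (y - q) =
      ∫ y, f y x * fX x * deriv g (y - q) := by
    rw [← integral_const_mul]
    congr 1 with y
    ring
  rw [ENNReal.toReal_ofReal (hd.fX_nonneg x), smul_eq_mul, mul_left_comm, hsplit, norm_mul]
  exact mul_le_mul (hB x) (hg.abs_integral_mul_deriv_le (hsmooth x hx) hfx (hD x hx) q)
    (norm_nonneg _) ((abs_nonneg _).trans (hB x))

theorem tendsto_integral_rescale (hd : HasDensities μ Y X ν fX f fY) (hY : Measurable Y)
    (hX : Measurable X) (hC : ∀ x ∈ (μ.map X).support, ∀ y, f y x ≤ C)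
    (hcont : ∀ x ∈ (μ.map X).support, Continuous fun y => f y x * fX x)
    (hK : IsSmoothKernel K) (Q : ℝ) :
    Tendsto (fun h => ∫ ω, rescale K h (Y ω - Q) ∂μ) (𝓝[>] 0) (𝓝 (∫ ω, f Q (X ω) ∂μ)) := by
  have hf := hd.measurable_f
  have hKm : Measurable K := hK.contDiff.continuous.measurable
  have hrescale : ∀ᶠ h in 𝓝[>] (0 : ℝ), ∫ ω, (∫ u, K u * f (Q + h * u) (X ω)) ∂μ =
      ∫ ω, rescale K h (Y ω - Q) ∂μ := by
    filter_upwards [self_mem_nhdsWithin] with h hh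
    have hcond := hd.integral_comp_sub_mul hY hX hC (W := fun _ => 1) (B := 1)
      (hK.rescale hh).contDiff.continuous.measurable (hK.rescale hh).integrable
      measurable_const (by simp) Q
    simp only [mul_one, one_mul, mul_comm (f _ _)] at hcond
    rw [hcond]
    simp only [integral_rescale_mul hh (fun y => f y _)]
  have hbound : ∀ᵐ ω ∂μ, ∀ h u, ‖K u * f (Q + h * u) (X ω)‖ ≤ |K u| * C := by
    filter_upwards [ae_mem_support hX] with ω hω h u
    rw [norm_mul, Real.norm_of_nonneg (hd.f_nonneg _ _)]
    exact mul_le_mul_of_nonneg_left (hC _ hω _) (abs_nonneg _)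
  refine Tendsto.congr' hrescale ?_
  refine tendsto_integral_filter_of_dominated_convergence (fun _ => ∫ u, |K u| * C)
    (Eventually.of_forall fun h => ?_) (Eventually.of_forall fun h => ?_) (integrable_const _) ?_
  · have hjoint : Measurable fun p : Ω × ℝ => K p.2 * f (Q + h * p.2) (X p.1) :=
      (hKm.comp measurable_snd).mul (hf.comp <|
        (measurable_snd.const_mul h).const_add Q |>.prodMk (hX.comp measurable_fst))
    exact hjoint.stronglyMeasurable.integral_prod_right'.aestronglyMeasurable
  · filter_upwards [hbound] with ω hω
    exact norm_integral_le_of_norm_le (hK.integrable.abs.mul_const C) (ae_of_all _ (hω h))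
  · filter_upwards [hbound, hd.ae_continuous_condDensity hY hX hcont] with ω hω hcontω
    have hlim : Tendsto (fun h => ∫ u, K u * f (Q + h * u) (X ω)) (𝓝[>] 0)
        (𝓝 (∫ u, K u * f Q (X ω))) := by
      refine tendsto_integral_filter_of_dominated_convergence (fun u => |K u| * C)
        (Eventually.of_forall fun h => ?_) (Eventually.of_forall fun h => ae_of_all _ (hω h))
        (hK.integrable.abs.mul_const C) (ae_of_all _ fun u => ?_)
      · exact (hK.contDiff.continuous.mul
          (hcontω.comp (by fun_prop))).aestronglyMeasurable
      · have hcu : Continuous fun h => K u * f (Q + h * u) (X ω) :=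
          continuous_const.mul (hcontω.comp (by fun_prop))
        simpa using (hcu.tendsto 0).mono_left nhdsWithin_le_nhds
    rwa [integral_mul_const, hK.integral_eq_one, one_mul] at hlim

end HasDensities

end KernelExpectation

section LocalRadius

theorem exists_isLittleO_between {α : Type*} {l : Filter α} {u v : α → ℝ}
    (hu : ∀ᶠ n in l, 0 < u n) (hv : ∀ᶠ n in l, 0 < v n) (ho : u =o[l] v) :
    ∃ s : α → ℝ, (∀ᶠ n in l, 0 < s n) ∧ u =o[l] s ∧ s =o[l] v := by
  have hsq : (fun n => √(u n * v n) ^ 2) =ᶠ[l] fun n => u n * v n := by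
    filter_upwards [hu, hv] with n hun hvn using Real.sq_sqrt (mul_nonneg hun.le hvn.le)
  refine ⟨fun n => √(u n * v n), ?_, ?_, ?_⟩
  · filter_upwards [hu, hv] with n hun hvn using Real.sqrt_pos.2 (mul_pos hun hvn)
  · refine Asymptotics.IsLittleO.of_pow (n := 2) (.congr' ?_ .rfl hsq.symm) two_ne_zero
    exact ((Asymptotics.isBigO_refl u l).mul_isLittleO ho).congr_left fun n => (sq (u n)).symm
  · refine Asymptotics.IsLittleO.of_pow (n := 2) (.congr' ?_ hsq.symm .rfl) two_ne_zero
    exact (ho.mul_isBigO (Asymptotics.isBigO_refl v l)).congr_right fun n => (sq (v n)).symm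

theorem IsAdmissibleBandwidth.exists_radius {h : ℕ → ℝ} (hh : IsAdmissibleBandwidth h) :
    ∃ s : ℕ → ℝ, (∀ᶠ n in atTop, 0 < s n) ∧
      (fun n : ℕ => (n : ℝ) ^ (-(1 / 2) : ℝ)) =o[atTop] s ∧
      s =o[atTop] kernelRate h ∧ s =o[atTop] h := by
  have hu : ∀ᶠ n : ℕ in atTop, 0 < (n : ℝ) ^ (-(1 / 2) : ℝ) :=
    (eventually_gt_atTop 0).mono fun n hn => Real.rpow_pos_of_pos (Nat.cast_pos.2 hn) _
  have huh : (fun n : ℕ => (n : ℝ) ^ (-(1 / 2) : ℝ)) =o[atTop] h :=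
    (Asymptotics.isLittleO_iff_tendsto' (hh.eventually_pos.mono fun n hn h0 =>
      absurd h0 hn.ne')).2 hh.tendsto_rpow_div
  obtain ⟨s, hs, hus, hsk⟩ :=
    exists_isLittleO_between hu hh.eventually_kernelRate_pos hh.rpow_isLittleO_kernelRate
  obtain ⟨t, ht, hut, hth⟩ := exists_isLittleO_between hu hh.eventually_pos huh
  have hmin : ∀ᶠ n in atTop, 0 < min (s n) (t n) := by
    filter_upwards [hs, ht] with n hsn htn using lt_min hsn htn
  refine ⟨fun n => min (s n) (t n), hmin, ?_, ?_, ?_⟩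
  · refine Asymptotics.isLittleO_iff.2 fun c hc => ?_
    filter_upwards [hus.def hc, hut.def hc, hs, ht, hmin] with n h1 h2 hsn htn hm
    rw [Real.norm_of_nonneg hsn.le] at h1
    rw [Real.norm_of_nonneg htn.le] at h2
    rw [Real.norm_of_nonneg hm.le, mul_min_of_nonneg _ _ hc.le]
    exact le_min h1 h2
  · refine Asymptotics.IsBigO.trans_isLittleO (.of_bound' ?_) hsk
    filter_upwards [hmin] with n hm
    exact abs_le_abs_of_nonneg hm.le (min_le_left _ _)
  · refine Asymptotics.IsBigO.trans_isLittleO (.of_bound' ?_) hth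
    filter_upwards [hmin] with n hm
    exact abs_le_abs_of_nonneg hm.le (min_le_right _ _)

end LocalRadius

section KernelMeanRate

variable {Ω : Type*} [MeasurableSpace Ω] {μ : Measure Ω} {d : ℕ}
    {y : ℕ → Ω → ℝ} {x : ℕ → Ω → Fin d → ℝ} {ν : Measure (Fin d → ℝ)} [SFinite ν]
    {fX : (Fin d → ℝ) → ℝ} {f : ℝ → (Fin d → ℝ) → ℝ} {fY : ℝ → ℝ}
    {g k K : ℝ → ℝ} {h s : ℕ → ℝ} {C D B : ℝ} {W : (Fin d → ℝ) → ℝ}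

theorem IsRandomSample.measurable_kernelMean {Ω : Type*} [MeasurableSpace Ω] {μ : Measure Ω}
    {d : ℕ} {y : ℕ → Ω → ℝ} {x : ℕ → Ω → Fin d → ℝ} {W : (Fin d → ℝ) → ℝ} {g : ℝ → ℝ}
    (hs : IsRandomSample μ y x) (hg : Measurable g) (hW : Measurable W) (n : ℕ) :
    Measurable (Function.uncurry fun ω t =>
      kernelMean g n (fun i => y i ω) (fun i => W (x i ω)) t) := by
  have hy := hs.measurable_y
  have hx := hs.measurable_x
  unfold kernelMean Function.uncurry
  fun_prop

variable [IsProbabilityMeasure μ]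

theorem exists_lintegral_kernelMean_deriv_le (hs : IsRandomSample μ y x)
    (hd : HasDensities μ (y 0) (x 0) ν fX f fY)
    (hC : ∀ x' ∈ (μ.map (x 0)).support, ∀ y, f y x' ≤ C)
    (hν : ν (μ.map (x 0)).support < ⊤)
    (hsmooth : ∀ x' ∈ (μ.map (x 0)).support, ContDiff ℝ 1 fun y => f y x' * fX x')
    (hD : ∀ x' ∈ (μ.map (x 0)).support, ∀ y, |deriv (fun y => f y x' * fX x') y| ≤ D)
    (hK : IsSmoothKernel K) (hh : IsAdmissibleBandwidth h) (hW : Measurable W)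
    (hB : ∀ x', |W x'| ≤ B) :
    ∃ b c : ℝ, ∀ᶠ n in atTop, ∀ t,
      ∫⁻ ω, ‖kernelMean (deriv (rescale K (h n))) n (fun i => y i ω) (fun i => W (x i ω)) t‖ₑ ∂μ
        ≤ ENNReal.ofReal (b + c * (kernelRate h n / h n)) := by
  refine ⟨B * (D * ∫ u, |K u|) * ν.real (μ.map (x 0)).support,
    √(B ^ 2 * (C * ∫ u, deriv K u ^ 2)), ?_⟩
  have hY := hs.measurable_y 0
  have hX := hs.measurable_x 0
  filter_upwards [hh.eventually_pos, hh.eventually_kernelRate_pos, eventually_ne_atTop 0]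
    with n hhn hρ hn t
  have hKh := hK.rescale hhn
  have hgm : Measurable (deriv (rescale K (h n))) := measurable_deriv _
  have hmean := hd.abs_integral_deriv_mul_le hY hX hC hν hsmooth hD hKh hW hB t
  have hsq := hd.integral_comp_sub_mul_sq_le hY hX hC hgm hKh.memLp_deriv hB t
  rw [integral_abs_rescale hhn] at hmean
  rw [hK.integral_deriv_rescale_sq hhn] at hsq
  refine (lintegral_enorm_sampleMean_le_add (Z := fun i ω => (y i ω, x i ω)) hs.indep
    hs.identDistrib (φ := fun z => deriv (rescale K (h n)) (z.1 - t) * W z.2) (by fun_prop)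
    (hd.memLp_comp_sub_mul hY hX hC hgm hKh.memLp_deriv hW hB t) hn).trans
      (ENNReal.ofReal_le_ofReal (add_le_add hmean ?_))
  rw [← Real.sqrt_sq (div_nonneg hρ.le hhn.le), ← Real.sqrt_mul' _ (sq_nonneg _), div_pow,
    kernelRate_sq hhn]
  refine Real.sqrt_le_sqrt ((div_le_div_of_nonneg_right hsq n.cast_nonneg).trans_eq ?_)
  field_simp

theorem isLittleO_kernelMean_sub (hs : IsRandomSample μ y x)
    (hd : HasDensities μ (y 0) (x 0) ν fX f fY)
    (hC : ∀ x' ∈ (μ.map (x 0)).support, ∀ y, f y x' ≤ C)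
    (hν : ν (μ.map (x 0)).support < ⊤)
    (hsmooth : ∀ x' ∈ (μ.map (x 0)).support, ContDiff ℝ 1 fun y => f y x' * fX x')
    (hD : ∀ x' ∈ (μ.map (x 0)).support, ∀ y, |deriv (fun y => f y x' * fX x') y| ≤ D)
    (hK : IsSmoothKernel K) (hh : IsAdmissibleBandwidth h) (hW : Measurable W)
    (hB : ∀ x', |W x'| ≤ B) (hs0 : ∀ᶠ n in atTop, 0 < s n) (hsk : s =o[atTop] kernelRate h)
    (hsh : s =o[atTop] h) {q : ℕ × Ω → ℝ} {Q : ℝ} (hq : ∀ᶠ p in whp μ, |q p - Q| ≤ s p.1) :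
    (fun p : ℕ × Ω =>
      kernelMean (rescale K (h p.1)) p.1 (fun i => y i p.2) (fun i => W (x i p.2)) (q p) -
        kernelMean (rescale K (h p.1)) p.1 (fun i => y i p.2) (fun i => W (x i p.2)) Q)
      =o[whp μ] fun p => kernelRate h p.1 := by
  obtain ⟨b, c, hbc⟩ :=
    exists_lintegral_kernelMean_deriv_le hs hd hC hν hsmooth hD hK hh hW hB
  have ho : (fun n => s n * (b + c * (kernelRate h n / h n))) =o[atTop] kernelRate h := by
    have hsh' : (fun n => s n * (kernelRate h n / h n)) =o[atTop] kernelRate h := by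
      refine (hsh.mul_isBigO (Asymptotics.isBigO_refl _ _)).congr' .rfl ?_
      filter_upwards [hh.eventually_pos] with n hn using mul_div_cancel₀ _ hn.ne'
    refine ((hsk.const_mul_left b).add (hsh'.const_mul_left c)).congr_left fun n => ?_
    ring
  refine Asymptotics.IsBigO.trans_isLittleO (.of_bound' ?_) (isLittleO_whp_setIntegral_abs
    (fun n => hs.measurable_kernelMean (measurable_deriv (rescale K (h n))) hW n) hs0 hbc
    hh.eventually_kernelRate_pos ho Q)
  filter_upwards [hq, tendsto_fst_whp.eventually hh.eventually_pos] with p hqp hhp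
  exact (abs_kernelMean_sub_le (hK.rescale hhp).contDiff hqp).trans (le_abs_self _)

theorem isLittleO_kernelMean_sub_integral (hs : IsRandomSample μ y x)
    (hd : HasDensities μ (y 0) (x 0) ν fX f fY)
    (hC : ∀ x' ∈ (μ.map (x 0)).support, ∀ y, f y x' ≤ C) (hkm : Measurable k)
    (hk : Integrable k) (hk2 : MemLp k 2) (hh : IsAdmissibleBandwidth h) (Q : ℝ) :
    (fun p : ℕ × Ω =>
      kernelMean (rescale k (h p.1)) p.1 (fun i => y i p.2) (fun _ => 1) Q -
        ∫ ω, rescale k (h p.1) (y 0 ω - Q) ∂μ) =o[whp μ] fun _ => (1 : ℝ) := by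
  have hY := hs.measurable_y 0
  have hX := hs.measurable_x 0
  have hrm : ∀ n, Measurable (rescale k (h n)) := fun n =>
    (hkm.comp (measurable_id.div_const _)).const_mul _
  have ho : (fun n : ℕ => √((∫ ω, (rescale k (h n) (y 0 ω - Q) * 1) ^ 2 ∂μ) / n)) =o[atTop]
      fun _ => (1 : ℝ) := by
    have hlim := hh.tendsto_kernelRate.const_mul √(C * ∫ u, k u ^ 2)
    rw [mul_zero] at hlim
    refine (Asymptotics.isLittleO_one_iff ℝ).2
      (squeeze_zero' (Eventually.of_forall fun _ => Real.sqrt_nonneg _) ?_ hlim)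
    filter_upwards [hh.eventually_pos, hh.eventually_kernelRate_pos] with n hhn hρ
    have hsq := hd.integral_comp_sub_mul_sq_le hY hX hC (hrm n) (memLp_two_rescale hk hk2 hhn)
      (W := fun _ => 1) (B := 1) (by simp) Q
    rw [integral_rescale_sq hhn] at hsq
    rw [← Real.sqrt_sq hρ.le, ← Real.sqrt_mul' _ (sq_nonneg _), kernelRate_sq hhn]
    refine Real.sqrt_le_sqrt ((div_le_div_of_nonneg_right hsq n.cast_nonneg).trans_eq ?_)
    field_simp
  have hmean := isLittleO_whp_sampleMean_sub (Z := fun i ω => (y i ω, x i ω)) hs.indep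
    hs.identDistrib
    (φ := fun n (z : ℝ × (Fin d → ℝ)) => rescale k (h n) (z.1 - Q) * 1)
    (fun n => ((hrm n).comp (measurable_fst.sub_const Q)).mul_const 1) ?_
    (r := fun _ => 1) (.of_forall fun _ => one_pos) ho
  · simpa only [sampleMean, kernelMean, mul_one] using hmean
  · filter_upwards [hh.eventually_pos] with n hhn
    exact hd.memLp_comp_sub_mul hY hX hC (hrm n) (memLp_two_rescale hk hk2 hhn)
      (W := fun _ => 1) measurable_const (B := 1) (by simp) Q

theorem tendsto_kernelMean_one (hs : IsRandomSample μ y x)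
    (hd : HasDensities μ (y 0) (x 0) ν fX f fY)
    (hC : ∀ x' ∈ (μ.map (x 0)).support, ∀ y, f y x' ≤ C)
    (hcont : ∀ x' ∈ (μ.map (x 0)).support, Continuous fun y => f y x' * fX x')
    (hK : IsSmoothKernel K) (hh : IsAdmissibleBandwidth h) (Q : ℝ) :
    Tendsto (fun p : ℕ × Ω =>
      kernelMean (rescale K (h p.1)) p.1 (fun i => y i p.2) (fun _ => 1) Q) (whp μ)
      (𝓝 (∫ ω, f Q (x 0 ω) ∂μ)) := by
  have hstoch := (Asymptotics.isLittleO_one_iff ℝ).1 <| isLittleO_kernelMean_sub_integral hs hd hC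
    hK.contDiff.continuous.measurable hK.integrable hK.memLp_two hh Q
  have hh0 : Tendsto h atTop (𝓝[>] 0) :=
    tendsto_nhdsWithin_iff.2 ⟨hh.tendsto_zero, hh.eventually_pos⟩
  have hbias := ((hd.tendsto_integral_rescale (hs.measurable_y 0) (hs.measurable_x 0) hC hcont hK
    Q).comp hh0).comp (tendsto_fst_whp (μ := μ))
  simpa using hstoch.add hbias

theorem isBigO_kernelMean_abs (hs : IsRandomSample μ y x)
    (hd : HasDensities μ (y 0) (x 0) ν fX f fY)
    (hC : ∀ x' ∈ (μ.map (x 0)).support, ∀ y, f y x' ≤ C)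
    (hK : IsSmoothKernel K) (hh : IsAdmissibleBandwidth h) (Q : ℝ) :
    (fun p : ℕ × Ω =>
      kernelMean (fun u => |rescale K (h p.1) u|) p.1 (fun i => y i p.2) (fun _ => 1) Q)
      =O[whp μ] fun _ => (1 : ℝ) := by
  have hKm : Measurable K := hK.contDiff.continuous.measurable
  have hstoch := isLittleO_kernelMean_sub_integral hs hd hC hKm.abs hK.integrable.abs
    hK.memLp_two.abs hh Q
  have hmean : (fun p : ℕ × Ω => ∫ ω, rescale (fun u => |K u|) (h p.1) (y 0 ω - Q) ∂μ)
      =O[whp μ] fun _ => (1 : ℝ) := by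
    refine .of_bound (C * ∫ u, |K u|) ?_
    filter_upwards [tendsto_fst_whp.eventually hh.eventually_pos] with p hp
    have hle := hd.integral_abs_comp_sub_le (hs.measurable_y 0) (hs.measurable_x 0) hC
      (hK.rescale hp).contDiff.continuous.measurable (hK.rescale hp).integrable Q
    rw [integral_abs_rescale hp] at hle
    simp_rw [← abs_rescale hp]
    rwa [Real.norm_of_nonneg (integral_nonneg fun _ => abs_nonneg _), norm_one, mul_one]
  refine (hstoch.isBigO.add hmean).congr' ?_ .rfl
  filter_upwards [tendsto_fst_whp.eventually hh.eventually_pos] with p hp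
  simp_rw [sub_add_cancel, abs_rescale hp]

theorem isBigO_kernelMean_abs_of_abs_sub_le (hs : IsRandomSample μ y x)
    (hd : HasDensities μ (y 0) (x 0) ν fX f fY)
    (hC : ∀ x' ∈ (μ.map (x 0)).support, ∀ y, f y x' ≤ C)
    (hK : IsSmoothKernel K) (hh : IsAdmissibleBandwidth h) (hs0 : ∀ᶠ n in atTop, 0 < s n)
    (hsh : s =o[atTop] h) {q : ℕ × Ω → ℝ} {Q : ℝ} (hq : ∀ᶠ p in whp μ, |q p - Q| ≤ s p.1) :
    (fun p : ℕ × Ω =>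
      kernelMean (fun u => |rescale K (h p.1) u|) p.1 (fun i => y i p.2) (fun _ => 1) (q p))
      =O[whp μ] fun _ => (1 : ℝ) := by
  have hmeas : ∀ n, Measurable fun u => |deriv (rescale K (h n)) u| := fun n =>
    (measurable_deriv _).abs
  have ho : (fun n => s n * (C * ((h n)⁻¹ * ∫ u, |deriv K u|))) =o[atTop]
      fun _ => (1 : ℝ) := by
    refine (Asymptotics.isLittleO_one_iff ℝ).2 ?_
    have hlim := hsh.tendsto_div_nhds_zero.mul_const (C * ∫ u, |deriv K u|)
    rw [zero_mul] at hlim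
    refine hlim.congr fun n => ?_
    ring
  have hbound : ∀ᶠ n in atTop, ∀ t, ∫⁻ ω, ‖kernelMean (fun u => |deriv (rescale K (h n)) u|) n
      (fun i => y i ω) (fun _ => 1) t‖ₑ ∂μ ≤
        ENNReal.ofReal (C * ((h n)⁻¹ * ∫ u, |deriv K u|)) := by
    filter_upwards [hh.eventually_pos] with n hn t
    refine (lintegral_enorm_sampleMean_le (Z := fun i ω => (y i ω, x i ω)) hs.identDistrib
      (φ := fun z => |deriv (rescale K (h n)) (z.1 - t)| * 1)
      (((hmeas n).comp (measurable_fst.sub_const t)).mul_const 1) n).trans ?_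
    have hle := hd.lintegral_enorm_comp_sub_le (hs.measurable_y 0) (hs.measurable_x 0) hC
      (hmeas n) (hK.rescale hn).integrable_deriv.abs t
    simpa only [abs_abs, hK.integral_abs_deriv_rescale hn, mul_one] using hle
  have hvar := isLittleO_whp_setIntegral_abs
    (fun n => hs.measurable_kernelMean (hmeas n) (measurable_const (a := (1 : ℝ))) n) hs0 hbound
    (by simp) ho Q
  refine .trans (.of_bound' ?_) ((isBigO_kernelMean_abs hs hd hC hK hh Q).add hvar.isBigO)
  filter_upwards [hq, tendsto_fst_whp.eventually hh.eventually_pos] with p hqp hhp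
  refine abs_le_abs_of_nonneg ?_ (kernelMean_abs_le (hK.rescale hhp).contDiff hqp)
  unfold kernelMean
  positivity

end KernelMeanRate

section Ratio

theorem isLittleO_div_sub_div {α : Type*} {l : Filter α} {N N' D D' r : α → ℝ} {c : ℝ}
    (hN : (fun p => N p - N' p) =o[l] r) (hD : (fun p => D p - D' p) =o[l] r)
    (hN' : N' =O[l] fun _ => (1 : ℝ)) (hD' : Tendsto D' l (𝓝 c)) (hc : c ≠ 0)
    (hr : Tendsto r l (𝓝 0)) : (fun p => N p / D p - N' p / D' p) =o[l] r := by
  have hDc : Tendsto D l (𝓝 c) := by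
    simpa using (hD.trans_tendsto hr).add hD'
  have hinv := ((hDc.mul hD').inv₀ (mul_ne_zero hc hc)).isBigO_one ℝ
  have hnum : (fun p => (N p - N' p) * D' p - N' p * (D p - D' p)) =o[l] r := by
    exact ((hN.mul_isBigO (hD'.isBigO_one ℝ)).congr_right fun _ => mul_one _).sub
      ((hN'.mul_isLittleO hD).congr_right fun _ => one_mul _)
  refine (hnum.mul_isBigO hinv).congr' ?_ (.of_forall fun _ => mul_one _)
  filter_upwards [hDc.eventually_ne hc, hD'.eventually_ne hc] with p hp hp'
  field_simp
  ring

end Ratio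

section Regression

variable {Ω : Type*} [MeasurableSpace Ω] {μ : Measure Ω} {d : ℕ}
    {y : ℕ → Ω → ℝ} {x : ℕ → Ω → Fin d → ℝ} {ν : Measure (Fin d → ℝ)}
    {fX : (Fin d → ℝ) → ℝ} {f : ℝ → (Fin d → ℝ) → ℝ} {fY : ℝ → ℝ}

theorem IsRandomSample.eventually_whp_mem_support (hs : IsRandomSample μ y x) :
    ∀ᶠ p in whp μ, ∀ i, x i p.2 ∈ (μ.map (x 0)).support :=
  eventually_whp_of_eventually_ae (.of_forall fun _ => hs.ae_forall_mem_support)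

theorem IsRandomSample.isLittleO_kernelMean (hs : IsRandomSample μ y x) {g : ℕ → ℝ → ℝ}
    {r : ℕ → ℝ} {q : ℕ × Ω → ℝ} {v : (ℕ × Ω) × (Fin d → ℝ) → ℝ}
    (hv : v =o[whp μ ×ˢ 𝓟 (μ.map (x 0)).support] fun p => r p.1.1)
    (hg : (fun p : ℕ × Ω =>
      kernelMean (fun u => |g p.1 u|) p.1 (fun i => y i p.2) (fun _ => 1) (q p)) =O[whp μ]
        fun _ => (1 : ℝ)) :
    (fun p : ℕ × Ω =>
      kernelMean (g p.1) p.1 (fun i => y i p.2) (fun i => v (p, x i p.2)) (q p))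
      =o[whp μ] fun p => r p.1 := by
  have hmul := (Asymptotics.isBigO_refl (fun p : ℕ × Ω => r p.1) (whp μ)).mul hg
  simp only [mul_one] at hmul
  refine (Asymptotics.isLittleO_iff.2 fun c hc => ?_).trans_isBigO hmul
  filter_upwards [eventually_prod_principal_iff.1 (hv.def hc),
    hs.eventually_whp_mem_support] with p hvp hxp
  rw [norm_mul, ← mul_assoc]
  refine (abs_kernelMean_le fun i _ => hvp _ (hxp i)).trans ?_
  gcongr
  exact le_abs_self _

variable [IsProbabilityMeasure μ]

theorem isLittleO_nadarayaWatson_sub [SFinite ν] {K : ℝ → ℝ} {h s : ℕ → ℝ} {C D B : ℝ}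
    {W : (Fin d → ℝ) → ℝ} (hs : IsRandomSample μ y x)
    (hd : HasDensities μ (y 0) (x 0) ν fX f fY)
    (hC : ∀ x' ∈ (μ.map (x 0)).support, ∀ y, f y x' ≤ C)
    (hν : ν (μ.map (x 0)).support < ⊤)
    (hsmooth : ∀ x' ∈ (μ.map (x 0)).support, ContDiff ℝ 1 fun y => f y x' * fX x')
    (hD : ∀ x' ∈ (μ.map (x 0)).support, ∀ y, |deriv (fun y => f y x' * fX x') y| ≤ D)
    (hK : IsSmoothKernel K) (hh : IsAdmissibleBandwidth h) (hW : Measurable W)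
    (hB : ∀ x', |W x'| ≤ B) (hs0 : ∀ᶠ n in atTop, 0 < s n) (hsk : s =o[atTop] kernelRate h)
    (hsh : s =o[atTop] h) {q : ℕ × Ω → ℝ} {Q : ℝ} (hq : ∀ᶠ p in whp μ, |q p - Q| ≤ s p.1)
    (hQ : ∫ ω, f Q (x 0 ω) ∂μ ≠ 0) {w : (ℕ × Ω) × (Fin d → ℝ) → ℝ}
    (hw : (fun p => w p - W p.2) =o[whp μ ×ˢ 𝓟 (μ.map (x 0)).support]
      fun p => kernelRate h p.1.1) :
    (fun p : ℕ × Ω =>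
      nadarayaWatson K (h p.1) p.1 (fun i => y i p.2) (fun i => w (p, x i p.2)) (q p) -
        nadarayaWatson K (h p.1) p.1 (fun i => y i p.2) (fun i => W (x i p.2)) Q)
      =o[whp μ] fun p => kernelRate h p.1 := by
  have hweights := hs.isLittleO_kernelMean hw (g := fun n => rescale K (h n))
    (isBigO_kernelMean_abs_of_abs_sub_le hs hd hC hK hh hs0 hsh hq)
  have hnum := hweights.add
    (isLittleO_kernelMean_sub hs hd hC hν hsmooth hD hK hh hW hB hs0 hsk hsh hq)
  simp only [← kernelMean_sub, sub_add_sub_cancel] at hnum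
  have hden := isLittleO_kernelMean_sub hs hd hC hν hsmooth hD hK hh (W := fun _ => 1)
    measurable_const (B := 1) (by simp) hs0 hsk hsh hq
  have hnum0 : (fun p : ℕ × Ω => kernelMean (rescale K (h p.1)) p.1 (fun i => y i p.2)
      (fun i => W (x i p.2)) Q) =O[whp μ] fun _ => (1 : ℝ) := by
    refine .trans (.of_bound B (.of_forall fun p => ?_)) (isBigO_kernelMean_abs hs hd hC hK hh Q)
    refine (abs_kernelMean_le fun i _ => hB _).trans ?_
    gcongr
    · exact (abs_nonneg _).trans (hB 0)
    · exact le_abs_self _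
  have hden0 := tendsto_kernelMean_one hs hd hC (fun x' hx => (hsmooth x' hx).continuous) hK hh Q
  refine (isLittleO_div_sub_div hnum hden hnum0 hden0 hQ
    (hh.tendsto_kernelRate.comp tendsto_fst_whp)).congr' ?_ .rfl
  filter_upwards [tendsto_fst_whp.eventually (eventually_ne_atTop 0)] with p hp
  simp only [nadarayaWatson_eq_div K _ hp]

end Regression

section Oracle

variable {Ω : Type*} [MeasurableSpace Ω] {μ : Measure Ω} {d : ℕ}
    {y : ℕ → Ω → ℝ} {x : ℕ → Ω → Fin d → ℝ} {ν : Measure (Fin d → ℝ)}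
    {fX : (Fin d → ℝ) → ℝ} {f : ℝ → (Fin d → ℝ) → ℝ} {fY : ℝ → ℝ}
    {τ ε Q : ℝ} {β : ℝ → Fin d → ℝ} {ξ : (Fin d → ℝ) → ℝ}

theorem HasDensities.exists_measurable_comp_matching {Y : Ω → ℝ} {X : Ω → Fin d → ℝ}
    (hd : HasDensities μ Y X ν fX f fY) {b : ℝ → ℝ} (hb : ContinuousOn b (Icc ε (1 - ε)))
    (hε : ε ≤ 1 - ε)
    (hξ : ∀ x ∈ (μ.map X).support, ξ x ∈ matchingSet f Q x ∩ Icc ε (1 - ε)) :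
    ∃ (W : (Fin d → ℝ) → ℝ) (B : ℝ), Measurable W ∧ (∀ x, |W x| ≤ B) ∧
      ∀ x ∈ (μ.map X).support, W x = b (ξ x) := by
  obtain ⟨B, hB⟩ := isCompact_Icc.exists_bound_of_continuousOn hb
  have hext : Continuous (IccExtend hε fun η : Icc ε (1 - ε) => b η) :=
    (continuousOn_iff_continuous_domRestrict.1 hb).Icc_extend'
  refine ⟨fun x => IccExtend hε (fun η : Icc ε (1 - ε) => b η) ((condLaw f x).real (Iic Q)), B,
    hext.measurable.comp (hd.measurable_condLaw_real_Iic Q),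
    fun x => hB _ (projIcc ε (1 - ε) hε _).2, fun x hx => ?_⟩
  have := hd.cond x hx
  simp only [condLaw_real_Iic_of_mem_matchingSet (hξ x hx).1, IccExtend_of_mem hε _ (hξ x hx).2]

theorem IsLinearQuantileModel.integral_density_pos [IsProbabilityMeasure μ]
    {βhat : ℕ → ℝ → Ω → Fin d → ℝ} {Qhat : ℕ → Ω → ℝ}
    (hm : IsLinearQuantileModel μ y x f fY τ ε β βhat Qhat) (hs : IsRandomSample μ y x)
    (hd : HasDensities μ (y 0) (x 0) ν fX f fY) (hε : ε ∈ Ioo (0 : ℝ) (1 / 2))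
    (hξ : ∀ x' ∈ (μ.map (x 0)).support, ξ x' ∈ matchingSet f Q x' ∩ Icc ε (1 - ε)) {C : ℝ}
    (hC : ∀ x' ∈ (μ.map (x 0)).support, ∀ y, f y x' ≤ C) : 0 < ∫ ω, f Q (x 0 ω) ∂μ := by
  obtain ⟨c, hc, hcf⟩ := hm.exists_le_density hd hε
  have hX := hs.measurable_x 0
  have hf := hd.measurable_f
  have hle : ∀ᵐ ω ∂μ, c ≤ f Q (x 0 ω) := (ae_mem_support hX).mono fun ω hω =>
    hcf _ hω _ (hξ _ hω).2 _ (hξ _ hω).2 Q (by simp [hm.dotProduct_matching hω (hξ _ hω)])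
  have hint : Integrable (fun ω => f Q (x 0 ω)) μ := by
    refine .of_bound (Measurable.aestronglyMeasurable (by fun_prop)) C ?_
    filter_upwards [ae_mem_support hX] with ω hω
    exact (Real.norm_of_nonneg (hd.f_nonneg _ _)).trans_le (hC _ hω _)
  calc 0 < ∫ _, c ∂μ := by simpa using hc
    _ ≤ ∫ ω, f Q (x 0 ω) ∂μ := integral_mono_ae (integrable_const _) hint hle

end Oracle

section Smoothness

variable {d : ℕ} {S : Set (Fin d → ℝ)} {fX : (Fin d → ℝ) → ℝ} {f : ℝ → (Fin d → ℝ) → ℝ}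
    {fY : ℝ → ℝ} {r : ℕ}

theorem DensityAssumption.contDiff_one (h : DensityAssumption S fX f fY r) {x : Fin d → ℝ}
    (hx : x ∈ S) : ContDiff ℝ 1 fun y => f y x * fX x :=
  (h.joint_contDiff x hx).of_le (by exact_mod_cast Nat.le_add_left 1 r)

theorem DensityAssumption.exists_abs_deriv_le (h : DensityAssumption S fX f fY r) :
    ∃ D : ℝ, ∀ x ∈ S, ∀ y, |deriv (fun y => f y x * fX x) y| ≤ D := by
  obtain ⟨D, hD⟩ := h.joint_bounded
  refine ⟨D, fun x hx y => ?_⟩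
  simpa only [iteratedDeriv_one] using hD x hx 1 (by simp) y

end Smoothness

end UQPE

end

theorem theorem2_general {Ω : Type*} [MeasurableSpace Ω] {μ : Measure Ω} [IsProbabilityMeasure μ]
    {d : ℕ} [NeZero d] {y : ℕ → Ω → ℝ} {x : ℕ → Ω → Fin d → ℝ}
    (hsample : UQPE.IsRandomSample μ y x) {ν : Measure (Fin d → ℝ)} [IsLocallyFiniteMeasure ν]
    {fX : (Fin d → ℝ) → ℝ} {f : ℝ → (Fin d → ℝ) → ℝ} {fY : ℝ → ℝ}
    (hdens : UQPE.HasDensities μ (y 0) (x 0) ν fX f fY)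
    {τ : ℝ} (hτ : τ ∈ Ioo (0 : ℝ) 1) {ε : ℝ} (hε : ε ∈ Ioo (0 : ℝ) (1 / 2))
    {β : ℝ → Fin d → ℝ} {ξ : (Fin d → ℝ) → ℝ}
    (hξ : ∀ x' ∈ (μ.map (x 0)).support,
      ξ x' ∈ UQPE.matchingSet f (UQPE.quantile (μ.map (y 0)) τ) x' ∩ Icc ε (1 - ε))
    {βhat : ℕ → ℝ → Ω → Fin d → ℝ}
    {Qhat : ℕ → Ω → ℝ} {ξhat : ℕ → (Fin d → ℝ) → Ω → ℝ}
    (hξhat : ∀ n x' ω, ξhat n x' ω ∈ Icc ε (1 - ε))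
    {K : ℝ → ℝ} {h : ℕ → ℝ} {D : ℝ}
    (hmodel : UQPE.IsLinearQuantileModel μ y x f fY τ ε β βhat Qhat)
    (hkernel : UQPE.IsSmoothKernel K) (hbandwidth : UQPE.IsAdmissibleBandwidth h)
    (hsmooth : ∀ x' ∈ (μ.map (x 0)).support, ContDiff ℝ 1 fun y => f y x' * fX x')
    (hD : ∀ x' ∈ (μ.map (x 0)).support, ∀ y, |deriv (fun y => f y x' * fX x') y| ≤ D)
    (happrox : UQPE.ApproxAssumption μ (μ.map (x 0)).support f ε
      (UQPE.quantile (μ.map (y 0)) τ) β ξ βhat Qhat ξhat) :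
    UQPE.IsLittleOp μ
      (fun n ω =>
        UQPE.nadarayaWatson K (h n) n (fun i => y i ω)
            (fun i => βhat n (ξhat n (x i ω) ω) ω 0) (Qhat n ω)
          - UQPE.nadarayaWatson K (h n) n (fun i => y i ω)
            (fun i => β (ξ (x i ω)) 0) (UQPE.quantile (μ.map (y 0)) τ))
      (fun n => (n : ℝ) ^ (-(1 / 2) : ℝ) * h n ^ (-(1 / 2) : ℝ)) := by
  have hbdd := hmodel.isBounded_support hsample hdens hτ hε hξ hξhat happrox
  have hν := (Metric.isCompact_of_isClosed_isBounded
    Measure.isClosed_support hbdd).measure_lt_top (μ := ν)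
  obtain ⟨C, hC⟩ := happrox.density_bounded
  obtain ⟨W, B, hW, hB, hWβ⟩ := hdens.exists_measurable_comp_matching
    happrox.beta_differentiable.continuousOn (by linarith [hε.2]) hξ
  obtain ⟨s, hs0, hns, hsk, hsh⟩ := hbandwidth.exists_radius
  have hQhat : ∀ᶠ p in UQPE.whp μ, |Qhat p.1 p.2 - UQPE.quantile (μ.map (y 0)) τ| ≤ s p.1 := by
    filter_upwards [(hmodel.isLittleO_sampleQuantile hsample hdens hτ hs0 hns).def one_pos,
      UQPE.tendsto_fst_whp.eventually hs0] with p hp hsp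
    rwa [one_mul, Real.norm_of_nonneg hsp.le] at hp
  have hweight : (fun p : (ℕ × Ω) × (Fin d → ℝ) =>
      βhat p.1.1 (ξhat p.1.1 p.2 p.1.2) p.1.2 0 - W p.2)
      =o[UQPE.whp μ ×ˢ 𝓟 (μ.map (x 0)).support] fun p => UQPE.kernelRate h p.1.1 := by
    refine (hmodel.isLittleO_weight hsample hdens hτ hε (fun x' hx => (hξ x' hx).2) hξhat
      happrox hbdd hbandwidth).congr' (eventually_prod_principal_iff.2 ?_) .rfl
    exact .of_forall fun p x' hx => by simp only [hWβ x' hx]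
  refine (UQPE.isLittleOp_iff_isLittleO
    (hbandwidth.eventually_kernelRate_pos.mono fun _ => le_of_lt)).2
    ((UQPE.isLittleO_nadarayaWatson_sub hsample hdens hC hν hsmooth hD hkernel hbandwidth hW hB hs0
      hsk hsh hQhat (hmodel.integral_density_pos hsample hdens hε hξ hC).ne' hweight).congr'
      ?_ .rfl)
  filter_upwards [hsample.eventually_whp_mem_support] with p hp
  simp only [hWβ _ (hp _)]

theorem theorem2 {Ω : Type*} [MeasurableSpace Ω] (μ : Measure Ω) [IsProbabilityMeasure μ]
    {d : ℕ} [NeZero d]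
    -- the sample and its densities
    (y : ℕ → Ω → ℝ) (x : ℕ → Ω → Fin d → ℝ) (hsample : UQPE.IsRandomSample μ y x)
    (ν : Measure (Fin d → ℝ)) [IsLocallyFiniteMeasure ν]
    (fX : (Fin d → ℝ) → ℝ) (f : ℝ → (Fin d → ℝ) → ℝ) (fY : ℝ → ℝ)
    (hdens : UQPE.HasDensities μ (y 0) (x 0) ν fX f fY)
    -- the quantile levels, the coefficients and the true matching function
    (τ : ℝ) (hτ : τ ∈ Ioo (0 : ℝ) 1) (ε : ℝ) (hε : ε ∈ Ioo (0 : ℝ) (1 / 2))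
    (β : ℝ → Fin d → ℝ) (ξ : (Fin d → ℝ) → ℝ)
    (hξ : ∀ x' ∈ (μ.map (x 0)).support,
      ξ x' ∈ UQPE.matchingSet f (UQPE.quantile (μ.map (y 0)) τ) x' ∩ Icc ε (1 - ε))
    -- the first-step estimators
    (m : ℕ → ℕ) (grid : (n : ℕ) → Fin (m n + 1) → ℝ)
    (βhat : ℕ → ℝ → Ω → Fin d → ℝ)
    (hβhat : ∀ n, ∀ η ∈ Icc ε (1 - ε), ∀ ω,
      UQPE.IsQRCoef n (fun i => y i ω) (fun i => x i ω) η (βhat n η ω))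
    (Qhat : ℕ → Ω → ℝ)
    (hQhat : ∀ n ω, UQPE.IsSampleQuantile n (fun i => y i ω) τ (Qhat n ω))
    (ξhat : ℕ → (Fin d → ℝ) → Ω → ℝ)
    (hξhat : ∀ n x' ω,
      UQPE.IsMatch ε (grid n) (fun η => βhat n η ω) (Qhat n ω) x' (ξhat n x' ω))
    -- the kernel and the bandwidth
    (K : ℝ → ℝ) (r : ℕ) (h : ℕ → ℝ) (a : ℝ)
    -- the assumptions
    (hmatching : UQPE.MatchingAssumption μ y x f fY τ ε β βhat Qhat m grid)
    (hkernel : UQPE.KernelAssumption K r)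
    (hbandwidth : UQPE.BandwidthAssumption h a r)
    (hdensity : UQPE.DensityAssumption (μ.map (x 0)).support fX f fY r)
    (happrox : UQPE.ApproxAssumption μ (μ.map (x 0)).support f ε
      (UQPE.quantile (μ.map (y 0)) τ) β ξ βhat Qhat ξhat) :
    UQPE.IsLittleOp μ
      (fun n ω =>
        UQPE.nadarayaWatson K (h n) n (fun i => y i ω)
            (fun i => βhat n (ξhat n (x i ω) ω) ω 0) (Qhat n ω)
          - UQPE.nadarayaWatson K (h n) n (fun i => y i ω)
            (fun i => β (ξ (x i ω)) 0) (UQPE.quantile (μ.map (y 0)) τ))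
      (fun n => (n : ℝ) ^ (-(1 / 2) : ℝ) * h n ^ (-(1 / 2) : ℝ)) := by
  obtain ⟨D, hD⟩ := hdensity.exists_abs_deriv_le
  exact theorem2_general hsample hdens hτ hε hξ
    (fun n x' ω => hmatching.mem_Icc_of_isMatch (hξhat n x' ω)) hmatching.isLinearQuantileModel
    hkernel.isSmoothKernel hbandwidth.isAdmissibleBandwidth (fun _ => hdensity.contDiff_one) hD
    happrox
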